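/- Let $0<k<1$, $k'=\sqrt{1-k^2}$, $K=K(k)=\int_0^{\pi/2}(1-k^2\sin^2u)^{-1/2}\,du$, $\tau=iK(k')/K(k)$, and let $\theta_1,\dots,\theta_4$ be the Jacobi theta functions with period $\tau$, $\theta_3(z)=\sum_{n\in\mathbb Z}e^{i\pi(n^2\tau+2nz)}$, $\theta_4(z)=\theta_3(z+\tfrac12)$, $\theta_2(z)=e^{i\pi(\tau/4+z)}\theta_3(z+\tfrac\tau2)$, $\theta_1(z)=-ie^{i\pi(\tau/4+z)}\theta_3(z+\tfrac12+\tfrac\tau2)$; write $\theta_s=\theta_s(0)$. Let $\mathcal C$ be the curve $\eta^2+\frac{K^2}{4}\left(\zeta^4+2(k^2-k'^2)\zeta^2+1\right)=0$ and $\infty_1$ its point at infinity at which $\eta/\zeta^2\to -iK/2$. Let $x=(x_1,x_2,x_3)\in\mathbb R^3$, $x_\pm=x_1\pm ix_2$, $r^2=x_1^2+x_2^2+x_3^2$, $\lambda=\frac18K^2(1-2k^2)$, and assume $X:=K^2-4x_-^2\neq0$. Substituting $\eta=(x_2-ix_1)-2x_3\zeta-(x_2+ix_1)\zeta^2$ into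 the equation of $\mathcal C$ gives a quartic in $\zeta$; let $\zeta_1,\dots,\zeta_4$ be its roots (with multiplicity), $\eta_r$ the corresponding values of $\eta$, and $P_r=(\zeta_r,\eta_r)$. Let $\alpha_r=\int_{\infty_1}^{P_r}\frac{d\zeta}{4\eta}$, along contours on $\mathcal C$ chosen so that $\alpha_1+\alpha_2+\alpha_3+\alpha_4=N\tau$ with $N\in\mathbb Z$, and put $$\mu_r=\tfrac14\Big(\frac{\theta_1'(\alpha_r)}{\theta_1(\alpha_r)}+\frac{\theta_3'(\alpha_r)}{\theta_3(\alpha_r)}\Big)+i\pi N-i\left[(x_1-ix_2)\zeta_r-ix_3\right].$$ Let $f_3(z)=\frac{\pi\theta_2\theta_4}{2}\,\frac{\theta_4(z/2)}{\theta_2(z/2)}$, $F=\cosh\left(\frac12\int_0^zf_3\right)$, $G=\sinh\left(\frac12\int_0^zf_3\right)$, $C(z)=\begin{pmatrix}F&G\\G&F\end{pmatrix}$, $\mathcal O=\frac1{\sqrt2}\begin{pmatrix}1&-1\\1&1\end{pmatrix}$. For $\{i,j,m,l\}=\{1,2,3,4\}$ let $$\bar v_i(z)=\left(1_2\otimes\mathcal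 O\,C(z)^{-1}\right)\frac{1}{\theta_2(z/2)^2}\,\bar\Lambda_i(z),\qquad \bar\Lambda_i=\left[\begin{pmatrix}-i\zeta_j\\1\end{pmatrix}\otimes\begin{pmatrix}A\\B\end{pmatrix}+\begin{pmatrix}1\\0\end{pmatrix}\otimes\begin{pmatrix}a\\b\end{pmatrix}\right]e^{-z\mu_i},$$ where $$A=\frac{\theta_2(\frac z2)\,\theta_2(\sum_{s\ne i}\alpha_s-\frac z2)}{\prod_{s\neq i}\theta_3(\alpha_s)},\qquad B=\frac{\theta_2(\frac z2)\,\theta_4(\sum_{s\ne i}\alpha_s-\frac z2)}{\prod_{s\ne i}\theta_1(\alpha_s)},$$ $$a=D\,\frac{\theta_4(\alpha_j-\frac z2)}{\theta_3(\alpha_j)},\qquad b=D\,\frac{\theta_2(\alpha_j-\frac z2)}{\theta_1(\alpha_j)},\qquad D=\frac{\theta_2\theta_4\,\theta_3(\alpha_j+\alpha_m)\,\theta_3(\alpha_j+\alpha_l)\,\theta_4(\alpha_m+\alpha_l-\frac z2)}{\prod_{s\ne i}\theta_1(\alpha_s)\theta_3(\alpha_s)}.$$ (Up to a constant factor, $\bar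 v_i$ is the $i$-th column of the matrix $\overline V$.) Put $$N_i=\frac{4}{\theta_1'(0)^2}\sqrt K\,\theta_2\theta_4\,\frac{\prod_{p<q;\ p,q\ne i}\theta_3(\alpha_p+\alpha_q)}{\prod_{s\ne i}\theta_1(\alpha_s)\theta_3(\alpha_s)}\,e^{-\mu_i}.$$ Then $N_i\neq0$ and, as $\xi\to0^+$, at $z=1-\xi$, $$\bar v_i=N_i\left(\frac1{\xi^{3/2}}\begin{pmatrix}0\\1\\-1\\0\end{pmatrix}+\frac1{\xi^{1/2}}\begin{pmatrix}-x_1-ix_2\\x_3\\x_3\\x_1-ix_2\end{pmatrix}+\frac{\bar v_{i,3}}{N_i}\,\xi^{1/2}+O(\xi^{3/2})\right),$$ $$\frac{\bar v_{i,3}}{N_i}=\begin{pmatrix}E_i\\-\frac18X\zeta_i^2-2ix_-x_3\zeta_i+\lambda-\frac32x_3^2\\-\frac18X\zeta_i^2-2ix_-x_3\zeta_i+\lambda+x_+x_--\frac12x_3^2\\\frac i4X\zeta_i-x_-x_3\end{pmatrix},$$ where $E_i$ is given by each of the following equivalent expressions (the first for every $j\neq i$): $$\tfrac i4(\zeta_i^2+\zeta_i\zeta_j+\zeta_j^2)\zeta_jX-x_+x_3-2i(r^2-3x_3^2+2\lambda)\zeta_j-4x_-x_3\zeta_j(\zeta_i+\zeta_j),$$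 $$-\tfrac i4X\zeta_i^3+4x_-x_3\zeta_i^2+2i(r^2-3x_3^2+2\lambda)\zeta_i+3x_+x_3,$$ $$\tfrac i4\,\frac{K^2-4x_+^2}{\zeta_i}-x_+x_3.$$ -/

import Mathlib

open Filter Topology Polynomial Kronecker

noncomputable section

namespace Monopole

/-- The complete elliptic integral of the first kind `K(k) = ∫₀^{π/2} du / √(1 - k² sin² u)`. -/
def ellK (k : ℝ) : ℝ :=
  ∫ u in (0 : ℝ)..(Real.pi / 2), 1 / Real.sqrt (1 - k ^ 2 * Real.sin u ^ 2)

/-- The complementary modulus `k' = √(1 - k²)`. -/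
def compl (k : ℝ) : ℝ := Real.sqrt (1 - k ^ 2)

/-- The period `τ = i K(k') / K(k)`. -/
def tau (k : ℝ) : ℂ := Complex.I * (ellK (compl k) : ℂ) / (ellK k : ℂ)

/-! ### Jacobi theta functions

`θ₃(z|τ) = ∑ₙ exp(iπ(n²τ + 2nz))` is Mathlib's `jacobiTheta₂ z τ`; the others are its
translates by half periods, normalised so that `θ₁(z) = 2 e^{iπτ/4} sin(πz) - ⋯`. -/

def theta3 (τ z : ℂ) : ℂ := jacobiTheta₂ z τ

def theta4 (τ z : ℂ) : ℂ := jacobiTheta₂ (z + 1 / 2) τ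

def theta2 (τ z : ℂ) : ℂ :=
  Complex.exp (Complex.I * Real.pi * (τ / 4 + z)) * jacobiTheta₂ (z + τ / 2) τ

def theta1 (τ z : ℂ) : ℂ :=
  -Complex.I * Complex.exp (Complex.I * Real.pi * (τ / 4 + z)) *
    jacobiTheta₂ (z + 1 / 2 + τ / 2) τ

/-! ### The spectral curve and the mini-twistor correspondence -/

/-- `(ζ, η)` lies on the charge two spectral curve
`η² + (K²/4)(ζ⁴ + 2(k² - k'²)ζ² + 1) = 0`. -/
def OnCurve (k : ℝ) (ζ η : ℂ) : Prop :=
  η ^ 2 + (ellK k : ℂ) ^ 2 / 4 *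
    (ζ ^ 4 + 2 * ((k : ℂ) ^ 2 - (compl k : ℂ) ^ 2) * ζ ^ 2 + 1) = 0

/-- The mini-twistor polynomial `(x₂ - i x₁) - 2 x₃ ζ - (x₂ + i x₁) ζ²` in `ζ`. -/
def twistor (x₁ x₂ x₃ : ℝ) : ℂ[X] :=
  C ((x₂ : ℂ) - Complex.I * x₁) - C (2 * (x₃ : ℂ)) * X - C ((x₂ : ℂ) + Complex.I * x₁) * X ^ 2

/-- The Atiyah–Ward quartic: the mini-twistor relation substituted into the curve. -/
def atiyahWard (k x₁ x₂ x₃ : ℝ) : ℂ[X] :=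
  twistor x₁ x₂ x₃ ^ 2 + C ((ellK k : ℂ) ^ 2 / 4) *
    (X ^ 4 + C (2 * ((k : ℂ) ^ 2 - (compl k : ℂ) ^ 2)) * X ^ 2 + 1)

/-- `a` is a value of the Abel map `∫_{∞₁}^{(ζ,η)} dζ/(4η)`, along some contour on the curve.
The contour is `t ↦ (p t, q t)`, `0 < t ≤ 1`. It starts at `∞₁`, the point at infinity at
which `η/ζ² → -iK/2`; its interior is `C¹` and avoids the branch points
(the end point itself may be a branch point). -/
def IsAbelImage (k : ℝ) (ζ η a : ℂ) : Prop :=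
  ∃ p q : ℝ → ℂ,
    ContinuousOn p (Set.Ioc 0 1) ∧ ContinuousOn q (Set.Ioc 0 1) ∧
    ContDiffOn ℝ 1 p (Set.Ioo 0 1) ∧
    (∀ t ∈ Set.Ioc (0 : ℝ) 1, OnCurve k (p t) (q t)) ∧
    (∀ t ∈ Set.Ioo (0 : ℝ) 1, q t ≠ 0) ∧
    Tendsto (fun t => ‖p t‖) (𝓝[>] 0) atTop ∧
    Tendsto (fun t => q t / p t ^ 2) (𝓝[>] 0) (𝓝 (-Complex.I * (ellK k : ℂ) / 2)) ∧
    p 1 = ζ ∧ q 1 = η ∧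
    IntervalIntegrable (fun t => deriv p t / (4 * q t)) MeasureTheory.volume 0 1 ∧
    a = ∫ t in (0 : ℝ)..1, deriv p t / (4 * q t)

/-- `β₁ = (1/4) (θ₁'/θ₁ + θ₃'/θ₃)` at the Abel image `a`. -/
def beta1 (k : ℝ) (a : ℂ) : ℂ :=
  (logDeriv (theta1 (tau k)) a + logDeriv (theta3 (tau k)) a) / 4

/-- `μ = β₁ + iπN - i[(x₁ - i x₂)ζ - i x₃]`. -/
def mu (k x₁ x₂ x₃ : ℝ) (N : ℤ) (ζ a : ℂ) : ℂ :=
  beta1 k a + Complex.I * Real.pi * N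
    - Complex.I * (((x₁ : ℂ) - Complex.I * x₂) * ζ - Complex.I * x₃)

/-! ### The gauge transformation -/

/-- The Nahm function `f₃(z) = (π θ₂ θ₄ / 2) θ₄(z/2)/θ₂(z/2) = K k' / cn(Kz)`. -/
def nahmF3 (k z : ℝ) : ℂ :=
  Real.pi * theta2 (tau k) 0 * theta4 (tau k) 0 / 2 *
    (theta4 (tau k) (z / 2) / theta2 (tau k) (z / 2))

/-- `C(z) = (F G; G F)`, `F = cosh (∫₀^z f₃/2)`, `G = sinh (∫₀^z f₃/2)`. -/
def gaugeC (k z : ℝ) : Matrix (Fin 2) (Fin 2) ℂ :=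
  let I₃ : ℂ := (∫ s in (0 : ℝ)..z, nahmF3 k s) / 2
  !![Complex.cosh I₃, Complex.sinh I₃; Complex.sinh I₃, Complex.cosh I₃]

/-- The orthogonal matrix `𝒪 = (1/√2) (1 -1; 1 1)`. -/
def orthO : Matrix (Fin 2) (Fin 2) ℂ :=
  (1 / (Real.sqrt 2 : ℂ)) • !![1, -1; 1, 1]

/-- `1₂ ⊗ M` as a `4 × 4` matrix (two diagonal blocks `M`). -/
def oneTensor (M : Matrix (Fin 2) (Fin 2) ℂ) : Matrix (Fin 4) (Fin 4) ℂ :=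
  Matrix.reindex finProdFinEquiv finProdFinEquiv ((1 : Matrix (Fin 2) (Fin 2) ℂ) ⊗ₖ M)

/-! ### The vectors `Λ̄ᵢ`, `v̄ᵢ` and the normalisation `Nᵢ` -/

/-- The vector `Λ̄ᵢ(z)`, written with a labelling `(i, j, m, l)` of the four points. -/
def lambdaBar (k x₁ x₂ x₃ : ℝ) (N : ℤ) (ζ α : Fin 4 → ℂ) (i j m l : Fin 4) (z : ℝ) :
    Fin 4 → ℂ :=
  let θ₁ := theta1 (tau k)
  let θ₂ := theta2 (tau k)
  let θ₃ := theta3 (tau k)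
  let θ₄ := theta4 (tau k)
  let S : ℂ := ∑ r ∈ Finset.univ.erase i, α r
  let A : ℂ := θ₂ (z / 2) * θ₂ (S - z / 2) / ∏ s ∈ Finset.univ.erase i, θ₃ (α s)
  let B : ℂ := θ₂ (z / 2) * θ₄ (S - z / 2) / ∏ s ∈ Finset.univ.erase i, θ₁ (α s)
  let a : ℂ := θ₂ 0 * θ₄ 0 * θ₃ (α j + α m) * θ₃ (α j + α l) * θ₄ (α j - z / 2)
      * θ₄ (α m + α l - z / 2)
      / (θ₃ (α j) * ∏ s ∈ Finset.univ.erase i, θ₁ (α s) * θ₃ (α s))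
  let b : ℂ := θ₂ 0 * θ₄ 0 * θ₃ (α j + α m) * θ₃ (α j + α l) * θ₂ (α j - z / 2)
      * θ₄ (α m + α l - z / 2)
      / (θ₁ (α j) * ∏ s ∈ Finset.univ.erase i, θ₁ (α s) * θ₃ (α s))
  Complex.exp (-z * mu k x₁ x₂ x₃ N (ζ i) (α i)) •
    ![-Complex.I * ζ j * A + a, -Complex.I * ζ j * B + b, A, B]

/-- `v̄ᵢ(z) = (1₂ ⊗ 𝒪 C(z)⁻¹) θ₂(z/2)⁻² Λ̄ᵢ(z)`. -/
def vBar (k x₁ x₂ x₃ : ℝ) (N : ℤ) (ζ α : Fin 4 → ℂ) (i j m l : Fin 4) (z : ℝ) :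
    Fin 4 → ℂ :=
  (oneTensor (orthO * (gaugeC k z)⁻¹)).mulVec
    ((1 / theta2 (tau k) (z / 2) ^ 2) • lambdaBar k x₁ x₂ x₃ N ζ α i j m l z)

/-- The normalisation `Nᵢ`, with the constant `c = 4 / θ₁'(0)²`. -/
def normN (k x₁ x₂ x₃ : ℝ) (N : ℤ) (ζ α : Fin 4 → ℂ) (i : Fin 4) : ℂ :=
  4 / deriv (theta1 (tau k)) 0 ^ 2 * (Real.sqrt (ellK k) : ℂ)
    * theta2 (tau k) 0 * theta4 (tau k) 0
    * ((∏ p ∈ (Finset.univ : Finset (Fin 4 × Fin 4)).filter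
          (fun p => p.1 < p.2 ∧ p.1 ≠ i ∧ p.2 ≠ i), theta3 (tau k) (α p.1 + α p.2))
      / ∏ r ∈ Finset.univ.erase i, theta1 (tau k) (α r) * theta3 (tau k) (α r))
    * Complex.exp (-mu k x₁ x₂ x₃ N (ζ i) (α i))

/-! ### The coefficients of the expansion -/

def xPlus (x₁ x₂ : ℝ) : ℂ := x₁ + Complex.I * x₂

def xMinus (x₁ x₂ : ℝ) : ℂ := x₁ - Complex.I * x₂

/-- `λ = K²(1 - 2k²)/8`. -/
def lam (k : ℝ) : ℂ := (ellK k : ℂ) ^ 2 * (1 - 2 * (k : ℂ) ^ 2) / 8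

/-- `X = K² - 4 x₋²`. -/
def bigX (k x₁ x₂ : ℝ) : ℂ := (ellK k : ℂ) ^ 2 - 4 * xMinus x₁ x₂ ^ 2

/-- `r² - 3 x₃² + 2λ`, with `r² = x₁² + x₂² + x₃²`. -/
def bigR (k x₁ x₂ x₃ : ℝ) : ℂ :=
  ((x₁ : ℂ) ^ 2 + (x₂ : ℂ) ^ 2 + (x₃ : ℂ) ^ 2) - 3 * (x₃ : ℂ) ^ 2 + 2 * lam k

/-- Coefficient of `ξ^{-3/2}`. -/
def poleVec0 : Fin 4 → ℂ := ![0, 1, -1, 0]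

/-- Coefficient of `ξ^{-1/2}`. -/
def poleVec1 (x₁ x₂ x₃ : ℝ) : Fin 4 → ℂ :=
  ![-(x₁ : ℂ) - Complex.I * x₂, x₃, x₃, (x₁ : ℂ) - Complex.I * x₂]

/-- The finite term with prescribed first entry `a`; `w` stands for `ζᵢ`.
The last three entries are common to the three representations. -/
def finiteVec (k x₁ x₂ x₃ : ℝ) (w a : ℂ) : Fin 4 → ℂ :=
  ![a,
    -(1 / 8) * bigX k x₁ x₂ * w ^ 2 - 2 * Complex.I * xMinus x₁ x₂ * x₃ * w + lam k
      - 3 / 2 * (x₃ : ℂ) ^ 2,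
    -(1 / 8) * bigX k x₁ x₂ * w ^ 2 - 2 * Complex.I * xMinus x₁ x₂ * x₃ * w + lam k
      + xPlus x₁ x₂ * xMinus x₁ x₂ - 1 / 2 * (x₃ : ℂ) ^ 2,
    Complex.I / 4 * bigX k x₁ x₂ * w - xMinus x₁ x₂ * x₃]

/-- First representation of the first entry, in terms of `w = ζᵢ` and `u = ζⱼ`, `j ≠ i`. -/
def firstEntryA (k x₁ x₂ x₃ : ℝ) (w u : ℂ) : ℂ :=
  Complex.I / 4 * (w ^ 2 + w * u + u ^ 2) * u * bigX k x₁ x₂ - xPlus x₁ x₂ * x₃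
    - 2 * Complex.I * bigR k x₁ x₂ x₃ * u - 4 * xMinus x₁ x₂ * x₃ * u * (w + u)

/-- Second representation of the first entry, `w = ζᵢ`. -/
def firstEntryB (k x₁ x₂ x₃ : ℝ) (w : ℂ) : ℂ :=
  -(Complex.I / 4) * bigX k x₁ x₂ * w ^ 3 + 4 * xMinus x₁ x₂ * x₃ * w ^ 2
    + 2 * Complex.I * bigR k x₁ x₂ x₃ * w + 3 * xPlus x₁ x₂ * x₃

/-- Third representation of the first entry, `w = ζᵢ`. -/
def firstEntryC (k x₁ x₂ x₃ : ℝ) (w : ℂ) : ℂ :=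
  Complex.I / 4 * (((ellK k : ℂ) ^ 2 - 4 * xPlus x₁ x₂ ^ 2) / w) - xPlus x₁ x₂ * x₃

end Monopole

end

noncomputable section

namespace Monopole

/-! ### Half-period shifts, parity and quasi-periodicity of the theta functions -/

/-! Put w = ξ/2. At z = 1 - ξ the argument z/2 equals 1/2 - w, and the half-period shift turns θ₂,
θ₄ into θ₁, θ₃; the singularity at z = 1 becomes the simple zero of θ₁ at w = 0. The claim is then
that ξ^{3/2} v̄ᵢ/Nᵢ is an analytic germ in w, of which the coefficients of order 0, 1 and 2 are
computed.

Geometry. The Abel map is inverted by ζ = -iθ₂θ₄/(θ₁θ₃), for which dζ = 4η dα (`Params.abelImage`).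
This needs the theta constants at τ = iK'/K to have modulus k, and K = πθ₃²/2 (`nonempty_params`);
both rest on Jacobi's formula `deriv_theta1_zero`. Replacing αᵢ by a = αᵢ - Nτ makes the four Abel
images sum to zero, and the term iπN of μᵢ absorbs the resulting jump of β₁ (`Params.linePoints`,
`Params.two_mul_mu`).

Algebra. For two points where the curve meets a mini-twistor line, an addition theorem expresses
quotients of θ₁ and θ₃ through ζ linearly (`Params.addition_of_quarticDD`). Applied to complementary
pairs and combined with Riemann's quartic relation, it evaluates ∏θ₁ and ∏θ₃ over the four points
(`LinePoints.prod_theta1`, `LinePoints.prod_theta3`). The dependence on αⱼ, αₘ, αₗ then collects in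
one constant factor, and the entries of Λ̄ᵢ become combinations of y₁ and y₃, proportional to θ₁(w -
a)e^{2wμ}/θ₁(w) and θ₃(w - a)e^{2wμ}/θ₁(w), with coefficients built from ζᵢ and ρ = πθ₂θ₄
θ₃(w)/θ₁(w) (`lambdaBar_eq`).

Analysis. With q = iKζᵢ and p = -2ix₋ζᵢ - 2x₃ one has y₁' = (p + q)y₁ - ρy₃ and y₃' = (p - q)y₃ -
ρy₁. The gauge factor satisfies exp ∫f₃ = iζ(w/2), whose logarithmic derivative in w is -ρ, and ρ
solves an elliptic equation. Comparing coefficients in these equations (`Expands.unique`) gives all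
the expansions, except for one resonant coefficient of y₃ - y₁. That one is computed directly and
equals an expression in η, which the mini-twistor relation makes quadratic in ζᵢ. Multiplying out
(`Params.expands_entryGerm`) yields the second form of the first entry; the other two forms differ
from it by multiples of a divided difference of the quartic, or of the quartic itself, at its roots.
-/

lemma exp_I_pi_half : Complex.exp (Complex.I * Real.pi * (1 / 2)) = Complex.I := by
  rw [show Complex.I * Real.pi * (1 / 2) = (Real.pi / 2 : ℂ) * Complex.I by ring,
    Complex.exp_pi_div_two_mul_I]

lemma theta3_add_half (τ z : ℂ) : theta3 τ (z + 1 / 2) = theta4 τ z := rfl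

lemma theta3_add_one (τ z : ℂ) : theta3 τ (z + 1) = theta3 τ z := jacobiTheta₂_add_left z τ

lemma theta4_add_half (τ z : ℂ) : theta4 τ (z + 1 / 2) = theta3 τ z := by
  rw [theta4, add_assoc, show (1 / 2 : ℂ) + 1 / 2 = 1 by norm_num]
  exact theta3_add_one τ z

lemma theta2_add_half (τ z : ℂ) : theta2 τ (z + 1 / 2) = -theta1 τ z := by
  rw [theta2, theta1, show Complex.I * Real.pi * (τ / 4 + (z + 1 / 2)) =
    Complex.I * Real.pi * (τ / 4 + z) + Complex.I * Real.pi * (1 / 2) by ring, Complex.exp_add,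
    exp_I_pi_half]
  ring

lemma theta1_add_half (τ z : ℂ) : theta1 τ (z + 1 / 2) = theta2 τ z := by
  rw [theta2, theta1, show Complex.I * Real.pi * (τ / 4 + (z + 1 / 2)) =
    Complex.I * Real.pi * (τ / 4 + z) + Complex.I * Real.pi * (1 / 2) by ring, Complex.exp_add,
    exp_I_pi_half, show z + 1 / 2 + 1 / 2 + τ / 2 = (z + τ / 2) + 1 by ring,
    jacobiTheta₂_add_left]
  linear_combination (-Complex.exp (Complex.I * Real.pi * (τ / 4 + z)) *
    jacobiTheta₂ (z + τ / 2) τ) * Complex.I_sq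

lemma theta3_neg (τ z : ℂ) : theta3 τ (-z) = theta3 τ z := jacobiTheta₂_neg_left z τ

lemma theta4_neg (τ z : ℂ) : theta4 τ (-z) = theta4 τ z := by
  rw [← theta3_add_half, ← theta3_add_half, ← theta3_neg, ← theta3_add_one]
  congr 1; ring

lemma theta3_add_tau (τ z : ℂ) :
    theta3 τ (z + τ) = Complex.exp (-Real.pi * Complex.I * (τ + 2 * z)) * theta3 τ z :=
  jacobiTheta₂_add_left' z τ

lemma theta2_neg (τ z : ℂ) : theta2 τ (-z) = theta2 τ z := by
  have h := theta3_add_tau τ (-z - τ / 2)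
  rw [show -z - τ / 2 + τ = -z + τ / 2 by ring,
    show -z - τ / 2 = -(z + τ / 2) by ring, theta3_neg] at h
  simp only [theta3] at h
  rw [theta2, theta2, h, ← mul_assoc, ← Complex.exp_add]
  congr 2; ring

lemma theta1_neg (τ z : ℂ) : theta1 τ (-z) = -theta1 τ z := by
  have h := theta2_add_half τ (-z - 1 / 2 - 1 / 2)
  have h1 := theta2_add_half τ (-z - 1 / 2)
  rw [show -z - 1 / 2 + 1 / 2 = -z by ring, theta2_neg] at h1
  have h2 := theta1_add_half τ (-z - 1 / 2)
  rw [show -z - 1 / 2 + 1 / 2 = -z by ring, show -z - 1 / 2 = -(z + 1 / 2) by ring, theta2_neg,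
    theta2_add_half] at h2
  exact h2

lemma theta2_add_one (τ z : ℂ) : theta2 τ (z + 1) = -theta2 τ z := by
  rw [show z + 1 = z + 1 / 2 + 1 / 2 by ring, theta2_add_half, theta1_add_half]

lemma theta1_add_one (τ z : ℂ) : theta1 τ (z + 1) = -theta1 τ z := by
  rw [show z + 1 = z + 1 / 2 + 1 / 2 by ring, theta1_add_half, theta2_add_half]

lemma theta1_zero (τ : ℂ) : theta1 τ 0 = 0 := by
  have := theta1_neg τ 0
  rw [neg_zero] at this
  linear_combination this / 2

lemma theta4_add_tau (τ z : ℂ) :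
    theta4 τ (z + τ) = -Complex.exp (-Real.pi * Complex.I * (τ + 2 * z)) * theta4 τ z := by
  rw [← theta3_add_half, ← theta3_add_half, show z + τ + 1 / 2 = z + 1 / 2 + τ by ring,
    theta3_add_tau, show -Real.pi * Complex.I * (τ + 2 * (z + 1 / 2)) =
      -Real.pi * Complex.I * (τ + 2 * z) + -(Real.pi * Complex.I) by ring, Complex.exp_add,
    Complex.exp_neg, Complex.exp_pi_mul_I]
  ring

lemma theta2_add_tau (τ z : ℂ) :
    theta2 τ (z + τ) = Complex.exp (-Real.pi * Complex.I * (τ + 2 * z)) * theta2 τ z := by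
  have h := theta3_add_tau τ (z + τ / 2)
  simp only [theta3] at h
  rw [theta2, theta2, show z + τ + τ / 2 = z + τ / 2 + τ by ring, h, ← mul_assoc,
    ← Complex.exp_add, ← mul_assoc, ← Complex.exp_add]
  congr 2; ring

lemma theta1_add_tau (τ z : ℂ) :
    theta1 τ (z + τ) = -Complex.exp (-Real.pi * Complex.I * (τ + 2 * z)) * theta1 τ z := by
  have h := theta2_add_tau τ (z + 1 / 2)
  rw [show z + 1 / 2 + τ = z + τ + 1 / 2 by ring, theta2_add_half, theta2_add_half,
    show -Real.pi * Complex.I * (τ + 2 * (z + 1 / 2)) =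
      -Real.pi * Complex.I * (τ + 2 * z) + -(Real.pi * Complex.I) by ring, Complex.exp_add,
    Complex.exp_neg, Complex.exp_pi_mul_I] at h
  linear_combination -h

/-! ### Analyticity -/

lemma differentiable_theta3 {τ : ℂ} (hτ : 0 < τ.im) : Differentiable ℂ (theta3 τ) :=
  fun z => differentiableAt_jacobiTheta₂_fst z hτ

lemma differentiable_theta4 {τ : ℂ} (hτ : 0 < τ.im) : Differentiable ℂ (theta4 τ) :=
  (differentiable_theta3 hτ).comp (differentiable_id.add_const (1 / 2))

lemma differentiable_theta2 {τ : ℂ} (hτ : 0 < τ.im) : Differentiable ℂ (theta2 τ) :=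
  (Complex.differentiable_exp.comp ((differentiable_id.const_add _).const_mul _)).mul
    ((differentiable_theta3 hτ).comp (differentiable_id.add_const (τ / 2)))

lemma differentiable_theta1 {τ : ℂ} (hτ : 0 < τ.im) : Differentiable ℂ (theta1 τ) := by
  have : theta1 τ = fun z => -theta2 τ (z + 1 / 2) := by
    funext z; rw [theta2_add_half, neg_neg]
  rw [this]
  exact ((differentiable_theta2 hτ).comp (differentiable_id.add_const (1 / 2))).neg

/-! ### Duplication of the period -/

lemma summable_norm_theta_term {τ : ℂ} (hτ : 0 < τ.im) (z : ℂ) :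
    Summable fun n : ℤ => ‖jacobiTheta₂_term n z τ‖ :=
  ((summable_jacobiTheta₂_term_iff z τ).mpr hτ).norm

lemma hasSum_theta_mul {τ σ : ℂ} (hτ : 0 < τ.im) (hσ : 0 < σ.im) (x y : ℂ) :
    HasSum (fun n : ℤ × ℤ => jacobiTheta₂_term n.1 x τ * jacobiTheta₂_term n.2 y σ)
      (jacobiTheta₂ x τ * jacobiTheta₂ y σ) := by
  have h : Summable fun n : ℤ × ℤ => jacobiTheta₂_term n.1 x τ * jacobiTheta₂_term n.2 y σ :=
    summable_mul_of_summable_norm (f := fun n => jacobiTheta₂_term n x τ)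
      (g := fun n => jacobiTheta₂_term n y σ) (summable_norm_theta_term hτ x)
      (summable_norm_theta_term hσ y)
  exact HasSum.mul (f := fun n => jacobiTheta₂_term n x τ)
    (g := fun n => jacobiTheta₂_term n y σ)
    (hasSum_jacobiTheta₂_term x hτ) (hasSum_jacobiTheta₂_term y hσ) h

/-- Sort the pairs of the double series by the parity of their sum. On pairs (a + b, a - b) the
quadratic form is 2a² + 2b² and the linear term is a(x + y) + b(x - y), so the series factorises
with period 2τ; on pairs of odd sum a and b are moved by 1/2, which gives θ₂ in place of θ₃. -/
theorem theta3_mul_theta3 {τ : ℂ} (hτ : 0 < τ.im) (x y : ℂ) :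
    theta3 τ x * theta3 τ y =
      theta3 (2 * τ) (x + y) * theta3 (2 * τ) (x - y)
        + theta2 (2 * τ) (x + y) * theta2 (2 * τ) (x - y) := by
  have hτ2 : 0 < (2 * τ).im := by simpa using hτ
  have hL := hasSum_theta_mul hτ hτ x y
  let e : ℤ × ℤ → ℤ × ℤ := fun n => (n.1 + n.2, n.1 - n.2)
  let o : ℤ × ℤ → ℤ × ℤ := fun n => (n.1 + n.2 + 1, n.1 - n.2)
  have he : Function.Injective e := by
    rintro ⟨a, b⟩ ⟨c, d⟩ h
    simp only [e, Prod.mk.injEq] at h ⊢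
    omega
  have ho : Function.Injective o := by
    rintro ⟨a, b⟩ ⟨c, d⟩ h
    simp only [o, Prod.mk.injEq] at h ⊢
    omega
  have hc : IsCompl (Set.range e) (Set.range o) := by
    refine ⟨Set.disjoint_left.mpr ?_, codisjoint_iff_le_sup.mpr ?_⟩
    · rintro _ ⟨⟨a, b⟩, rfl⟩ ⟨⟨c, d⟩, h⟩
      simp only [e, o, Prod.mk.injEq] at h
      omega
    · rintro ⟨m, n⟩ -
      rcases Int.even_or_odd' (m + n) with ⟨a, ha | ha⟩
      · exact Or.inl ⟨(a, m - a), by simp only [e, Prod.mk.injEq]; omega⟩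
      · exact Or.inr ⟨(a, m - a - 1), by simp only [o, Prod.mk.injEq]; omega⟩
  have hE : HasSum ((fun n : ℤ × ℤ => jacobiTheta₂_term n.1 x τ * jacobiTheta₂_term n.2 y τ) ∘ e)
      (theta3 (2 * τ) (x + y) * theta3 (2 * τ) (x - y)) := by
    have h := hasSum_theta_mul hτ2 hτ2 (x + y) (x - y)
    refine Eq.subst (motive := fun f => HasSum f (jacobiTheta₂ (x + y) (2 * τ)
      * jacobiTheta₂ (x - y) (2 * τ))) (funext ?_) h
    rintro ⟨a, b⟩
    simp only [Function.comp_apply, e, jacobiTheta₂_term, ← Complex.exp_add]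
    congr 1
    push_cast
    ring
  have hO : HasSum ((fun n : ℤ × ℤ => jacobiTheta₂_term n.1 x τ * jacobiTheta₂_term n.2 y τ) ∘ o)
      (theta2 (2 * τ) (x + y) * theta2 (2 * τ) (x - y)) := by
    have h := (hasSum_theta_mul hτ2 hτ2 (x + y + 2 * τ / 2) (x - y + 2 * τ / 2)).mul_left
      (Complex.exp (Complex.I * Real.pi * (2 * τ / 4 + (x + y)))
        * Complex.exp (Complex.I * Real.pi * (2 * τ / 4 + (x - y))))
    have hv : theta2 (2 * τ) (x + y) * theta2 (2 * τ) (x - y) =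
        Complex.exp (Complex.I * Real.pi * (2 * τ / 4 + (x + y)))
          * Complex.exp (Complex.I * Real.pi * (2 * τ / 4 + (x - y)))
          * (jacobiTheta₂ (x + y + 2 * τ / 2) (2 * τ)
            * jacobiTheta₂ (x - y + 2 * τ / 2) (2 * τ)) := by
      simp only [theta2]
      ring
    rw [hv]
    refine Eq.subst (motive := fun f => HasSum f _) (funext ?_) h
    rintro ⟨a, b⟩
    simp only [Function.comp_apply, o, jacobiTheta₂_term, ← Complex.exp_add]
    congr 1
    push_cast
    ring
  exact hL.unique
    (HasSum.add_isCompl hc (he.hasSum_range_iff.mpr hE) (ho.hasSum_range_iff.mpr hO))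

theorem theta4_mul_theta4 {τ : ℂ} (hτ : 0 < τ.im) (x y : ℂ) :
    theta4 τ x * theta4 τ y =
      theta3 (2 * τ) (x + y) * theta3 (2 * τ) (x - y)
        - theta2 (2 * τ) (x + y) * theta2 (2 * τ) (x - y) := by
  rw [← theta3_add_half, ← theta3_add_half, theta3_mul_theta3 hτ,
    show x + 1 / 2 + (y + 1 / 2) = x + y + 1 by ring, theta3_add_one, theta2_add_one,
    show x + 1 / 2 - (y + 1 / 2) = x - y by ring]
  ring

theorem theta3_mul_theta4 {τ : ℂ} (hτ : 0 < τ.im) (x y : ℂ) :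
    theta3 τ x * theta4 τ y =
      theta4 (2 * τ) (x + y) * theta4 (2 * τ) (x - y)
        - theta1 (2 * τ) (x + y) * theta1 (2 * τ) (x - y) := by
  have h1 := theta4_add_half (2 * τ) (x - (y + 1 / 2))
  have h2 := theta1_add_half (2 * τ) (x - (y + 1 / 2))
  rw [show x - (y + 1 / 2) + 1 / 2 = x - y by ring] at h1 h2
  rw [← theta3_add_half τ y, theta3_mul_theta3 hτ, ← add_assoc, theta3_add_half, theta2_add_half,
    ← h1, ← h2]
  ring

/-- Shift both arguments of `theta3_mul_theta3` by τ/2: the difference is unchanged, while the sum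
moves by τ, a half period for 2τ, which exchanges θ₂ and θ₃ there. -/
theorem theta2_mul_theta2 {τ : ℂ} (hτ : 0 < τ.im) (x y : ℂ) :
    theta2 τ x * theta2 τ y =
      theta2 (2 * τ) (x + y) * theta3 (2 * τ) (x - y)
        + theta3 (2 * τ) (x + y) * theta2 (2 * τ) (x - y) := by
  have h := theta3_mul_theta3 hτ (x + τ / 2) (y + τ / 2)
  rw [show x + τ / 2 + (y + τ / 2) = x + y + τ by ring,
    show x + τ / 2 - (y + τ / 2) = x - y by ring] at h
  have h2 : Complex.exp (Complex.I * Real.pi * (τ / 4 + x)) *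
      Complex.exp (Complex.I * Real.pi * (τ / 4 + y)) * theta3 (2 * τ) (x + y + τ) =
      theta2 (2 * τ) (x + y) := by
    rw [← Complex.exp_add, theta2, show x + y + 2 * τ / 2 = x + y + τ by ring]
    congr 2; ring
  have h3 : Complex.exp (Complex.I * Real.pi * (τ / 4 + x)) *
      Complex.exp (Complex.I * Real.pi * (τ / 4 + y)) * theta2 (2 * τ) (x + y + τ) =
      theta3 (2 * τ) (x + y) := by
    rw [theta2, show x + y + τ + 2 * τ / 2 = x + y + 2 * τ by ring, jacobiTheta₂_add_left', theta3,
      ← mul_assoc, ← mul_assoc, ← Complex.exp_add, ← Complex.exp_add, ← Complex.exp_add]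
    ring_nf
    simp
  rw [← h2, ← h3]
  simp only [theta2, theta3] at h ⊢
  linear_combination (Complex.exp (Complex.I * Real.pi * (τ / 4 + x)) *
      Complex.exp (Complex.I * Real.pi * (τ / 4 + y))) * h

theorem theta1_mul_theta1 {τ : ℂ} (hτ : 0 < τ.im) (x y : ℂ) :
    theta1 τ x * theta1 τ y =
      theta3 (2 * τ) (x + y) * theta2 (2 * τ) (x - y)
        - theta2 (2 * τ) (x + y) * theta3 (2 * τ) (x - y) := by
  have h := theta2_mul_theta2 hτ (x + 1 / 2) (y + 1 / 2)
  rw [theta2_add_half, theta2_add_half,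
    show x + 1 / 2 + (y + 1 / 2) = x + y + 1 by ring, theta3_add_one, theta2_add_one,
    show x + 1 / 2 - (y + 1 / 2) = x - y by ring] at h
  linear_combination h

theorem theta2_mul_theta1 {τ : ℂ} (hτ : 0 < τ.im) (x y : ℂ) :
    theta2 τ x * theta1 τ y =
      theta1 (2 * τ) (x + y) * theta4 (2 * τ) (x - y)
        - theta4 (2 * τ) (x + y) * theta1 (2 * τ) (x - y) := by
  have h := theta2_mul_theta2 hτ x (y + 1 / 2)
  have h1 := theta4_add_half (2 * τ) (x - (y + 1 / 2))
  have h2 := theta1_add_half (2 * τ) (x - (y + 1 / 2))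
  rw [show x - (y + 1 / 2) + 1 / 2 = x - y by ring] at h1 h2
  rw [← add_assoc, theta3_add_half, theta2_add_half, theta2_add_half, ← h1, ← h2] at h
  linear_combination -h

/-! ### Quadratic and addition identities -/

section Addition

variable {τ : ℂ}

/-- Sum and difference are free variables so that every product can be expanded at prescribed
arguments. Identities of degree four then become polynomial identities between theta functions of
period 2τ. -/
lemma theta33_of_eq (hτ : 0 < τ.im) (x y s d : ℂ) (hs : x + y = s) (hd : x - y = d) :
    theta3 τ x * theta3 τ y =
      theta3 (2 * τ) s * theta3 (2 * τ) d + theta2 (2 * τ) s * theta2 (2 * τ) d := by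
  rw [theta3_mul_theta3 hτ, hs, hd]

lemma theta11_of_eq (hτ : 0 < τ.im) (x y s d : ℂ) (hs : x + y = s) (hd : x - y = d) :
    theta1 τ x * theta1 τ y =
      theta3 (2 * τ) s * theta2 (2 * τ) d - theta2 (2 * τ) s * theta3 (2 * τ) d := by
  rw [theta1_mul_theta1 hτ, hs, hd]

lemma theta22_of_eq (hτ : 0 < τ.im) (x y s d : ℂ) (hs : x + y = s) (hd : x - y = d) :
    theta2 τ x * theta2 τ y =
      theta2 (2 * τ) s * theta3 (2 * τ) d + theta3 (2 * τ) s * theta2 (2 * τ) d := by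
  rw [theta2_mul_theta2 hτ, hs, hd]

lemma theta44_of_eq (hτ : 0 < τ.im) (x y s d : ℂ) (hs : x + y = s) (hd : x - y = d) :
    theta4 τ x * theta4 τ y =
      theta3 (2 * τ) s * theta3 (2 * τ) d - theta2 (2 * τ) s * theta2 (2 * τ) d := by
  rw [theta4_mul_theta4 hτ, hs, hd]

lemma theta34_of_eq (hτ : 0 < τ.im) (x y s d : ℂ) (hs : x + y = s) (hd : x - y = d) :
    theta3 τ x * theta4 τ y =
      theta4 (2 * τ) s * theta4 (2 * τ) d - theta1 (2 * τ) s * theta1 (2 * τ) d := by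
  rw [theta3_mul_theta4 hτ, hs, hd]

lemma theta21_of_eq (hτ : 0 < τ.im) (x y s d : ℂ) (hs : x + y = s) (hd : x - y = d) :
    theta2 τ x * theta1 τ y =
      theta1 (2 * τ) s * theta4 (2 * τ) d - theta4 (2 * τ) s * theta1 (2 * τ) d := by
  rw [theta2_mul_theta1 hτ, hs, hd]

lemma theta3_sq (hτ : 0 < τ.im) (x : ℂ) : theta3 τ x ^ 2 =
    theta3 (2 * τ) (2 * x) * theta3 (2 * τ) 0 + theta2 (2 * τ) (2 * x) * theta2 (2 * τ) 0 := by
  rw [sq, theta33_of_eq hτ x x (2 * x) 0 (by ring) (by ring)]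

lemma theta4_sq (hτ : 0 < τ.im) (x : ℂ) : theta4 τ x ^ 2 =
    theta3 (2 * τ) (2 * x) * theta3 (2 * τ) 0 - theta2 (2 * τ) (2 * x) * theta2 (2 * τ) 0 := by
  rw [sq, theta44_of_eq hτ x x (2 * x) 0 (by ring) (by ring)]

lemma theta2_sq (hτ : 0 < τ.im) (x : ℂ) : theta2 τ x ^ 2 =
    theta2 (2 * τ) (2 * x) * theta3 (2 * τ) 0 + theta3 (2 * τ) (2 * x) * theta2 (2 * τ) 0 := by
  rw [sq, theta22_of_eq hτ x x (2 * x) 0 (by ring) (by ring)]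

lemma theta1_sq (hτ : 0 < τ.im) (x : ℂ) : theta1 τ x ^ 2 =
    theta3 (2 * τ) (2 * x) * theta2 (2 * τ) 0 - theta2 (2 * τ) (2 * x) * theta3 (2 * τ) 0 := by
  rw [sq, theta11_of_eq hτ x x (2 * x) 0 (by ring) (by ring)]

lemma theta2_sq_eq (hτ : 0 < τ.im) (x : ℂ) : theta3 τ 0 ^ 2 * theta2 τ x ^ 2 =
    theta2 τ 0 ^ 2 * theta3 τ x ^ 2 - theta4 τ 0 ^ 2 * theta1 τ x ^ 2 := by
  simp only [theta3_sq hτ, theta2_sq hτ, theta4_sq hτ, theta1_sq hτ, mul_zero]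
  ring

lemma theta4_sq_eq (hτ : 0 < τ.im) (x : ℂ) : theta3 τ 0 ^ 2 * theta4 τ x ^ 2 =
    theta4 τ 0 ^ 2 * theta3 τ x ^ 2 + theta2 τ 0 ^ 2 * theta1 τ x ^ 2 := by
  simp only [theta3_sq hτ, theta2_sq hτ, theta4_sq hτ, theta1_sq hτ, mul_zero]
  ring

lemma theta4_sq_eq' (hτ : 0 < τ.im) (x : ℂ) : theta2 τ 0 ^ 2 * theta4 τ x ^ 2 =
    theta4 τ 0 ^ 2 * theta2 τ x ^ 2 + theta3 τ 0 ^ 2 * theta1 τ x ^ 2 := by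
  simp only [theta3_sq hτ, theta2_sq hτ, theta4_sq hτ, theta1_sq hτ, mul_zero]
  ring

/-- Jacobi's identity `θ₃⁴ = θ₂⁴ + θ₄⁴` for the theta constants. -/
lemma theta_const_pow_four (hτ : 0 < τ.im) :
    theta3 τ 0 ^ 4 = theta2 τ 0 ^ 4 + theta4 τ 0 ^ 4 := by
  have h : ∀ a : ℂ, a ^ 4 = (a ^ 2) ^ 2 := fun a => by ring
  simp only [h, theta3_sq hτ, theta2_sq hτ, theta4_sq hτ, mul_zero]
  ring

/-- The four factors of each term are grouped in pairs θ₂θ₁ and θ₃θ₄. After expansion to period 2τ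
both sides involve only the arguments x + y and x - y. -/
lemma theta1_add_theta3_sub (hτ : 0 < τ.im) (x y : ℂ) :
    theta1 τ (x + y) * theta3 τ (x - y) * (theta2 τ 0 * theta4 τ 0) =
      theta1 τ x * theta3 τ x * (theta2 τ y * theta4 τ y)
        + theta2 τ x * theta4 τ x * (theta1 τ y * theta3 τ y) := by
  have e1 := theta21_of_eq hτ 0 (x + y) (x + y) (-(x + y)) (by ring) (by ring)
  have e2 := theta34_of_eq hτ (x - y) 0 (x - y) (x - y) (by ring) (by ring)
  have e3 := theta21_of_eq hτ y x (x + y) (-(x - y)) (by ring) (by ring)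
  have e4 := theta34_of_eq hτ x y (x + y) (x - y) (by ring) (by ring)
  have e5 := theta21_of_eq hτ x y (x + y) (x - y) (by ring) (by ring)
  have e6 := theta34_of_eq hτ y x (x + y) (-(x - y)) (by ring) (by ring)
  rw [theta4_neg, theta1_neg] at e1 e3 e6
  calc _ = (theta2 τ 0 * theta1 τ (x + y)) * (theta3 τ (x - y) * theta4 τ 0) := by ring
    _ = (theta2 τ y * theta1 τ x) * (theta3 τ x * theta4 τ y)
        + (theta2 τ x * theta1 τ y) * (theta3 τ y * theta4 τ x) := by
      rw [e1, e2, e3, e4, e5, e6]; ring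
    _ = _ := by ring

lemma theta1_add_theta4_sub (hτ : 0 < τ.im) (x y : ℂ) :
    theta1 τ (x + y) * theta4 τ (x - y) * (theta2 τ 0 * theta3 τ 0) =
      theta1 τ x * theta4 τ x * (theta2 τ y * theta3 τ y)
        + theta2 τ x * theta3 τ x * (theta1 τ y * theta4 τ y) := by
  have e1 := theta21_of_eq hτ 0 (x + y) (x + y) (-(x + y)) (by ring) (by ring)
  have e2 := theta34_of_eq hτ 0 (x - y) (x - y) (-(x - y)) (by ring) (by ring)
  have e3 := theta21_of_eq hτ y x (x + y) (-(x - y)) (by ring) (by ring)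
  have e4 := theta34_of_eq hτ x y (x + y) (x - y) (by ring) (by ring)
  have e5 := theta21_of_eq hτ x y (x + y) (x - y) (by ring) (by ring)
  have e6 := theta34_of_eq hτ y x (x + y) (-(x - y)) (by ring) (by ring)
  rw [theta4_neg, theta1_neg] at e1 e2 e3 e6
  calc _ = (theta2 τ 0 * theta1 τ (x + y)) * (theta3 τ 0 * theta4 τ (x - y)) := by ring
    _ = (theta2 τ y * theta1 τ x) * (theta3 τ y * theta4 τ x)
        + (theta2 τ x * theta1 τ y) * (theta3 τ x * theta4 τ y) := by
      rw [e1, e2, e3, e4, e5, e6]; ring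
    _ = _ := by ring

lemma theta3_add_theta3_sub (hτ : 0 < τ.im) (x y : ℂ) :
    theta3 τ (x + y) * theta3 τ (x - y) * theta3 τ 0 ^ 2 =
      theta3 τ x ^ 2 * theta3 τ y ^ 2 + theta1 τ x ^ 2 * theta1 τ y ^ 2 := by
  have e1 := theta33_of_eq hτ (x + y) 0 (x + y) (x + y) (by ring) (by ring)
  have e2 := theta33_of_eq hτ (x - y) 0 (x - y) (x - y) (by ring) (by ring)
  have e3 := theta33_of_eq hτ x y (x + y) (x - y) (by ring) (by ring)
  have e4 := theta11_of_eq hτ x y (x + y) (x - y) (by ring) (by ring)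
  calc _ = (theta3 τ (x + y) * theta3 τ 0) * (theta3 τ (x - y) * theta3 τ 0) := by ring
    _ = (theta3 τ x * theta3 τ y) ^ 2 + (theta1 τ x * theta1 τ y) ^ 2 := by
      rw [e1, e2, e3, e4]; ring
    _ = _ := by ring

lemma theta1_add_theta1_sub (hτ : 0 < τ.im) (x y : ℂ) :
    theta1 τ (x + y) * theta1 τ (x - y) * theta3 τ 0 ^ 2 =
      theta1 τ x ^ 2 * theta3 τ y ^ 2 - theta3 τ x ^ 2 * theta1 τ y ^ 2 := by
  have e1 := theta11_of_eq hτ (x + y) (x - y) (2 * x) (2 * y) (by ring) (by ring)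
  rw [e1]
  simp only [theta3_sq hτ, theta1_sq hτ, mul_zero]
  ring

/-- Riemann's quartic relation for three points and their sum. -/
lemma theta_riemann (hτ : 0 < τ.im) (a b c : ℂ) :
    theta3 τ (a + b + c) * (theta3 τ a * theta3 τ b * theta3 τ c)
      - theta1 τ (a + b + c) * (theta1 τ a * theta1 τ b * theta1 τ c) =
      theta3 τ 0 * (theta3 τ (a + b) * theta3 τ (a + c) * theta3 τ (b + c)) := by
  have e1 := theta33_of_eq hτ (a + b + c) a (2 * a + b + c) (b + c) (by ring) (by ring)
  have e2 := theta33_of_eq hτ b c (b + c) (b - c) (by ring) (by ring)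
  have e3 := theta11_of_eq hτ (a + b + c) a (2 * a + b + c) (b + c) (by ring) (by ring)
  have e4 := theta11_of_eq hτ b c (b + c) (b - c) (by ring) (by ring)
  have e5 := theta33_of_eq hτ (b + c) 0 (b + c) (b + c) (by ring) (by ring)
  have e6 := theta33_of_eq hτ (a + b) (a + c) (2 * a + b + c) (b - c) (by ring) (by ring)
  calc _ = (theta3 τ (a + b + c) * theta3 τ a) * (theta3 τ b * theta3 τ c)
        - (theta1 τ (a + b + c) * theta1 τ a) * (theta1 τ b * theta1 τ c) := by ring
    _ = (theta3 τ (b + c) * theta3 τ 0) * (theta3 τ (a + b) * theta3 τ (a + c)) := by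
      rw [e1, e2, e3, e4, e5, e6]; ring
    _ = _ := by ring

/-- A product whose arguments add up to 2w - a is a combination of θ₃(w)θ₃(w - a) and θ₁(w)θ₁(w -
a), with coefficients free of w. Together with `theta31_decomp` this separates w from αⱼ in the
entries of Λ̄ᵢ; the first-order terms in b of `theta31_decomp` and `theta11_decomp` give the
differential equations of y₃ and y₁. -/
lemma theta33_decomp (hτ : 0 < τ.im) (w a b : ℂ) :
    theta3 τ (w - a - b) * theta3 τ (w + b) * (theta3 τ 0 * theta3 τ a) =
      theta3 τ (a + b) * theta3 τ b * (theta3 τ w * theta3 τ (w - a))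
        + theta1 τ (a + b) * theta1 τ b * (theta1 τ w * theta1 τ (w - a)) := by
  have e1 := theta33_of_eq hτ (w + b) (w - a - b) (2 * w - a) (a + 2 * b) (by ring) (by ring)
  have e2 := theta33_of_eq hτ a 0 a a (by ring) (by ring)
  have e3 := theta33_of_eq hτ (a + b) b (a + 2 * b) a (by ring) (by ring)
  have e4 := theta33_of_eq hτ w (w - a) (2 * w - a) a (by ring) (by ring)
  have e5 := theta11_of_eq hτ (a + b) b (a + 2 * b) a (by ring) (by ring)
  have e6 := theta11_of_eq hτ w (w - a) (2 * w - a) a (by ring) (by ring)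
  calc _ = (theta3 τ (w + b) * theta3 τ (w - a - b)) * (theta3 τ a * theta3 τ 0) := by ring
    _ = _ := by rw [e1, e2, e3, e4, e5, e6]; ring

lemma theta31_decomp (hτ : 0 < τ.im) (w a b : ℂ) :
    theta3 τ (w - a - b) * theta1 τ (w + b) * (theta3 τ 0 * theta1 τ a) =
      theta1 τ (a + b) * theta3 τ b * (theta1 τ w * theta3 τ (w - a))
        - theta3 τ (a + b) * theta1 τ b * (theta3 τ w * theta1 τ (w - a)) := by
  have e1 := theta33_of_eq hτ (w - a - b) 0 (w - a - b) (w - a - b) (by ring) (by ring)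
  have e2 := theta11_of_eq hτ (w + b) a (w + a + b) (w + b - a) (by ring) (by ring)
  have e3 := theta11_of_eq hτ w (a + b) (w + a + b) (w - a - b) (by ring) (by ring)
  have e4 := theta33_of_eq hτ (w - a) b (w + b - a) (w - a - b) (by ring) (by ring)
  have e5 := theta33_of_eq hτ w (a + b) (w + a + b) (w - a - b) (by ring) (by ring)
  have e6 := theta11_of_eq hτ (w - a) b (w + b - a) (w - a - b) (by ring) (by ring)
  calc _ = (theta3 τ (w - a - b) * theta3 τ 0) * (theta1 τ (w + b) * theta1 τ a) := by ring
    _ = (theta1 τ w * theta1 τ (a + b)) * (theta3 τ (w - a) * theta3 τ b)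
        - (theta3 τ w * theta3 τ (a + b)) * (theta1 τ (w - a) * theta1 τ b) := by
      rw [e1, e2, e3, e4, e5, e6]; ring
    _ = _ := by ring

lemma theta11_decomp (hτ : 0 < τ.im) (w a b : ℂ) :
    theta1 τ (w - a - b) * theta1 τ (w + b) * (theta3 τ 0 * theta3 τ a) =
      theta3 τ (a + b) * theta3 τ b * (theta1 τ w * theta1 τ (w - a))
        - theta1 τ (a + b) * theta1 τ b * (theta3 τ w * theta3 τ (w - a)) := by
  have e1 := theta11_of_eq hτ (w + b) (w - a - b) (2 * w - a) (a + 2 * b) (by ring) (by ring)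
  have e2 := theta33_of_eq hτ a 0 a a (by ring) (by ring)
  have e3 := theta33_of_eq hτ (a + b) b (a + 2 * b) a (by ring) (by ring)
  have e4 := theta33_of_eq hτ w (w - a) (2 * w - a) a (by ring) (by ring)
  have e5 := theta11_of_eq hτ (a + b) b (a + 2 * b) a (by ring) (by ring)
  have e6 := theta11_of_eq hτ w (w - a) (2 * w - a) a (by ring) (by ring)
  calc _ = (theta1 τ (w + b) * theta1 τ (w - a - b)) * (theta3 τ a * theta3 τ 0) := by ring
    _ = _ := by rw [e1, e2, e3, e4, e5, e6]; ring

/-! ### Landen-type relations between the periods `τ` and `2τ` -/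

lemma theta1_two_mul (hτ : 0 < τ.im) (z : ℂ) :
    theta1 (2 * τ) (2 * z) * theta4 (2 * τ) 0 = theta1 τ z * theta2 τ z := by
  have h := theta21_of_eq hτ z z (2 * z) 0 (by ring) (by ring)
  rw [theta1_zero] at h
  linear_combination -h

lemma theta4_two_mul_sq (hτ : 0 < τ.im) :
    theta4 (2 * τ) 0 ^ 2 = theta3 τ 0 * theta4 τ 0 := by
  have h := theta34_of_eq hτ 0 0 0 0 (by ring) (by ring)
  rw [theta1_zero] at h
  linear_combination -h

lemma theta2_const_sq (hτ : 0 < τ.im) :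
    theta2 τ 0 ^ 2 = 2 * theta2 (2 * τ) 0 * theta3 (2 * τ) 0 := by
  rw [theta2_sq hτ, mul_zero]; ring

lemma theta3_const_sq (hτ : 0 < τ.im) :
    theta3 τ 0 ^ 2 = theta3 (2 * τ) 0 ^ 2 + theta2 (2 * τ) 0 ^ 2 := by
  rw [theta3_sq hτ, mul_zero]; ring

/-! ### Wronskian identities -/

lemma hasDerivAt_theta1 (hτ : 0 < τ.im) (z : ℂ) :
    HasDerivAt (theta1 τ) (deriv (theta1 τ) z) z := (differentiable_theta1 hτ z).hasDerivAt

lemma hasDerivAt_theta2 (hτ : 0 < τ.im) (z : ℂ) :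
    HasDerivAt (theta2 τ) (deriv (theta2 τ) z) z := (differentiable_theta2 hτ z).hasDerivAt

lemma hasDerivAt_theta3 (hτ : 0 < τ.im) (z : ℂ) :
    HasDerivAt (theta3 τ) (deriv (theta3 τ) z) z := (differentiable_theta3 hτ z).hasDerivAt

lemma hasDerivAt_theta4 (hτ : 0 < τ.im) (z : ℂ) :
    HasDerivAt (theta4 τ) (deriv (theta4 τ) z) z := (differentiable_theta4 hτ z).hasDerivAt

lemma deriv_zero_of_even {f : ℂ → ℂ} (hf : ∀ z, f (-z) = f z) : deriv f 0 = 0 := by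
  have h : (fun z => f (-z)) = f := funext hf
  have := deriv_comp_neg f 0
  rw [h, neg_zero] at this
  linear_combination this / 2

lemma deriv_theta2_zero (τ : ℂ) : deriv (theta2 τ) 0 = 0 := deriv_zero_of_even (theta2_neg τ)
lemma deriv_theta3_zero (τ : ℂ) : deriv (theta3 τ) 0 = 0 := deriv_zero_of_even (theta3_neg τ)
lemma deriv_theta4_zero (τ : ℂ) : deriv (theta4 τ) 0 = 0 := deriv_zero_of_even (theta4_neg τ)

lemma hasDerivAt_add_zero {f : ℂ → ℂ} {f' x : ℂ} (h : HasDerivAt f f' x) :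
    HasDerivAt (fun y => f (x + y)) f' 0 := by
  have := HasDerivAt.comp_const_add x 0 (f := f) (f' := f') (by simpa using h)
  exact this

lemma hasDerivAt_sub_zero {f : ℂ → ℂ} {f' x : ℂ} (h : HasDerivAt f f' x) :
    HasDerivAt (fun y => f (x - y)) (-f') 0 := by
  have := HasDerivAt.comp_const_sub x 0 (f := f) (f' := f') (by simpa using h)
  exact this

/-- Derivative of `theta1_add_theta3_sub` in y at y = 0, where θ₁ vanishes and the derivatives of
the even functions θ₂, θ₃, θ₄ vanish. -/
lemma wronskian_theta13 (hτ : 0 < τ.im) (x : ℂ) :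
    (deriv (theta1 τ) x * theta3 τ x - theta1 τ x * deriv (theta3 τ) x)
        * (theta2 τ 0 * theta4 τ 0) =
      deriv (theta1 τ) 0 * theta3 τ 0 * (theta2 τ x * theta4 τ x) := by
  have hL := ((hasDerivAt_add_zero (hasDerivAt_theta1 hτ x)).mul
    (hasDerivAt_sub_zero (hasDerivAt_theta3 hτ x))).mul_const (theta2 τ 0 * theta4 τ 0)
  have hR := (((hasDerivAt_theta2 hτ 0).mul (hasDerivAt_theta4 hτ 0)).const_mul
    (theta1 τ x * theta3 τ x)).add (((hasDerivAt_theta1 hτ 0).mul (hasDerivAt_theta3 hτ 0)).const_mul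
    (theta2 τ x * theta4 τ x))
  have h := (hL.congr_of_eventuallyEq
    (.of_forall fun y => (theta1_add_theta3_sub hτ x y).symm)).unique hR
  simp only [add_zero, sub_zero, deriv_theta2_zero, deriv_theta4_zero, theta1_zero,
    deriv_theta3_zero] at h
  linear_combination h

lemma wronskian_theta14 (hτ : 0 < τ.im) (x : ℂ) :
    (deriv (theta1 τ) x * theta4 τ x - theta1 τ x * deriv (theta4 τ) x)
        * (theta2 τ 0 * theta3 τ 0) =
      deriv (theta1 τ) 0 * theta4 τ 0 * (theta2 τ x * theta3 τ x) := by
  have hL := ((hasDerivAt_add_zero (hasDerivAt_theta1 hτ x)).mul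
    (hasDerivAt_sub_zero (hasDerivAt_theta4 hτ x))).mul_const (theta2 τ 0 * theta3 τ 0)
  have hR := (((hasDerivAt_theta2 hτ 0).mul (hasDerivAt_theta3 hτ 0)).const_mul
    (theta1 τ x * theta4 τ x)).add (((hasDerivAt_theta1 hτ 0).mul (hasDerivAt_theta4 hτ 0)).const_mul
    (theta2 τ x * theta3 τ x))
  have h := (hL.congr_of_eventuallyEq
    (.of_forall fun y => (theta1_add_theta4_sub hτ x y).symm)).unique hR
  simp only [add_zero, sub_zero, deriv_theta2_zero, deriv_theta4_zero, theta1_zero,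
    deriv_theta3_zero] at h
  linear_combination h

lemma wronskian_theta23 (hτ : 0 < τ.im) (x : ℂ) :
    (deriv (theta2 τ) x * theta3 τ x - theta2 τ x * deriv (theta3 τ) x)
        * (theta2 τ 0 * theta3 τ 0) =
      -deriv (theta1 τ) 0 * theta4 τ 0 * (theta1 τ x * theta4 τ x) := by
  have h := wronskian_theta14 hτ (x + 1 / 2)
  have h1 : deriv (theta1 τ) (x + 1 / 2) = deriv (theta2 τ) x := by
    rw [← deriv_comp_add_const]; simp only [theta1_add_half]
  have h2 : deriv (theta4 τ) (x + 1 / 2) = deriv (theta3 τ) x := by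
    rw [← deriv_comp_add_const]; simp only [theta4_add_half]
  rw [h1, h2, theta1_add_half, theta4_add_half, theta2_add_half, theta3_add_half] at h
  linear_combination h

lemma wronskian_theta11_shift (hτ : 0 < τ.im) (w a : ℂ) :
    (deriv (theta1 τ) (w - a) * theta1 τ w - theta1 τ (w - a) * deriv (theta1 τ) w)
        * (theta3 τ 0 * theta3 τ a) =
      theta1 τ a * deriv (theta1 τ) 0 * (theta3 τ w * theta3 τ (w - a))
        - deriv (theta3 τ) a * theta3 τ 0 * (theta1 τ w * theta1 τ (w - a)) := by
  have hL := ((hasDerivAt_sub_zero (hasDerivAt_theta1 hτ (w - a))).mul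
    (hasDerivAt_add_zero (hasDerivAt_theta1 hτ w))).mul_const (theta3 τ 0 * theta3 τ a)
  have hR := (((hasDerivAt_add_zero (hasDerivAt_theta3 hτ a)).mul
    (hasDerivAt_theta3 hτ 0)).mul_const (theta1 τ w * theta1 τ (w - a))).sub
    (((hasDerivAt_add_zero (hasDerivAt_theta1 hτ a)).mul
    (hasDerivAt_theta1 hτ 0)).mul_const (theta3 τ w * theta3 τ (w - a)))
  have h := (hL.congr_of_eventuallyEq
    (.of_forall fun y => (theta11_decomp hτ w a y).symm)).unique hR
  simp only [add_zero, sub_zero, theta1_zero, deriv_theta3_zero] at h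
  linear_combination -h

lemma wronskian_theta31_shift (hτ : 0 < τ.im) (w a : ℂ) :
    (deriv (theta3 τ) (w - a) * theta1 τ w - theta3 τ (w - a) * deriv (theta1 τ) w)
        * (theta3 τ 0 * theta1 τ a) =
      theta3 τ a * deriv (theta1 τ) 0 * (theta3 τ w * theta1 τ (w - a))
        - deriv (theta1 τ) a * theta3 τ 0 * (theta1 τ w * theta3 τ (w - a)) := by
  have hL := ((hasDerivAt_sub_zero (hasDerivAt_theta3 hτ (w - a))).mul
    (hasDerivAt_add_zero (hasDerivAt_theta1 hτ w))).mul_const (theta3 τ 0 * theta1 τ a)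
  have hR := (((hasDerivAt_add_zero (hasDerivAt_theta1 hτ a)).mul
    (hasDerivAt_theta3 hτ 0)).mul_const (theta1 τ w * theta3 τ (w - a))).sub
    (((hasDerivAt_add_zero (hasDerivAt_theta3 hτ a)).mul
    (hasDerivAt_theta1 hτ 0)).mul_const (theta3 τ w * theta1 τ (w - a)))
  have h := (hL.congr_of_eventuallyEq
    (.of_forall fun y => (theta31_decomp hτ w a y).symm)).unique hR
  simp only [add_zero, sub_zero, theta1_zero, deriv_theta3_zero] at h
  linear_combination -h

/-! ### Common zeros -/

/-- At a common zero u the addition formula gives θ₃(u + y)θ₃(u - y) = 0 for all y. By the identity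
theorem one factor vanishes identically, against θ₃(0) ≠ 0. -/
lemma not_theta1_theta3_common_zero (hτ : 0 < τ.im) (h3 : theta3 τ 0 ≠ 0) (u : ℂ)
    (h1u : theta1 τ u = 0) (h3u : theta3 τ u = 0) : False := by
  have h : ∀ y, theta3 τ (u + y) * theta3 τ (u - y) = 0 := fun y => by
    have := theta3_add_theta3_sub hτ u y
    rw [h1u, h3u] at this
    have h' : theta3 τ (u + y) * theta3 τ (u - y) * theta3 τ 0 ^ 2 = 0 := by rw [this]; ring
    exact (mul_eq_zero.mp h').resolve_right (pow_ne_zero _ h3)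
  have d3 := differentiable_theta3 hτ
  have hf : AnalyticOnNhd ℂ (fun y => theta3 τ (u + y)) Set.univ :=
    (d3.comp (differentiable_id.const_add u)).differentiableOn.analyticOnNhd isOpen_univ
  have hg : AnalyticOnNhd ℂ (fun y => theta3 τ (u - y)) Set.univ :=
    (d3.comp (differentiable_id.const_sub u)).differentiableOn.analyticOnNhd isOpen_univ
  rcases AnalyticOnNhd.eq_zero_or_eq_zero_of_mul_eq_zero hf hg (fun y _ => h y)
    isPreconnected_univ with h0 | h0
  · exact h3 (by simpa using h0 (-u) trivial)
  · exact h3 (by simpa using h0 u trivial)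

/-- If θ₂ or θ₄ vanished together with one of θ₁, θ₃, the quadratic relations would make θ₁ and θ₃
vanish together. Hence the quotient θ₂θ₄/(θ₁θ₃) is never of the form 0/0. -/
lemma theta24_ne_zero (hτ : 0 < τ.im) (h2 : theta2 τ 0 ≠ 0) (h3 : theta3 τ 0 ≠ 0)
    (h4 : theta4 τ 0 ≠ 0) (u : ℂ) (hu : theta1 τ u * theta3 τ u = 0) :
    theta2 τ u * theta4 τ u ≠ 0 := by
  intro h
  have e1 := theta2_sq_eq hτ u
  have e2 := theta4_sq_eq hτ u
  have n2 := pow_ne_zero 2 h2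
  have n4 := pow_ne_zero 2 h4
  rcases mul_eq_zero.mp hu with hu | hu <;> rcases mul_eq_zero.mp h with h | h <;>
    simp [hu, h, h2, h4] at e1 e2
  all_goals exact not_theta1_theta3_common_zero hτ h3 u (by assumption) (by assumption)

end Addition

/-! ### Theta functions on the real axis, for a purely imaginary period `τ = iT` -/

lemma mul_I_im_pos {T : ℝ} (hT : 0 < T) : 0 < ((T : ℂ) * Complex.I).im := by simpa using hT

lemma two_mul_mul_I (T : ℝ) : 2 * ((T : ℂ) * Complex.I) = ((2 * T : ℝ) : ℂ) * Complex.I := by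
  push_cast; ring

lemma theta_imag_pos {T : ℝ} (hT : 0 < T) (s : ℝ) :
    ∃ r : ℝ, 0 < r ∧ jacobiTheta₂ (s * Complex.I) (T * Complex.I) = r := by
  have h := hasSum_jacobiTheta₂_term ((s : ℂ) * Complex.I) (mul_I_im_pos hT)
  have ht : ∀ n : ℤ, jacobiTheta₂_term n (s * Complex.I) (T * Complex.I) =
      ((Real.exp (-(2 * Real.pi * n * s) - Real.pi * n ^ 2 * T) : ℝ) : ℂ) := fun n => by
    rw [jacobiTheta₂_term, Complex.ofReal_exp]
    congr 1
    push_cast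
    linear_combination (2 * Real.pi * n * s + Real.pi * n ^ 2 * T : ℂ) * Complex.I_sq
  simp only [ht] at h
  have hs : Summable fun n : ℤ => Real.exp (-(2 * Real.pi * n * s) - Real.pi * n ^ 2 * T) := by
    exact_mod_cast h.summable
  refine ⟨∑' n : ℤ, Real.exp (-(2 * Real.pi * n * s) - Real.pi * n ^ 2 * T), ?_, ?_⟩
  · exact hs.tsum_pos (fun n => (Real.exp_pos _).le) 0 (Real.exp_pos _)
  · rw [← h.tsum_eq, Complex.ofReal_tsum]

/-- The series oscillates on the real axis. The inversion τ ↦ -1/τ carries a real argument to an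
imaginary one, where every term is a positive real exponential. -/
lemma theta3_real_pos {T : ℝ} (hT : 0 < T) (x : ℝ) :
    ∃ r : ℝ, 0 < r ∧ theta3 (T * Complex.I) x = r := by
  obtain ⟨r, hr, h⟩ := theta_imag_pos (one_div_pos.mpr hT) (-(x / T))
  have hT' : (T : ℂ) ≠ 0 := by exact_mod_cast hT.ne'
  refine ⟨1 / T ^ (1 / 2 : ℝ) * Real.exp (-Real.pi * x ^ 2 / T) * r, by positivity, ?_⟩
  rw [theta3, jacobiTheta₂_functional_equation]
  have e1 : -Complex.I * (T * Complex.I) = T := by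
    linear_combination (-(T : ℂ)) * Complex.I_sq
  have e2 : (x : ℂ) / (T * Complex.I) = ((-(x / T) : ℝ) : ℂ) * Complex.I := by
    push_cast
    field_simp
    rw [Complex.I_sq]; ring
  have e3 : -1 / ((T : ℂ) * Complex.I) = ((1 / T : ℝ) : ℂ) * Complex.I := by
    push_cast
    field_simp
    rw [Complex.I_sq]
  have e4 : -(Real.pi : ℂ) * Complex.I * x ^ 2 / (T * Complex.I) =
      ((-Real.pi * x ^ 2 / T : ℝ) : ℂ) := by
    push_cast
    field_simp
  rw [e1, e2, e3, h, e4, ← Complex.ofReal_exp]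
  have e5 : (T : ℂ) ^ (1 / 2 : ℂ) = ((T ^ (1 / 2 : ℝ) : ℝ) : ℂ) := by
    rw [Complex.ofReal_cpow hT.le]; push_cast; rfl
  rw [e5]
  push_cast
  ring

lemma theta4_real_pos {T : ℝ} (hT : 0 < T) (x : ℝ) :
    ∃ r : ℝ, 0 < r ∧ theta4 (T * Complex.I) x = r := by
  obtain ⟨r, hr, h⟩ := theta3_real_pos hT (x + 1 / 2)
  refine ⟨r, hr, ?_⟩
  rw [← theta3_add_half, ← h]
  push_cast; rfl

lemma theta2_zero_pos {T : ℝ} (hT : 0 < T) :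
    ∃ r : ℝ, 0 < r ∧ theta2 (T * Complex.I) 0 = r := by
  obtain ⟨r, hr, h⟩ := theta_imag_pos hT (T / 2)
  refine ⟨Real.exp (-Real.pi * T / 4) * r, by positivity, ?_⟩
  rw [theta2, zero_add, show (T : ℂ) * Complex.I / 2 = ((T / 2 : ℝ) : ℂ) * Complex.I by
    push_cast; ring, h]
  push_cast
  congr 2
  linear_combination (Real.pi * T / 4 : ℂ) * Complex.I_sq

lemma theta2_real {T : ℝ} (x : ℝ) : (theta2 (T * Complex.I) x).im = 0 := by
  rw [← Complex.conj_eq_iff_im]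
  conv_rhs => rw [← theta2_neg]
  simp only [theta2, map_mul, jacobiTheta₂_conj, ← Complex.exp_conj, map_add, map_div₀,
    Complex.conj_I, Complex.conj_ofReal, map_ofNat]
  rw [← jacobiTheta₂_neg_left]
  congr 2 <;> ring

lemma theta1_real {T : ℝ} (x : ℝ) : (theta1 (T * Complex.I) x).im = 0 := by
  have h := theta2_real (T := T) (x + 1 / 2)
  push_cast at h
  rw [theta2_add_half, Complex.neg_im] at h
  linarith

/-! ### Real zeros of `θ₁` and `θ₂` -/

lemma norm_pow_sub_one_le {u : ℂ} (hu : ‖u‖ = 1) (m : ℕ) : ‖u ^ m - 1‖ ≤ m * ‖u - 1‖ := by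
  induction m with
  | zero => simp
  | succ m ih =>
    calc ‖u ^ (m + 1) - 1‖ = ‖u ^ m * (u - 1) + (u ^ m - 1)‖ := by ring_nf
      _ ≤ ‖u ^ m * (u - 1)‖ + ‖u ^ m - 1‖ := norm_add_le _ _
      _ ≤ ‖u - 1‖ + m * ‖u - 1‖ := by rw [norm_mul, norm_pow, hu, one_pow, one_mul]; gcongr
      _ = _ := by push_cast; ring

/-- The terms n and -n - 1 together equal ±e^{-πT(n²+n)}(uⁿ - u^{-n-1}), which carries the factor
u^{2n+1} - 1, of modulus at most (2n + 1)|u - 1| since |u| = 1. -/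
lemma norm_theta_pair_le {T : ℝ} (hT : 1 ≤ T) (x : ℝ) (n : ℕ) :
    ‖jacobiTheta₂_term (n : ℤ) (x + 1 / 2 + T * Complex.I / 2) (T * Complex.I)
      + jacobiTheta₂_term (-((n : ℤ) + 1)) (x + 1 / 2 + T * Complex.I / 2) (T * Complex.I)‖ ≤
      (1 / 4) ^ n * ‖Complex.exp (2 * Real.pi * Complex.I * x) - 1‖ := by
  set u := Complex.exp (2 * Real.pi * Complex.I * x) with hu
  have hnu : ‖u‖ = 1 := by
    rw [hu, show 2 * Real.pi * Complex.I * x = ((2 * Real.pi * x : ℝ) : ℂ) * Complex.I by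
      push_cast; ring, Complex.norm_exp_ofReal_mul_I]
  have hu0 : u ≠ 0 := Complex.exp_ne_zero _
  have h1 : jacobiTheta₂_term (n : ℤ) (x + 1 / 2 + T * Complex.I / 2) (T * Complex.I)
      = (-1) ^ n * (Real.exp (-Real.pi * T * (n ^ 2 + n)) : ℝ) * u ^ n := by
    rw [jacobiTheta₂_term, hu, ← Complex.exp_nat_mul, ← Complex.exp_pi_mul_I, ← Complex.exp_nat_mul,
      Complex.ofReal_exp, ← Complex.exp_add, ← Complex.exp_add]
    congr 1
    push_cast
    linear_combination (Real.pi * T * n + Real.pi * T * n ^ 2 : ℂ) * Complex.I_sq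
  have h2 : jacobiTheta₂_term (-((n : ℤ) + 1)) (x + 1 / 2 + T * Complex.I / 2) (T * Complex.I)
      = -((-1) ^ n * (Real.exp (-Real.pi * T * (n ^ 2 + n)) : ℝ) * (u ^ (n + 1))⁻¹) := by
    have hm : (-1 : ℂ) ^ n = -((-1 : ℂ) ^ (n + 1))⁻¹ := by
      rw [pow_succ]; rcases neg_one_pow_eq_or ℂ n with h | h <;> simp [h]
    rw [hm, jacobiTheta₂_term, hu, ← Complex.exp_nat_mul, ← Complex.exp_pi_mul_I,
      ← Complex.exp_nat_mul, ← Complex.exp_neg, ← Complex.exp_neg,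
      Complex.ofReal_exp, neg_mul, neg_mul, neg_neg, ← Complex.exp_add, ← Complex.exp_add]
    congr 1
    push_cast
    linear_combination (-Real.pi * T * (n + 1) + Real.pi * T * (n + 1) ^ 2 : ℂ) * Complex.I_sq
  -- Since πT ≥ 3 and n² + n ≥ 2n, the exponential is at most e^{-6n} ≤ 12^{-n}, while 2n + 1 ≤ 3ⁿ.
  have hq : Real.exp (-Real.pi * T * (n ^ 2 + n)) * (2 * n + 1) ≤ (1 / 4 : ℝ) ^ n := by
    have hn : (n : ℝ) ≤ (n : ℝ) ^ 2 := by exact_mod_cast Nat.le_self_pow two_ne_zero n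
    have hn0 : (0 : ℝ) ≤ n := n.cast_nonneg
    have e1 : Real.exp (-Real.pi * T * (n ^ 2 + n)) ≤ (1 / 12 : ℝ) ^ n := by
      have : (1 / 12 : ℝ) ≥ Real.exp (-6) := by
        rw [Real.exp_neg, ge_iff_le, one_div]
        apply inv_anti₀ (by norm_num)
        have := Real.quadratic_le_exp_of_nonneg (x := 6) (by norm_num)
        linarith
      calc Real.exp (-Real.pi * T * (n ^ 2 + n)) ≤ Real.exp (n * (-6)) := by
            apply Real.exp_le_exp.mpr
            have hp := Real.pi_gt_three
            have : (3 : ℝ) * 1 ≤ Real.pi * T := by gcongr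
            nlinarith
        _ = Real.exp (-6) ^ n := by rw [Real.exp_nat_mul]
        _ ≤ _ := by gcongr
    have e2 : (2 * n + 1 : ℝ) ≤ 3 ^ n := by
      have := one_add_mul_le_pow (a := (2 : ℝ)) (by norm_num) n
      norm_num at this; linarith
    calc _ ≤ (1 / 12 : ℝ) ^ n * 3 ^ n := by gcongr
      _ = _ := by rw [← mul_pow]; norm_num
  have hkey : (u ^ n - (u ^ (n + 1))⁻¹) = (u ^ (2 * n + 1) - 1) * (u ^ (n + 1))⁻¹ := by
    field_simp
    ring
  rw [h1, h2, ← sub_eq_add_neg, ← mul_sub, hkey, norm_mul, norm_mul, norm_mul, norm_pow, norm_inv,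
    norm_pow, hnu, norm_neg, norm_one, one_pow, one_pow, inv_one, mul_one, one_mul,
    Complex.norm_real, Real.norm_of_nonneg (Real.exp_pos _).le]
  calc _ ≤ Real.exp (-Real.pi * T * (n ^ 2 + n)) * ((2 * n + 1 : ℕ) * ‖u - 1‖) := by
        gcongr; exact norm_pow_sub_one_le hnu _
    _ = Real.exp (-Real.pi * T * (n ^ 2 + n)) * (2 * n + 1) * ‖u - 1‖ := by push_cast; ring
    _ ≤ _ := by gcongr

/-- The pair n = 0 has modulus |u - 1|, and the remaining pairs add up to at most |u -
1|∑_{n≥1}4^{-n} = |u - 1|/3. A zero therefore forces u = e^{2πix} = 1, so x is an integer. -/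
lemma theta1_ne_zero_of_one_le {T : ℝ} (hT : 1 ≤ T) {x : ℝ} (hx0 : 0 < x) (hx1 : x < 1) :
    theta1 (T * Complex.I) x ≠ 0 := by
  intro h
  have hJ : jacobiTheta₂ ((x : ℂ) + 1 / 2 + T * Complex.I / 2) (T * Complex.I) = 0 := by
    rw [theta1] at h
    have : -Complex.I * Complex.exp (Complex.I * Real.pi * (T * Complex.I / 4 + x)) ≠ 0 := by
      simp [Complex.exp_ne_zero]
    exact (mul_eq_zero.mp h).resolve_left this
  have hs := (hasSum_jacobiTheta₂_term ((x : ℂ) + 1 / 2 + T * Complex.I / 2)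
    (mul_I_im_pos (zero_lt_one.trans_le hT))).nat_add_neg_add_one
  rw [hJ] at hs
  set u := Complex.exp (2 * Real.pi * Complex.I * x) with hu
  have hs1 := (hasSum_nat_add_iff' 1).mpr hs
  have hg : HasSum (fun n : ℕ => (1 / 4 : ℝ) ^ (n + 1) * ‖u - 1‖) (1 / 3 * ‖u - 1‖) := by
    have := ((hasSum_geometric_of_lt_one (r := (1 / 4 : ℝ)) (by norm_num) (by norm_num)).mul_left
      (1 / 4)).mul_right ‖u - 1‖
    have h3 : (1 / 4 : ℝ) * (1 - 1 / 4)⁻¹ = 1 / 3 := by norm_num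
    simpa only [pow_succ', h3] using this
  have hle := hs1.norm_le_of_bounded hg (fun n => norm_theta_pair_le hT x (n + 1))
  have hu1 : ‖u - 1‖ = ‖(0 : ℂ) - (1 - u⁻¹)‖ := by
    have hu0 : u ≠ 0 := Complex.exp_ne_zero _
    have hnu : ‖u‖ = 1 := by
      rw [hu, show 2 * Real.pi * Complex.I * x = ((2 * Real.pi * x : ℝ) : ℂ) * Complex.I by
        push_cast; ring, Complex.norm_exp_ofReal_mul_I]
    rw [show (0 : ℂ) - (1 - u⁻¹) = -((u - 1) * u⁻¹) by field_simp; ring, norm_neg, norm_mul,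
      norm_inv, hnu, inv_one, mul_one]
  have h0 : (∑ i ∈ Finset.range 1, (jacobiTheta₂_term (i : ℤ) (x + 1 / 2 + T * Complex.I / 2)
      (T * Complex.I) + jacobiTheta₂_term (-((i : ℤ) + 1)) (x + 1 / 2 + T * Complex.I / 2)
      (T * Complex.I))) = 1 - u⁻¹ := by
    rw [Finset.sum_range_one, hu, ← Complex.exp_neg, sub_eq_add_neg]
    congr 1
    · simp [jacobiTheta₂_term]
    · rw [neg_eq_neg_one_mul (Complex.exp _), ← Complex.exp_pi_mul_I, ← Complex.exp_add,
        jacobiTheta₂_term, Complex.exp_eq_exp_iff_exists_int]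
      exact ⟨-1, by push_cast; ring⟩
  rw [h0, ← hu1] at hle
  have hz : ‖u - 1‖ = 0 := by
    have := norm_nonneg (u - 1)
    linarith
  rw [norm_eq_zero, sub_eq_zero, hu, Complex.exp_eq_one_iff] at hz
  obtain ⟨n, hn⟩ := hz
  have hxn : (x : ℂ) = n := by
    have hne : (2 * Real.pi * Complex.I : ℂ) ≠ 0 := Complex.two_pi_I_ne_zero
    apply mul_left_cancel₀ hne
    rw [hn]; ring
  have hxn' : x = n := by exact_mod_cast hxn
  rw [hxn'] at hx0 hx1
  have a1 : (0 : ℤ) < n := by exact_mod_cast hx0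
  have a2 : n < (1 : ℤ) := by exact_mod_cast hx1
  omega

/-- By `theta1_two_mul` a zero of θ₁(·|iT) in (0, 1/2) would give a zero of θ₁(·|2iT) in (0, 1). The
value at 1/2 is θ₂(0) > 0, and x ↦ 1 - x covers the other half. Repeated doubling reduces any T > 0
to T ≥ 1. -/
lemma theta1_ne_zero_of_two_mul {T : ℝ} (hT : 0 < T)
    (h : ∀ x : ℝ, 0 < x → x < 1 → theta1 ((2 * T : ℝ) * Complex.I) x ≠ 0) (x : ℝ) (hx0 : 0 < x)
    (hx1 : x < 1) : theta1 (T * Complex.I) x ≠ 0 := by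
  have key : ∀ y : ℝ, 0 < y → y < 1 / 2 → theta1 (T * Complex.I) y ≠ 0 := fun y hy0 hy1 h0 => by
    have e := theta1_two_mul (mul_I_im_pos hT) y
    rw [h0, zero_mul, two_mul_mul_I] at e
    obtain ⟨r, hr, h4⟩ := theta4_real_pos (T := 2 * T) (by positivity) 0
    have hn := h (2 * y) (by linarith) (by linarith)
    rw [Complex.ofReal_zero] at h4
    rw [h4] at e
    push_cast at e hn
    rcases mul_eq_zero.mp e with e | e
    · exact hn e
    · exact hr.ne' (by exact_mod_cast e)
  rcases lt_trichotomy x (1 / 2) with hx | hx | hx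
  · exact key x hx0 hx
  · obtain ⟨r, hr, h2⟩ := theta2_zero_pos hT
    rw [hx]
    push_cast
    rw [← zero_add (1 / 2 : ℂ), theta1_add_half, h2]
    exact_mod_cast hr.ne'
  · have := key (1 - x) (by linarith) (by linarith)
    push_cast at this
    rwa [show (1 - x : ℂ) = -x + 1 by ring, theta1_add_one, theta1_neg, neg_neg] at this

lemma theta1_ne_zero {T : ℝ} (hT : 0 < T) (x : ℝ) (hx0 : 0 < x) (hx1 : x < 1) :
    theta1 (T * Complex.I) x ≠ 0 := by
  have key : ∀ n : ℕ, ∀ T : ℝ, 0 < T → 1 ≤ 2 ^ n * T → ∀ x : ℝ, 0 < x → x < 1 →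
      theta1 (T * Complex.I) x ≠ 0 := by
    intro n
    induction n with
    | zero => intro T _ hT x h0 h1; exact theta1_ne_zero_of_one_le (by simpa using hT) h0 h1
    | succ n ih =>
      intro T hT0 hT
      exact theta1_ne_zero_of_two_mul hT0 (ih (2 * T) (by positivity)
        (by rw [pow_succ] at hT; linarith))
  obtain ⟨n, hn⟩ := pow_unbounded_of_one_lt (1 / T) one_lt_two
  exact key n T hT (by rw [div_lt_iff₀ hT] at hn; exact hn.le) x hx0 hx1

lemma theta2_ne_zero {T : ℝ} (hT : 0 < T) (x : ℝ) (hx0 : -(1 / 2) < x) (hx1 : x < 1 / 2) :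
    theta2 (T * Complex.I) x ≠ 0 := by
  have := theta1_ne_zero hT (x + 1 / 2) (by linarith) (by linarith)
  push_cast at this
  rwa [theta1_add_half] at this

lemma theta2_real_pos {T : ℝ} (hT : 0 < T) (x : ℝ) (hx0 : 0 ≤ x) (hx1 : x < 1 / 2) :
    ∃ r : ℝ, 0 < r ∧ theta2 (T * Complex.I) x = r := by
  have hre : ∀ y : ℝ, theta2 (T * Complex.I) y = ((theta2 (T * Complex.I) y).re : ℝ) := fun y =>
    Complex.ext (by simp) (by simp [theta2_real])
  refine ⟨(theta2 (T * Complex.I) x).re, ?_, hre x⟩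
  by_contra hneg
  push Not at hneg
  have hc : ContinuousOn (fun y : ℝ => (theta2 (T * Complex.I) y).re) (Set.Icc 0 x) :=
    (Complex.continuous_re.comp ((differentiable_theta2 (mul_I_im_pos hT)).continuous.comp
      Complex.continuous_ofReal)).continuousOn
  obtain ⟨r, hr, h2⟩ := theta2_zero_pos hT
  have h0 : (0 : ℝ) ≤ (theta2 (T * Complex.I) (0 : ℝ)).re := by
    rw [Complex.ofReal_zero, h2]; simpa using hr.le
  obtain ⟨y, hy, hy0⟩ := intermediate_value_Icc' hx0 hc ⟨hneg, h0⟩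
  refine theta2_ne_zero hT y (by linarith [hy.1]) (by linarith [hy.2]) ?_
  rw [hre y]
  simpa using hy0

lemma theta1_real_pos {T : ℝ} (hT : 0 < T) (x : ℝ) (hx0 : 0 < x) (hx1 : x ≤ 1 / 2) :
    ∃ r : ℝ, 0 < r ∧ theta1 (T * Complex.I) x = r := by
  obtain ⟨r, hr, h⟩ := theta2_real_pos hT (1 / 2 - x) (by linarith) (by linarith)
  refine ⟨r, hr, ?_⟩
  push_cast at h
  rw [← theta2_neg, show -(1 / 2 - x : ℂ) = x - 1 / 2 by ring] at h
  rw [← h, ← theta1_add_half]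
  congr 1; ring

/-! ### The complete elliptic integral -/

lemma one_sub_sq_mul_sin_sq_pos {k : ℝ} (hk0 : 0 ≤ k) (hk1 : k < 1) (u : ℝ) :
    0 < 1 - k ^ 2 * Real.sin u ^ 2 := by
  nlinarith [Real.sin_sq_le_one u, sq_nonneg (Real.sin u), pow_lt_one₀ hk0 hk1 two_ne_zero]

lemma continuous_ellK_integrand {k : ℝ} (hk0 : 0 ≤ k) (hk1 : k < 1) :
    Continuous fun u : ℝ => 1 / Real.sqrt (1 - k ^ 2 * Real.sin u ^ 2) := by
  refine continuous_const.div (by fun_prop) fun u => ?_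
  exact (Real.sqrt_pos.mpr (one_sub_sq_mul_sin_sq_pos hk0 hk1 u)).ne'

lemma ellK_strictMono {a b : ℝ} (ha : 0 ≤ a) (hab : a < b) (hb : b < 1) : ellK a < ellK b := by
  refine intervalIntegral.integral_lt_integral_of_continuousOn_of_le_of_exists_lt
    (by positivity) (continuous_ellK_integrand ha (hab.trans hb)).continuousOn
    (continuous_ellK_integrand (ha.trans hab.le) hb).continuousOn (fun u _ => ?_)
    ⟨Real.pi / 2, ⟨by positivity, le_rfl⟩, ?_⟩
  · have := one_sub_sq_mul_sin_sq_pos (ha.trans hab.le) hb u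
    gcongr
  · have := one_sub_sq_mul_sin_sq_pos (ha.trans hab.le) hb (Real.pi / 2)
    rw [Real.sin_pi_div_two] at *
    have h2 : a ^ 2 < b ^ 2 := by gcongr
    apply one_div_lt_one_div_of_lt (Real.sqrt_pos.mpr this)
    exact Real.sqrt_lt_sqrt this.le (by linarith)

lemma ellK_zero : ellK 0 = Real.pi / 2 := by simp [ellK]

lemma ellK_pos {k : ℝ} (hk0 : 0 < k) (hk1 : k < 1) : 0 < ellK k := by
  have := ellK_strictMono le_rfl hk0 hk1
  rw [ellK_zero] at this
  linarith [Real.pi_pos]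

lemma ellK_le {k : ℝ} (hk0 : 0 ≤ k) (hk1 : k < 1) :
    ellK k ≤ Real.pi / 2 * (1 / Real.sqrt (1 - k ^ 2)) := by
  have hk : 0 < 1 - k ^ 2 := by nlinarith
  calc ellK k ≤ ∫ _ in (0 : ℝ)..(Real.pi / 2), 1 / Real.sqrt (1 - k ^ 2) := by
        refine intervalIntegral.integral_mono_on (by positivity)
          ((continuous_ellK_integrand hk0 hk1).intervalIntegrable _ _)
          (continuous_const.intervalIntegrable _ _) fun u _ => ?_
        have h1 : k ^ 2 * Real.sin u ^ 2 ≤ k ^ 2 :=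
          mul_le_of_le_one_right (sq_nonneg k) (Real.sin_sq_le_one u)
        gcongr
    _ = _ := by rw [intervalIntegral.integral_const]; simp

/-! ### Evaluation of `K` by theta constants -/

section Evaluation

variable {T : ℝ}

/-- The formula sn' = G·cn·dn in theta form, where G is the constant first factor. -/
lemma hasDerivAt_sn (hT : 0 < T) (x : ℂ) (h4 : theta4 (T * Complex.I) x ≠ 0)
    (c2 : theta2 (T * Complex.I) 0 ≠ 0) (c3 : theta3 (T * Complex.I) 0 ≠ 0)
    (c4 : theta4 (T * Complex.I) 0 ≠ 0) :
    HasDerivAt (fun z => theta3 (T * Complex.I) 0 * theta1 (T * Complex.I) z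
        / (theta2 (T * Complex.I) 0 * theta4 (T * Complex.I) z))
      (deriv (theta1 (T * Complex.I)) 0 * theta3 (T * Complex.I) 0
        / (theta2 (T * Complex.I) 0 * theta4 (T * Complex.I) 0)
        * (theta4 (T * Complex.I) 0 * theta2 (T * Complex.I) x
          / (theta2 (T * Complex.I) 0 * theta4 (T * Complex.I) x))
        * (theta4 (T * Complex.I) 0 * theta3 (T * Complex.I) x
          / (theta3 (T * Complex.I) 0 * theta4 (T * Complex.I) x))) x := by
  have hτ := mul_I_im_pos hT
  have h := ((hasDerivAt_theta1 hτ x).const_mul (theta3 (T * Complex.I) 0)).div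
    ((hasDerivAt_theta4 hτ x).const_mul (theta2 (T * Complex.I) 0)) (mul_ne_zero c2 h4)
  refine h.congr_deriv ?_
  have w := wronskian_theta14 hτ x
  field_simp
  linear_combination w

/-- Substitute sin u = s(x) with s the theta quotient for sn. The integrand is 1/dn and du = G·dn
dx, so the incomplete integral has constant derivative G on (0, 1/2), while s runs from 0 to 1. -/
theorem ellK_theta (hT : 0 < T) {r₂ r₃ r₄ : ℝ} (p2 : 0 < r₂) (p3 : 0 < r₃) (p4 : 0 < r₄)
    (e2 : theta2 (T * Complex.I) 0 = r₂) (e3 : theta3 (T * Complex.I) 0 = r₃)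
    (e4 : theta4 (T * Complex.I) 0 = r₄) :
    ellK (r₂ ^ 2 / r₃ ^ 2) = (deriv (theta1 (T * Complex.I)) 0).re * r₃ / (r₂ * r₄) / 2 := by
  have hτ := mul_I_im_pos hT
  set κ := r₂ ^ 2 / r₃ ^ 2 with hκ
  set G := (deriv (theta1 (T * Complex.I)) 0).re * r₃ / (r₂ * r₄) with hG
  have hj : r₃ ^ 4 = r₂ ^ 4 + r₄ ^ 4 := by
    have := theta_const_pow_four hτ
    rw [e2, e3, e4] at this
    exact_mod_cast this
  have hκ0 : 0 ≤ κ := by positivity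
  have hκ1 : κ < 1 := by
    rw [hκ, div_lt_one (by positivity)]
    have : 0 < r₄ ^ 4 := by positivity
    nlinarith
  have c2 : theta2 (T * Complex.I) 0 ≠ 0 := by rw [e2]; exact_mod_cast p2.ne'
  have c3 : theta3 (T * Complex.I) 0 ≠ 0 := by rw [e3]; exact_mod_cast p3.ne'
  have c4 : theta4 (T * Complex.I) 0 ≠ 0 := by rw [e4]; exact_mod_cast p4.ne'
  set s : ℝ → ℝ := fun x => (theta3 (T * Complex.I) 0 * theta1 (T * Complex.I) x
        / (theta2 (T * Complex.I) 0 * theta4 (T * Complex.I) x)).re with hs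
  have h4 : ∀ x : ℝ, theta4 (T * Complex.I) x ≠ 0 := fun x => by
    obtain ⟨a, ha, h⟩ := theta4_real_pos hT x
    rw [h]; exact_mod_cast ha.ne'
  have hsd : ∀ x : ℝ, HasDerivAt s _ x := fun x =>
    (hasDerivAt_sn hT x (h4 x) c2 c3 c4).real_of_complex
  have hsc : Continuous s := continuous_iff_continuousAt.mpr fun x => (hsd x).continuousAt
  set f : ℝ → ℝ := fun u => 1 / Real.sqrt (1 - κ ^ 2 * Real.sin u ^ 2) with hf
  have hfc : Continuous f := continuous_ellK_integrand hκ0 hκ1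
  set F : ℝ → ℝ := fun x => ∫ u in (0 : ℝ)..(Real.arcsin (s x)), f u with hF
  have hI : ∀ y, HasDerivAt (fun y => ∫ u in (0 : ℝ)..y, f u) (f y) y := fun y =>
    hfc.integral_hasStrictDerivAt 0 y |>.hasDerivAt
  have hFc : Continuous F := by
    have h1 : Continuous fun y => ∫ u in (0 : ℝ)..y, f u :=
      continuous_iff_continuousAt.mpr fun y => (hI y).continuousAt
    exact h1.comp (Real.continuous_arcsin.comp hsc)
  have hFd : ∀ x ∈ Set.Ioo (0 : ℝ) (1 / 2), HasDerivAt F G x := by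
    intro x hx
    obtain ⟨a2, pa2, ea2⟩ := theta2_real_pos hT x hx.1.le hx.2
    obtain ⟨a3, pa3, ea3⟩ := theta3_real_pos hT x
    obtain ⟨a4, pa4, ea4⟩ := theta4_real_pos hT x
    obtain ⟨a1, pa1, ea1⟩ := theta1_real_pos hT x hx.1 hx.2.le
    have q1 : r₂ ^ 2 * a4 ^ 2 = r₄ ^ 2 * a2 ^ 2 + r₃ ^ 2 * a1 ^ 2 := by
      have := theta4_sq_eq' hτ x
      rw [e2, e3, e4, ea1, ea2, ea4] at this
      exact_mod_cast this
    have q2 : r₃ ^ 2 * a4 ^ 2 = r₄ ^ 2 * a3 ^ 2 + r₂ ^ 2 * a1 ^ 2 := by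
      have := theta4_sq_eq hτ x
      rw [e2, e3, e4, ea1, ea3, ea4] at this
      exact_mod_cast this
    have hsx : s x = r₃ * a1 / (r₂ * a4) := by
      simp only [hs]
      rw [e2, e3, ea1, ea4]
      norm_cast
    have hd := hsd x
    have hD : (deriv (theta1 (T * Complex.I)) 0 * theta3 (T * Complex.I) 0
        / (theta2 (T * Complex.I) 0 * theta4 (T * Complex.I) 0)
        * (theta4 (T * Complex.I) 0 * theta2 (T * Complex.I) x
          / (theta2 (T * Complex.I) 0 * theta4 (T * Complex.I) x))
        * (theta4 (T * Complex.I) 0 * theta3 (T * Complex.I) x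
          / (theta3 (T * Complex.I) 0 * theta4 (T * Complex.I) x))).re =
        G * (r₄ * a2 / (r₂ * a4)) * (r₄ * a3 / (r₃ * a4)) := by
      rw [e2, e3, e4, ea2, ea3, ea4, show ∀ D : ℂ, D * (r₃ : ℂ) / (r₂ * r₄)
        * (r₄ * a2 / (r₂ * a4)) * (r₄ * a3 / (r₃ * a4)) = D * ((r₃ / (r₂ * r₄)
        * (r₄ * a2 / (r₂ * a4)) * (r₄ * a3 / (r₃ * a4)) : ℝ) : ℂ) from fun D => by push_cast; ring,
        Complex.re_mul_ofReal, hG]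
      ring
    rw [hD] at hd
    have hc2 : 1 - s x ^ 2 = (r₄ * a2 / (r₂ * a4)) ^ 2 := by
      rw [hsx]; field_simp; linarith
    have hd2 : 1 - κ ^ 2 * s x ^ 2 = (r₄ * a3 / (r₃ * a4)) ^ 2 := by
      rw [hsx, hκ]; field_simp; linarith
    have hcp : 0 < r₄ * a2 / (r₂ * a4) := by positivity
    have hdp : 0 < r₄ * a3 / (r₃ * a4) := by positivity
    have hlt : s x ^ 2 < 1 := by
      have : 0 < (r₄ * a2 / (r₂ * a4)) ^ 2 := by positivity
      linarith
    have hab := abs_lt.mp ((sq_lt_one_iff_abs_lt_one _).mp hlt)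
    have harc := (Real.hasDerivAt_arcsin hab.1.ne' hab.2.ne).comp x hd
    refine ((hI (Real.arcsin (s x))).comp x harc).congr_deriv ?_
    simp only [hf]
    rw [Real.sin_arcsin hab.1.le hab.2.le, hd2, hc2, Real.sqrt_sq hcp.le, Real.sqrt_sq hdp.le]
    field_simp
  -- At x = 1/2 the arcsine is not differentiable, so only continuity is used at the end points.
  have hFint := intervalIntegral.integral_eq_sub_of_hasDerivAt_of_le (a := 0) (b := 1 / 2)
    (by norm_num) hFc.continuousOn hFd (continuous_const.intervalIntegrable _ _)
  have hs0 : s 0 = 0 := by simp [hs, theta1_zero]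
  have hs1 : s (1 / 2) = 1 := by
    simp only [hs]
    have h1 := theta1_add_half (T * Complex.I) 0
    have h2 := theta4_add_half (T * Complex.I) 0
    rw [zero_add] at h1 h2
    push_cast
    rw [h1, h2, mul_comm, div_self (mul_ne_zero c2 c3), Complex.one_re]
  rw [intervalIntegral.integral_const] at hFint
  simp only [hF, hs0, hs1, Real.arcsin_zero, Real.arcsin_one, intervalIntegral.integral_same,
    sub_zero, smul_eq_mul] at hFint
  rw [ellK, ← hFint]
  ring

end Evaluation

/-! ### Jacobi's derivative formula -/

lemma deriv_theta1_two_mul {τ : ℂ} (hτ : 0 < τ.im) :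
    2 * deriv (theta1 (2 * τ)) 0 * theta4 (2 * τ) 0 = deriv (theta1 τ) 0 * theta2 τ 0 := by
  have hτ2 : 0 < (2 * τ).im := by simpa using hτ
  have h1 : HasDerivAt (fun z : ℂ => theta1 (2 * τ) (2 * z)) (deriv (theta1 (2 * τ)) 0 * 2) 0 := by
    have hd : HasDerivAt (fun z : ℂ => 2 * z) 2 0 := by
      simpa using (hasDerivAt_id (0 : ℂ)).const_mul 2
    have := hasDerivAt_theta1 hτ2 (2 * 0)
    have h := HasDerivAt.comp (0 : ℂ) this hd
    rw [mul_zero] at h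
    exact h
  have hL := h1.mul_const (theta4 (2 * τ) 0)
  have hR := (hasDerivAt_theta1 hτ 0).mul (hasDerivAt_theta2 hτ 0)
  have h := (hL.congr_of_eventuallyEq (.of_forall fun z => (theta1_two_mul hτ z).symm)).unique hR
  rw [theta1_zero] at h
  linear_combination h

lemma deriv_theta1_im (T : ℝ) (hT : 0 < T) : (deriv (theta1 (T * Complex.I)) 0).im = 0 := by
  have h := (hasDerivAt_theta1 (mul_I_im_pos hT) ((0 : ℝ) : ℂ)).comp_ofReal
  have h2 := (Complex.imCLM.hasFDerivAt (x := theta1 (T * Complex.I) ((0 : ℝ) : ℂ))).comp_hasDerivAt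
    (0 : ℝ) h
  have h3 : (⇑Complex.imCLM ∘ fun y : ℝ => theta1 (T * Complex.I) y) = fun _ => (0 : ℝ) := by
    funext y; simp [theta1_real]
  rw [h3] at h2
  have := h2.unique (hasDerivAt_const (0 : ℝ) (0 : ℝ))
  simpa using this

lemma tendsto_theta3_const {T : ℝ} (hT : 0 < T) :
    Tendsto (fun n : ℕ => theta3 ((2 ^ n * T : ℝ) * Complex.I) 0) atTop (𝓝 1) := by
  have hb : ∀ n : ℕ, ‖theta3 ((2 ^ n * T : ℝ) * Complex.I) 0 - 1‖ ≤
      2 / (1 - Real.exp (-Real.pi * (2 ^ n * T))) * Real.exp (-Real.pi * (2 ^ n * T)) := fun n => by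
    have h := norm_jacobiTheta_sub_one_le (τ := ((2 ^ n * T : ℝ) : ℂ) * Complex.I)
      (mul_I_im_pos (by positivity))
    rwa [jacobiTheta_eq_jacobiTheta₂, Complex.im_ofReal_mul, Complex.I_im, mul_one] at h
  have he : Tendsto (fun n : ℕ => Real.exp (-Real.pi * (2 ^ n * T))) atTop (𝓝 0) := by
    apply Real.tendsto_exp_atBot.comp
    have h1 : Tendsto (fun n : ℕ => (2 : ℝ) ^ n) atTop atTop :=
      tendsto_pow_atTop_atTop_of_one_lt one_lt_two
    have h2 := (h1.atTop_mul_const hT).const_mul_atTop_of_neg (r := -Real.pi)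
      (by linarith [Real.pi_pos])
    exact h2
  have hlim : Tendsto (fun n : ℕ => 2 / (1 - Real.exp (-Real.pi * (2 ^ n * T)))
      * Real.exp (-Real.pi * (2 ^ n * T))) atTop (𝓝 0) := by
    have := (tendsto_const_nhds (x := (2 : ℝ))).div
      ((tendsto_const_nhds (x := (1 : ℝ))).sub he) (by norm_num)
    simpa using this.mul he
  rw [tendsto_iff_norm_sub_tendsto_zero]
  exact squeeze_zero (fun _ => norm_nonneg _) hb hlim

/-- Jacobi's derivative formula `θ₁'(0) = π θ₂ θ₃ θ₄`, for a purely imaginary period. -/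
theorem deriv_theta1_zero {T : ℝ} (hT : 0 < T) :
    deriv (theta1 (T * Complex.I)) 0 = Real.pi *
      (theta2 (T * Complex.I) 0 * theta3 (T * Complex.I) 0 * theta4 (T * Complex.I) 0) := by
  have h2 : ∀ n : ℕ, ∃ r : ℝ, 0 < r ∧ theta2 ((2 ^ n * T : ℝ) * Complex.I) 0 = r := fun n =>
    theta2_zero_pos (by positivity)
  have h3 : ∀ n : ℕ, ∃ r : ℝ, 0 < r ∧ theta3 ((2 ^ n * T : ℝ) * Complex.I) 0 = r := fun n => by
    simpa using theta3_real_pos (T := 2 ^ n * T) (by positivity) 0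
  have h4 : ∀ n : ℕ, ∃ r : ℝ, 0 < r ∧ theta4 ((2 ^ n * T : ℝ) * Complex.I) 0 = r := fun n => by
    simpa using theta4_real_pos (T := 2 ^ n * T) (by positivity) 0
  choose r₂ p2 e2 using h2
  choose r₃ p3 e3 using h3
  choose r₄ p4 e4 using h4
  set D : ℕ → ℝ := fun n => (deriv (theta1 ((2 ^ n * T : ℝ) * Complex.I)) 0).re with hD
  have hDe : ∀ n, deriv (theta1 ((2 ^ n * T : ℝ) * Complex.I)) 0 = D n := fun n =>
    Complex.ext (by simp [hD]) (by rw [deriv_theta1_im _ (by positivity)]; simp)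
  have hstep : ∀ n : ℕ, ((2 ^ (n + 1) * T : ℝ) : ℂ) * Complex.I =
      2 * (((2 ^ n * T : ℝ) : ℂ) * Complex.I) := fun n => by push_cast; ring
  -- The Landen relations make θ₁'(0)/(θ₂θ₃θ₄) invariant under τ ↦ 2τ. With c its value, K(θ₂²/θ₃²)
  -- = cθ₃²/2 along the whole sequence 2ⁿτ; letting n grow determines c.
  have hinv : ∀ n, D n / (r₂ n * r₃ n * r₄ n) = D 0 / (r₂ 0 * r₃ 0 * r₄ 0) := by
    intro n
    induction n with
    | zero => rfl
    | succ n ih =>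
      rw [← ih]
      have hτ : 0 < (((2 ^ n * T : ℝ) : ℂ) * Complex.I).im := mul_I_im_pos (by positivity)
      have f1 := deriv_theta1_two_mul hτ
      have f2 := theta4_two_mul_sq hτ
      have f3 := theta2_const_sq hτ
      rw [← hstep, hDe, hDe, e4, e2] at f1
      rw [← hstep, e4, e4, e3] at f2
      rw [← hstep, e2, e2, e3] at f3
      norm_cast at f1 f2 f3
      have := p2 n; have := p3 n; have := p4 n
      have := p2 (n + 1); have := p3 (n + 1); have := p4 (n + 1)
      rw [div_eq_div_iff (by positivity) (by positivity)]
      have key : D (n + 1) * r₂ n * r₄ (n + 1) = D n * (r₂ (n + 1) * r₃ (n + 1)) := by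
        apply mul_left_cancel₀ (p2 n).ne'
        linear_combination (r₂ n ^ 2 / 2) * f1 + (D n * r₂ n / 2) * f3
      linear_combination r₄ (n + 1) * key - D (n + 1) * r₂ n * f2
  have hK : ∀ n, ellK (r₂ n ^ 2 / r₃ n ^ 2) = D 0 / (r₂ 0 * r₃ 0 * r₄ 0) * r₃ n ^ 2 / 2 := by
    intro n
    rw [ellK_theta (T := 2 ^ n * T) (by positivity) (p2 n) (p3 n) (p4 n) (e2 n) (e3 n) (e4 n),
      ← hinv n]
    have := p2 n; have := p3 n; have := p4 n
    simp only [hD]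
    field_simp
  have l3 : Tendsto r₃ atTop (𝓝 1) := by
    have h := tendsto_theta3_const hT
    simp only [e3] at h
    exact_mod_cast (Complex.continuous_re.tendsto _).comp h
  -- θ₂(2τ)² = θ₃(τ)² - θ₃(2τ)² tends to 0 because θ₃ tends to 1. Hence the modulus tends to 0, K
  -- tends to π/2, and c = π.
  have l2 : Tendsto (fun n => r₂ (n + 1) ^ 2) atTop (𝓝 0) := by
    have : ∀ n, r₂ (n + 1) ^ 2 = r₃ n ^ 2 - r₃ (n + 1) ^ 2 := fun n => by
      have := theta3_const_sq (mul_I_im_pos (T := 2 ^ n * T) (by positivity))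
      rw [← hstep, e3, e3, e2] at this
      norm_cast at this
      linarith
    simp only [this]
    have := (l3.pow 2).sub (((tendsto_add_atTop_iff_nat 1).mpr l3).pow 2)
    simpa using this
  have lκ : Tendsto (fun n => r₂ (n + 1) ^ 2 / r₃ (n + 1) ^ 2) atTop (𝓝 0) := by
    have : Tendsto (fun n => r₂ (n + 1) ^ 2 / r₃ (n + 1) ^ 2) atTop (𝓝 (0 / 1 ^ 2)) :=
      l2.div (((tendsto_add_atTop_iff_nat 1).mpr l3).pow 2) (by norm_num)
    simpa using this
  have lK : Tendsto (fun n => ellK (r₂ (n + 1) ^ 2 / r₃ (n + 1) ^ 2)) atTop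
      (𝓝 (Real.pi / 2)) := by
    have hk1 : ∀ n, r₂ n ^ 2 / r₃ n ^ 2 < 1 := fun n => by
      have hj := theta_const_pow_four (mul_I_im_pos (T := 2 ^ n * T) (by positivity))
      rw [e2, e3, e4] at hj
      norm_cast at hj
      have a2 := p2 n; have a3 := p3 n
      have : 0 < r₄ n ^ 4 := by have := p4 n; positivity
      rw [div_lt_one (by positivity)]
      nlinarith
    have hk0 : ∀ n, 0 < r₂ n ^ 2 / r₃ n ^ 2 := fun n => by
      have := p2 n; have := p3 n; positivity
    refine tendsto_of_tendsto_of_tendsto_of_le_of_le tendsto_const_nhds (h := fun n =>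
      Real.pi / 2 * (1 / Real.sqrt (1 - (r₂ (n + 1) ^ 2 / r₃ (n + 1) ^ 2) ^ 2))) ?_ (fun n => ?_)
      (fun n => ellK_le (hk0 _).le (hk1 _))
    · have := (tendsto_const_nhds (x := (1 : ℝ))).sub (lκ.pow 2)
      have := (Real.continuous_sqrt.tendsto _).comp this
      have := ((tendsto_const_nhds (x := (1 : ℝ))).div this (by simp)).const_mul (Real.pi / 2)
      simpa using this
    · have := ellK_strictMono le_rfl (hk0 (n + 1)) (hk1 _)
      rw [ellK_zero] at this
      exact this.le
  have lK' : Tendsto (fun n => ellK (r₂ (n + 1) ^ 2 / r₃ (n + 1) ^ 2)) atTop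
      (𝓝 (D 0 / (r₂ 0 * r₃ 0 * r₄ 0) / 2)) := by
    simp only [hK]
    have := ((((tendsto_add_atTop_iff_nat 1).mpr l3).pow 2).const_mul
      (D 0 / (r₂ 0 * r₃ 0 * r₄ 0))).div_const 2
    simpa using this
  have hpi := tendsto_nhds_unique lK lK'
  have hD0 : D 0 = Real.pi * (r₂ 0 * r₃ 0 * r₄ 0) := by
    have := p2 0; have := p3 0; have := p4 0
    field_simp at hpi
    linarith
  have h0 : (((2 ^ 0 * T : ℝ) : ℂ) * Complex.I) = T * Complex.I := by simp
  have q2 := e2 0; have q3 := e3 0; have q4 := e4 0; have qD := hDe 0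
  rw [h0] at q2 q3 q4 qD
  rw [qD, q2, q3, q4, hD0]
  push_cast
  ring

/-! ### The parameters attached to the modulus `k` -/

lemma theta3_const_inv {T : ℝ} (hT : 0 < T) :
    theta3 ((1 / T : ℝ) * Complex.I) 0 ^ 2 = T * theta3 (T * Complex.I) 0 ^ 2 := by
  have h := jacobiTheta₂_functional_equation 0 (T * Complex.I)
  have hT' : (T : ℂ) ≠ 0 := by exact_mod_cast hT.ne'
  have e1 : -Complex.I * (T * Complex.I) = T := by
    linear_combination (-(T : ℂ)) * Complex.I_sq
  have e3 : -1 / ((T : ℂ) * Complex.I) = ((1 / T : ℝ) : ℂ) * Complex.I := by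
    push_cast
    field_simp
    rw [Complex.I_sq]
  rw [e1, e3] at h
  simp only [theta3]
  have hs : ((T : ℂ) ^ (1 / 2 : ℂ)) ^ 2 = T := by
    rw [← Complex.cpow_nat_mul]; norm_num
  rw [h]
  have hn : (T : ℂ) ^ (1 / 2 : ℂ) ≠ 0 := by simp [Complex.cpow_eq_zero_iff, hT']
  simp only [zero_div, ne_eq, OfNat.ofNat_ne_zero, not_false_eq_true, zero_pow, mul_zero,
    Complex.exp_zero, mul_one, mul_pow, div_pow, hs, one_pow]
  field_simp

lemma theta2_const_inv {T : ℝ} (hT : 0 < T) :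
    theta2 ((1 / T : ℝ) * Complex.I) 0 ^ 2 = T * theta4 (T * Complex.I) 0 ^ 2 := by
  have h := jacobiTheta₂_functional_equation (0 + 1 / 2) (T * Complex.I)
  have hT' : (T : ℂ) ≠ 0 := by exact_mod_cast hT.ne'
  have e1 : -Complex.I * (T * Complex.I) = T := by
    linear_combination (-(T : ℂ)) * Complex.I_sq
  have e3 : -1 / ((T : ℂ) * Complex.I) = ((1 / T : ℝ) : ℂ) * Complex.I := by
    push_cast
    field_simp
    rw [Complex.I_sq]
  have e4 : (0 + 1 / 2 : ℂ) / (T * Complex.I) = -(((1 / T : ℝ) : ℂ) * Complex.I / 2) := by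
    push_cast
    field_simp
    rw [Complex.I_sq]; ring
  have e5 : -(Real.pi : ℂ) * Complex.I * (0 + 1 / 2) ^ 2 / (T * Complex.I) =
      Complex.I * Real.pi * (((1 / T : ℝ) : ℂ) * Complex.I / 4 + 0) := by
    push_cast
    field_simp
    linear_combination (-4 : ℂ) * Complex.I_sq
  rw [e1, e3, e4, e5, jacobiTheta₂_neg_left] at h
  simp only [theta2, theta4, zero_add] at h ⊢
  have hs : ((T : ℂ) ^ (1 / 2 : ℂ)) ^ 2 = T := by
    rw [← Complex.cpow_nat_mul]; norm_num
  have hn : (T : ℂ) ^ (1 / 2 : ℂ) ≠ 0 := by simp [Complex.cpow_eq_zero_iff, hT']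
  rw [h]
  simp only [mul_pow, div_pow, hs, one_pow]
  field_simp

/-- The elliptic parameters of the modulus `k` expressed by theta constants. -/
structure Params (k : ℝ) where
  T : ℝ
  r₂ : ℝ
  r₃ : ℝ
  r₄ : ℝ
  T_pos : 0 < T
  r₂_pos : 0 < r₂
  r₃_pos : 0 < r₃
  r₄_pos : 0 < r₄
  tau_eq : tau k = T * Complex.I
  theta2_eq : theta2 (tau k) 0 = r₂
  theta3_eq : theta3 (tau k) 0 = r₃
  theta4_eq : theta4 (tau k) 0 = r₄
  pi_mul : Real.pi * r₃ ^ 2 = 2 * ellK k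
  k_eq : r₂ ^ 2 = k * r₃ ^ 2
  compl_eq : r₄ ^ 2 = compl k * r₃ ^ 2
  deriv_eq : deriv (theta1 (tau k)) 0 = Real.pi * (r₂ * r₃ * r₄)

lemma ellK_theta' {T : ℝ} (hT : 0 < T) {r₂ r₃ r₄ : ℝ} (p2 : 0 < r₂) (p3 : 0 < r₃) (p4 : 0 < r₄)
    (e2 : theta2 (T * Complex.I) 0 = r₂) (e3 : theta3 (T * Complex.I) 0 = r₃)
    (e4 : theta4 (T * Complex.I) 0 = r₄) :
    ellK (r₂ ^ 2 / r₃ ^ 2) = Real.pi * r₃ ^ 2 / 2 := by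
  rw [ellK_theta hT p2 p3 p4 e2 e3 e4, deriv_theta1_zero hT, e2, e3, e4]
  rw [show (Real.pi : ℂ) * (r₂ * r₃ * r₄) = ((Real.pi * (r₂ * r₃ * r₄) : ℝ) : ℂ) by push_cast; rfl,
    Complex.ofReal_re]
  field_simp

/-- Let a = θ₂²/θ₃² and b = θ₄²/θ₃² at τ = iT. Jacobi's identity gives a² + b² = 1, and evaluating K
at iT and at i/T, where θ₂ and θ₄ are exchanged, gives K(b) = T·K(a). Since K(√(1 - a²))/K(a) is
strictly decreasing in a and equals K(k')/K(k), it follows that a = k and b = k'. -/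
theorem nonempty_params {k : ℝ} (hk0 : 0 < k) (hk1 : k < 1) : Nonempty (Params k) := by
  have hc0 : 0 < compl k := Real.sqrt_pos.mpr (by nlinarith)
  have hcsq : compl k ^ 2 = 1 - k ^ 2 := Real.sq_sqrt (by nlinarith)
  have hc1 : compl k < 1 := by nlinarith
  have hK := ellK_pos hk0 hk1
  have hK' := ellK_pos hc0 hc1
  set T := ellK (compl k) / ellK k with hTdef
  have hT : 0 < T := by positivity
  have hτ : tau k = T * Complex.I := by rw [tau, hTdef]; push_cast; ring
  obtain ⟨r₂, p2, e2⟩ := theta2_zero_pos hT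
  obtain ⟨r₃, p3, e3⟩ := theta3_real_pos hT 0
  obtain ⟨r₄, p4, e4⟩ := theta4_real_pos hT 0
  obtain ⟨s₂, q2, f2⟩ := theta2_zero_pos (one_div_pos.mpr hT)
  obtain ⟨s₃, q3, f3⟩ := theta3_real_pos (one_div_pos.mpr hT) 0
  obtain ⟨s₄, q4, f4⟩ := theta4_real_pos (one_div_pos.mpr hT) 0
  rw [Complex.ofReal_zero] at e3 e4 f3 f4
  have hj : r₃ ^ 4 = r₂ ^ 4 + r₄ ^ 4 := by
    have := theta_const_pow_four (mul_I_im_pos hT)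
    rw [e2, e3, e4] at this
    exact_mod_cast this
  have g3 : s₃ ^ 2 = T * r₃ ^ 2 := by
    have := theta3_const_inv hT
    rw [f3, e3] at this
    exact_mod_cast this
  have g2 : s₂ ^ 2 = T * r₄ ^ 2 := by
    have := theta2_const_inv hT
    rw [f2, e4] at this
    exact_mod_cast this
  have hA := ellK_theta' hT p2 p3 p4 e2 e3 e4
  have hB := ellK_theta' (one_div_pos.mpr hT) q2 q3 q4 f2 f3 f4
  rw [g2, g3, mul_div_mul_left _ _ hT.ne'] at hB
  set a := r₂ ^ 2 / r₃ ^ 2 with ha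
  set b := r₄ ^ 2 / r₃ ^ 2 with hb
  have ha0 : 0 < a := by positivity
  have hb0 : 0 < b := by positivity
  have hab : a ^ 2 + b ^ 2 = 1 := by
    rw [ha, hb]; field_simp; linarith
  have ha1 : a < 1 := by nlinarith
  have hb1 : b < 1 := by nlinarith
  have hTeq : ellK b = T * ellK a := by rw [hA, hB]; ring
  have hTk : ellK (compl k) = T * ellK k := by rw [hTdef]; field_simp
  have hak : a = k := by
    rcases lt_trichotomy a k with h | h | h
    · have h1 := ellK_strictMono ha0.le h hk1
      have hsq : a ^ 2 < k ^ 2 := by gcongr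
      have hbc : compl k < b := lt_of_pow_lt_pow_left₀ 2 hb0.le (by linarith)
      have h2 := ellK_strictMono hc0.le hbc hb1
      have h3 : T * ellK a < T * ellK k := by gcongr
      linarith
    · exact h
    · have h1 := ellK_strictMono hk0.le h ha1
      have hsq : k ^ 2 < a ^ 2 := by gcongr
      have hbc : b < compl k := lt_of_pow_lt_pow_left₀ 2 hc0.le (by linarith)
      have h2 := ellK_strictMono hb0.le hbc hc1
      have h3 : T * ellK k < T * ellK a := by gcongr
      linarith
  have hbk : b = compl k := by
    have : b ^ 2 = compl k ^ 2 := by rw [hcsq, ← hak]; linarith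
    exact (pow_left_inj₀ hb0.le hc0.le two_ne_zero).mp this
  refine ⟨⟨T, r₂, r₃, r₄, hT, p2, p3, p4, hτ, by rw [hτ, e2], by rw [hτ, e3], by rw [hτ, e4],
    ?_, ?_, ?_, ?_⟩⟩
  · rw [← hak, hA]; ring
  · rw [← hak, ha]; field_simp
  · rw [← hbk, hb]; field_simp
  · rw [hτ, deriv_theta1_zero hT, e2, e3, e4]

/-! ### Uniqueness for curves uniformised by a holomorphic function -/

/-- If `F' = γ S` and `S² = Q ∘ F` near `u₀`, and a plane curve `(w, s)` satisfies `s² = Q(w)`,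
`w' = γ s u'`, with limit `(F u₀, S u₀)` as `u → u₀`, then `w = F ∘ u` and `s = S ∘ u` near the
limit point. -/
lemma eventually_eq_comp_of_ode {F S Q : ℂ → ℂ} {γ u₀ : ℂ} (hγ : γ ≠ 0) (hS0 : S u₀ ≠ 0)
    (hSc : ContinuousAt S u₀) (hF : AnalyticAt ℂ F u₀)
    (hFd : ∀ᶠ u in 𝓝 u₀, HasDerivAt F (γ * S u) u) (hSQ : ∀ᶠ u in 𝓝 u₀, S u ^ 2 = Q (F u))
    {a b t₀ : ℝ} {w s u w' : ℝ → ℂ}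
    [(𝓝[Set.Ioo a b] t₀).NeBot]
    (hw : Tendsto w (𝓝[Set.Ioo a b] t₀) (𝓝 (F u₀))) (hs : Tendsto s (𝓝[Set.Ioo a b] t₀) (𝓝 (S u₀)))
    (hu : Tendsto u (𝓝[Set.Ioo a b] t₀) (𝓝 u₀))
    (hwd : ∀ t ∈ Set.Ioo a b, HasDerivAt w (w' t) t)
    (hud : ∀ t ∈ Set.Ioo a b, HasDerivAt u (w' t / (γ * s t)) t)
    (hsq : ∀ t ∈ Set.Ioo a b, s t ^ 2 = Q (w t)) :
    ∀ᶠ t in 𝓝[Set.Ioo a b] t₀, w t = F (u t) ∧ s t = S (u t) := by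
  have hd0 : HasStrictDerivAt F (γ * S u₀) u₀ := by
    have := hF.hasStrictDerivAt
    rwa [hFd.self_of_nhds.deriv] at this
  have hne : γ * S u₀ ≠ 0 := mul_ne_zero hγ hS0
  set Ψ := HasStrictDerivAt.localInverse F (γ * S u₀) u₀ hd0 hne with hΨ
  have hΨs : HasStrictDerivAt Ψ (γ * S u₀)⁻¹ (F u₀) := hd0.to_localInverse hne
  have hΨ0 : Ψ (F u₀) = u₀ :=
    (HasStrictFDerivAt.localInverse_apply_image (f := F) (a := u₀)
      (hd0.hasStrictFDerivAt_equiv hne))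
  have hΨr : ∀ᶠ y in 𝓝 (F u₀), F (Ψ y) = y :=
    HasStrictFDerivAt.eventually_right_inverse (f := F) (a := u₀) (hd0.hasStrictFDerivAt_equiv hne)
  have hΨt : Tendsto Ψ (𝓝 (F u₀)) (𝓝 u₀) := by
    have := hΨs.hasDerivAt.continuousAt.tendsto
    rwa [hΨ0] at this
  have hΨc : ∀ᶠ y in 𝓝 (F u₀), ContinuousAt Ψ y := by
    have hE := hd0.hasStrictFDerivAt_equiv hne
    set e := hE.toOpenPartialHomeomorph F
    filter_upwards [e.open_target.mem_nhds hE.image_mem_toOpenPartialHomeomorph_target] with y hy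
    exact e.continuousAt_symm hy
  have hΨd : ∀ᶠ y in 𝓝 (F u₀), HasDerivAt Ψ (γ * S (Ψ y))⁻¹ y := by
    have h1 : ∀ᶠ y in 𝓝 (F u₀), S (Ψ y) ≠ 0 :=
      hΨt.eventually (hSc.eventually_ne hS0)
    filter_upwards [hΨt.eventually hFd, hΨr.eventually_nhds, h1, hΨc] with y e1 e2 e3 e4
    exact e1.of_local_left_inverse e4 (mul_ne_zero hγ e3) e2
  -- Both s and S ∘ Ψ ∘ w are square roots of Q(w). Their sum tends to 2S(u₀) ≠ 0, so they lie on
  -- the same sheet.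
  have hsum : ∀ᶠ t in 𝓝[Set.Ioo a b] t₀, s t + S (Ψ (w t)) ≠ 0 := by
    have h1 : Tendsto (fun t => s t + S (Ψ (w t))) (𝓝[Set.Ioo a b] t₀) (𝓝 (S u₀ + S u₀)) :=
      hs.add (hSc.tendsto.comp (hΨt.comp hw))
    exact h1.eventually_ne (by rw [← two_mul]; exact mul_ne_zero two_ne_zero hS0)
  have hall : ∀ᶠ t in 𝓝[Set.Ioo a b] t₀, t ∈ Set.Ioo a b ∧ F (Ψ (w t)) = w t ∧
      s t = S (Ψ (w t)) ∧ HasDerivAt (fun t => Ψ (w t) - u t) 0 t := by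
    filter_upwards [self_mem_nhdsWithin, hsum, hw.eventually hΨr, hw.eventually hΨd,
      (hΨt.comp hw).eventually hSQ] with t ht e1 e2 e3 e4
    have hss : s t = S (Ψ (w t)) := by
      have h0 : (s t - S (Ψ (w t))) * (s t + S (Ψ (w t))) = 0 := by
        have e4' : S (Ψ (w t)) ^ 2 = Q (F (Ψ (w t))) := e4
        rw [e2] at e4'
        linear_combination hsq t ht - e4'
      exact sub_eq_zero.mp ((mul_eq_zero.mp h0).resolve_right e1)
    refine ⟨ht, e2, hss, ?_⟩
    have hd := (e3.comp t (hwd t ht)).sub (hud t ht)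
    refine hd.congr_deriv ?_
    rw [← hss]; ring
  rw [eventually_nhdsWithin_iff, Metric.eventually_nhds_iff_ball] at hall
  obtain ⟨ε, hε, hball⟩ := hall
  rw [Real.ball_eq_Ioo] at hball
  -- Ψ ∘ w - u has derivative 0 on the interval J. The point t₀ may be an end point of (a, b), so
  -- the constant is read off from the limit at t₀.
  set J := Set.Ioo (t₀ - ε) (t₀ + ε) ∩ Set.Ioo a b with hJ
  have hJo : IsOpen J := isOpen_Ioo.inter isOpen_Ioo
  have hJc : IsPreconnected J := ((convex_Ioo _ _).inter (convex_Ioo _ _)).isPreconnected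
  have hJm : J ∈ 𝓝[Set.Ioo a b] t₀ := by
    rw [hJ, Set.inter_comm]
    exact inter_mem_nhdsWithin _ (Ioo_mem_nhds (by linarith) (by linarith))
  have hlim : Tendsto (fun t => Ψ (w t) - u t) (𝓝[Set.Ioo a b] t₀) (𝓝 0) := by
    simpa using (hΨt.comp hw).sub hu
  have hconst : ∀ x ∈ J, ∀ y ∈ J, Ψ (w x) - u x = Ψ (w y) - u y := fun x hx y hy =>
    hJo.is_const_of_deriv_eq_zero hJc
      (fun t ht => (hball t ht.1 ht.2).2.2.2.differentiableAt.differentiableWithinAt)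
      (fun t ht => (hball t ht.1 ht.2).2.2.2.deriv) hx hy
  have hzero : ∀ x ∈ J, Ψ (w x) - u x = 0 := fun x hx => by
    refine tendsto_nhds_unique (f := fun t => Ψ (w t) - u t) (l := 𝓝[Set.Ioo a b] t₀) ?_ hlim
    refine tendsto_const_nhds.congr' ?_
    filter_upwards [hJm] with y hy using hconst x hx y hy
  filter_upwards [hJm] with t ht
  obtain ⟨_, e1, e2, _⟩ := hball t ht.1 ht.2
  have := sub_eq_zero.mp (hzero t ht)
  rw [this] at e1 e2
  exact ⟨e1.symm, e2⟩

/-! ### The uniformisation of the spectral curve -/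

/-- `abelZ` and `abelH` are the coordinates ζ, η of the point with Abel image `a`. The base point ∞₁
corresponds to a = 0, a pole of `abelZ`, where η/ζ² tends to -iK/2. -/
def abelZ (k : ℝ) (a : ℂ) : ℂ :=
  -Complex.I * (theta2 (tau k) a * theta4 (tau k) a) / (theta1 (tau k) a * theta3 (tau k) a)

def abelH (k : ℝ) (a : ℂ) : ℂ :=
  Complex.I * ellK k / 2 * (k * compl k) *
    (theta1 (tau k) a ^ 4 + theta3 (tau k) a ^ 4) / (theta1 (tau k) a * theta3 (tau k) a) ^ 2

namespace Params

variable {k : ℝ} (P : Params k)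
include P

lemma im_pos : 0 < (tau k).im := by rw [P.tau_eq]; exact mul_I_im_pos P.T_pos

lemma theta2_ne : theta2 (tau k) 0 ≠ 0 := by rw [P.theta2_eq]; exact_mod_cast P.r₂_pos.ne'
lemma theta3_ne : theta3 (tau k) 0 ≠ 0 := by rw [P.theta3_eq]; exact_mod_cast P.r₃_pos.ne'
lemma theta4_ne : theta4 (tau k) 0 ≠ 0 := by rw [P.theta4_eq]; exact_mod_cast P.r₄_pos.ne'

lemma ellK_eq : (ellK k : ℂ) = Real.pi * theta3 (tau k) 0 ^ 2 / 2 := by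
  have := P.pi_mul
  rw [P.theta3_eq]
  have h : ellK k = Real.pi * P.r₃ ^ 2 / 2 := by linarith
  rw [h]; push_cast; ring

lemma ellK_ne : (ellK k : ℂ) ≠ 0 := by
  rw [P.ellK_eq]
  have h3 := P.theta3_ne
  have hpi : (Real.pi : ℂ) ≠ 0 := by exact_mod_cast Real.pi_ne_zero
  exact div_ne_zero (mul_ne_zero hpi (pow_ne_zero 2 h3)) two_ne_zero

lemma mul_k : (k : ℂ) * theta3 (tau k) 0 ^ 2 = theta2 (tau k) 0 ^ 2 := by
  rw [P.theta3_eq, P.theta2_eq]; exact_mod_cast P.k_eq.symm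

lemma mul_compl : (compl k : ℂ) * theta3 (tau k) 0 ^ 2 = theta4 (tau k) 0 ^ 2 := by
  rw [P.theta3_eq, P.theta4_eq]; exact_mod_cast P.compl_eq.symm

lemma k_sq_add : (k : ℂ) ^ 2 + (compl k : ℂ) ^ 2 = 1 := by
  have h := theta_const_pow_four P.im_pos
  have h3 := P.theta3_ne
  have e1 := P.mul_k
  have e2 := P.mul_compl
  apply mul_right_cancel₀ (pow_ne_zero 4 h3)
  rw [one_mul]
  linear_combination -h + (k * theta3 (tau k) 0 ^ 2 + theta2 (tau k) 0 ^ 2) * e1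
    + (compl k * theta3 (tau k) 0 ^ 2 + theta4 (tau k) 0 ^ 2) * e2

lemma k_ne : (k : ℂ) ≠ 0 := fun h => by
  have := P.mul_k
  rw [h, zero_mul] at this
  exact pow_ne_zero 2 P.theta2_ne this.symm

lemma compl_ne : (compl k : ℂ) ≠ 0 := fun h => by
  have := P.mul_compl
  rw [h, zero_mul] at this
  exact pow_ne_zero 2 P.theta4_ne this.symm

lemma deriv_theta1 : deriv (theta1 (tau k)) 0 =
    Real.pi * (theta2 (tau k) 0 * theta3 (tau k) 0 * theta4 (tau k) 0) := by
  rw [P.deriv_eq, P.theta2_eq, P.theta3_eq, P.theta4_eq]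

lemma theta2_sq_eq (a : ℂ) : theta2 (tau k) a ^ 2 =
    k * theta3 (tau k) a ^ 2 - compl k * theta1 (tau k) a ^ 2 := by
  have h3 := pow_ne_zero 2 P.theta3_ne
  apply mul_left_cancel₀ h3
  rw [Monopole.theta2_sq_eq P.im_pos]
  linear_combination (-theta3 (tau k) a ^ 2) * P.mul_k + theta1 (tau k) a ^ 2 * P.mul_compl

lemma theta4_sq_eq (a : ℂ) : theta4 (tau k) a ^ 2 =
    compl k * theta3 (tau k) a ^ 2 + k * theta1 (tau k) a ^ 2 := by
  have h3 := pow_ne_zero 2 P.theta3_ne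
  apply mul_left_cancel₀ h3
  rw [Monopole.theta4_sq_eq P.im_pos]
  linear_combination (-theta3 (tau k) a ^ 2) * P.mul_compl - theta1 (tau k) a ^ 2 * P.mul_k

lemma theta24_sq (a : ℂ) : (theta2 (tau k) a * theta4 (tau k) a) ^ 2 =
    k * compl k * (theta3 (tau k) a ^ 4 - theta1 (tau k) a ^ 4)
      + (k ^ 2 - compl k ^ 2) * (theta1 (tau k) a * theta3 (tau k) a) ^ 2 := by
  rw [mul_pow, P.theta2_sq_eq, P.theta4_sq_eq]
  ring

lemma theta24_four (a : ℂ) : (theta2 (tau k) a * theta4 (tau k) a) ^ 4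
    - 2 * (k ^ 2 - compl k ^ 2) * (theta2 (tau k) a * theta4 (tau k) a) ^ 2
      * (theta1 (tau k) a * theta3 (tau k) a) ^ 2 + (theta1 (tau k) a * theta3 (tau k) a) ^ 4 =
    (k * compl k) ^ 2 * (theta1 (tau k) a ^ 4 + theta3 (tau k) a ^ 4) ^ 2 := by
  rw [show (theta2 (tau k) a * theta4 (tau k) a) ^ 4
    = ((theta2 (tau k) a * theta4 (tau k) a) ^ 2) ^ 2 by ring, P.theta24_sq]
  linear_combination (-((k : ℂ) ^ 2 + (compl k : ℂ) ^ 2 + 1)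
    * (theta1 (tau k) a * theta3 (tau k) a) ^ 4) * P.k_sq_add

lemma onCurve_abel {a : ℂ} (ha : theta1 (tau k) a * theta3 (tau k) a ≠ 0) :
    OnCurve k (abelZ k a) (abelH k a) := by
  have h := P.theta24_four a
  rw [OnCurve, abelZ, abelH]
  have e2 : Complex.I ^ 2 = -1 := Complex.I_sq
  have e4 : Complex.I ^ 4 = 1 := Complex.I_pow_four
  generalize theta2 (tau k) a * theta4 (tau k) a = A at *
  generalize hB : theta1 (tau k) a * theta3 (tau k) a = B at *
  generalize theta1 (tau k) a ^ 4 + theta3 (tau k) a ^ 4 = E at *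
  have key : (Complex.I * (ellK k : ℂ) / 2 * (k * compl k) * E / B ^ 2) ^ 2 + (ellK k : ℂ) ^ 2 / 4 *
      ((-Complex.I * A / B) ^ 4 + 2 * ((k : ℂ) ^ 2 - (compl k : ℂ) ^ 2) * (-Complex.I * A / B) ^ 2
        + 1) = (ellK k : ℂ) ^ 2 / 4 / B ^ 4 * (Complex.I ^ 2 * (k * compl k) ^ 2 * E ^ 2 +
          (Complex.I ^ 4 * A ^ 4 + 2 * ((k : ℂ) ^ 2 - (compl k : ℂ) ^ 2) * Complex.I ^ 2 * A ^ 2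
            * B ^ 2 + B ^ 4)) := by
    field_simp
    ring
  rw [key, e2, e4]
  linear_combination (ellK k : ℂ) ^ 2 / 4 / B ^ 4 * h

/-- The numerator of the derivative of θ₂θ₄/(θ₁θ₃). It splits into the Wronskians of (θ₁, θ₄) and
(θ₂, θ₃), and its value is the reason why dζ = 4η da. -/
lemma wronskian_prod (a : ℂ) :
    (deriv (theta2 (tau k)) a * theta4 (tau k) a + theta2 (tau k) a * deriv (theta4 (tau k)) a)
        * (theta1 (tau k) a * theta3 (tau k) a)
      - theta2 (tau k) a * theta4 (tau k) a * (deriv (theta1 (tau k)) a * theta3 (tau k) a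
        + theta1 (tau k) a * deriv (theta3 (tau k)) a) =
      -(2 * ellK k * (k * compl k)) * (theta1 (tau k) a ^ 4 + theta3 (tau k) a ^ 4) := by
  have w1 := wronskian_theta14 P.im_pos a
  have w2 := wronskian_theta23 P.im_pos a
  have h2 := P.theta2_ne
  have h3 := P.theta3_ne
  rw [P.deriv_theta1] at w1 w2
  have w1' : deriv (theta1 (tau k)) a * theta4 (tau k) a - theta1 (tau k) a * deriv (theta4 (tau k)) a
      = Real.pi * theta4 (tau k) 0 ^ 2 * (theta2 (tau k) a * theta3 (tau k) a) := by
    apply mul_right_cancel₀ (mul_ne_zero h2 h3)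
    linear_combination w1
  have w2' : deriv (theta2 (tau k)) a * theta3 (tau k) a - theta2 (tau k) a * deriv (theta3 (tau k)) a
      = -Real.pi * theta4 (tau k) 0 ^ 2 * (theta1 (tau k) a * theta4 (tau k) a) := by
    apply mul_right_cancel₀ (mul_ne_zero h2 h3)
    linear_combination w2
  have q2 := P.theta2_sq_eq a
  have q4 := P.theta4_sq_eq a
  rw [P.ellK_eq]
  rw [← P.mul_compl] at w1' w2'
  linear_combination (theta1 (tau k) a * theta4 (tau k) a) * w2'
    - theta2 (tau k) a * theta3 (tau k) a * w1'
    - (Real.pi * (compl k * theta3 (tau k) 0 ^ 2)) * (theta1 (tau k) a ^ 2 * q4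
      + theta3 (tau k) a ^ 2 * q2)

lemma hasDerivAt_abelZ {a : ℂ} (ha : theta1 (tau k) a * theta3 (tau k) a ≠ 0) :
    HasDerivAt (abelZ k) (4 * abelH k a) a := by
  have hτ := P.im_pos
  have h := (((hasDerivAt_theta2 hτ a).mul (hasDerivAt_theta4 hτ a)).const_mul (-Complex.I)).div
    ((hasDerivAt_theta1 hτ a).mul (hasDerivAt_theta3 hτ a)) ha
  refine h.congr_deriv ?_
  have w := P.wronskian_prod a
  simp only [Pi.mul_apply]
  rw [abelH, div_eq_iff (pow_ne_zero 2 ha), mul_div_assoc', div_mul_cancel₀ _ (pow_ne_zero 2 ha)]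
  linear_combination (-Complex.I) * w

/-- The local coordinate `1/ζ` near `∞₁`. -/
lemma hasDerivAt_inv_abelZ {a : ℂ} (ha : theta2 (tau k) a * theta4 (tau k) a ≠ 0) :
    HasDerivAt (fun a => Complex.I * (theta1 (tau k) a * theta3 (tau k) a)
        / (theta2 (tau k) a * theta4 (tau k) a))
      (-4 * (-(Complex.I * ellK k / 2 * (k * compl k) *
        (theta1 (tau k) a ^ 4 + theta3 (tau k) a ^ 4)
          / (theta2 (tau k) a * theta4 (tau k) a) ^ 2))) a := by
  have hτ := P.im_pos
  have h := (((hasDerivAt_theta1 hτ a).mul (hasDerivAt_theta3 hτ a)).const_mul Complex.I).div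
    ((hasDerivAt_theta2 hτ a).mul (hasDerivAt_theta4 hτ a)) ha
  refine h.congr_deriv ?_
  have w := P.wronskian_prod a
  simp only [Pi.mul_apply]
  rw [div_eq_iff (pow_ne_zero 2 ha), neg_mul_neg, mul_div_assoc',
    div_mul_cancel₀ _ (pow_ne_zero 2 ha)]
  linear_combination (-Complex.I) * w

/-- The curve in the coordinates (1/ζ, η/ζ²), regular at infinity. Its equation keeps its form
because the quartic in ζ is palindromic. -/
lemma inv_curve {a : ℂ} (ha : theta2 (tau k) a * theta4 (tau k) a ≠ 0) :
    (-(Complex.I * ellK k / 2 * (k * compl k) * (theta1 (tau k) a ^ 4 + theta3 (tau k) a ^ 4)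
          / (theta2 (tau k) a * theta4 (tau k) a) ^ 2)) ^ 2 =
      -((ellK k : ℂ) ^ 2 / 4 * ((Complex.I * (theta1 (tau k) a * theta3 (tau k) a)
        / (theta2 (tau k) a * theta4 (tau k) a)) ^ 4 + 2 * ((k : ℂ) ^ 2 - (compl k : ℂ) ^ 2)
        * (Complex.I * (theta1 (tau k) a * theta3 (tau k) a)
        / (theta2 (tau k) a * theta4 (tau k) a)) ^ 2 + 1)) := by
  have h := P.theta24_four a
  have e2 : Complex.I ^ 2 = -1 := Complex.I_sq
  have e4 : Complex.I ^ 4 = 1 := Complex.I_pow_four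
  generalize theta2 (tau k) a * theta4 (tau k) a = A at *
  generalize hB : theta1 (tau k) a * theta3 (tau k) a = B at *
  generalize theta1 (tau k) a ^ 4 + theta3 (tau k) a ^ 4 = E at *
  have k1 : (-(Complex.I * (ellK k : ℂ) / 2 * (k * compl k) * E / A ^ 2)) ^ 2 =
      (ellK k : ℂ) ^ 2 / 4 / A ^ 4 * (Complex.I ^ 2 * ((k * compl k) ^ 2 * E ^ 2)) := by
    field_simp
    ring
  have k2 : (ellK k : ℂ) ^ 2 / 4 * ((Complex.I * B / A) ^ 4 +
      2 * ((k : ℂ) ^ 2 - (compl k : ℂ) ^ 2) * (Complex.I * B / A) ^ 2 + 1) =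
      (ellK k : ℂ) ^ 2 / 4 / A ^ 4 * (Complex.I ^ 4 * B ^ 4 + 2 * ((k : ℂ) ^ 2 - (compl k : ℂ) ^ 2)
        * Complex.I ^ 2 * A ^ 2 * B ^ 2 + A ^ 4) := by
    field_simp
  rw [k1, k2, e2, e4]
  linear_combination (ellK k : ℂ) ^ 2 / 4 / A ^ 4 * h

end Params

/-! ### Inversion of the Abel map by continuation along the contour. -/

namespace Params

variable {k : ℝ} (P : Params k)
include P

lemma continuous_theta1 : Continuous (theta1 (tau k)) := (differentiable_theta1 P.im_pos).continuous
lemma continuous_theta2 : Continuous (theta2 (tau k)) := (differentiable_theta2 P.im_pos).continuous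
lemma continuous_theta3 : Continuous (theta3 (tau k)) := (differentiable_theta3 P.im_pos).continuous
lemma continuous_theta4 : Continuous (theta4 (tau k)) := (differentiable_theta4 P.im_pos).continuous

lemma continuousAt_abelH {a : ℂ} (ha : theta1 (tau k) a * theta3 (tau k) a ≠ 0) :
    ContinuousAt (abelH k) a := by
  have h1 := P.continuous_theta1
  have h3 := P.continuous_theta3
  unfold abelH
  exact (ContinuousAt.div (by fun_prop) (by fun_prop) (pow_ne_zero 2 ha))

lemma eventually_theta13_ne {a : ℂ} (ha : theta1 (tau k) a * theta3 (tau k) a ≠ 0) :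
    ∀ᶠ u in 𝓝 a, theta1 (tau k) u * theta3 (tau k) u ≠ 0 :=
  (P.continuous_theta1.mul P.continuous_theta3).continuousAt.eventually_ne ha

lemma eventually_theta24_ne :
    ∀ᶠ u in 𝓝 (0 : ℂ), theta2 (tau k) u * theta4 (tau k) u ≠ 0 :=
  (P.continuous_theta2.mul P.continuous_theta4).continuousAt.eventually_ne
    (mul_ne_zero P.theta2_ne P.theta4_ne)

lemma start_value : -(Complex.I * ellK k / 2 * (k * compl k) *
    (theta1 (tau k) 0 ^ 4 + theta3 (tau k) 0 ^ 4) / (theta2 (tau k) 0 * theta4 (tau k) 0) ^ 2) =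
    -Complex.I * ellK k / 2 := by
  have h3 := P.theta3_ne
  have hk := P.k_ne
  have hc := P.compl_ne
  rw [mul_pow, ← P.mul_k, ← P.mul_compl, theta1_zero]
  field_simp
  ring

/-- Behaviour of the Abel map near the base point `∞₁`. -/
lemma eventually_eq_abel_start {p q u : ℝ → ℂ}
    (hpd : ∀ t ∈ Set.Ioo (0 : ℝ) 1, HasDerivAt p (deriv p t) t)
    (hud : ∀ t ∈ Set.Ioo (0 : ℝ) 1, HasDerivAt u (deriv p t / (4 * q t)) t)
    (hon : ∀ t ∈ Set.Ioo (0 : ℝ) 1, OnCurve k (p t) (q t))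
    (hp : Tendsto (fun t => ‖p t‖) (𝓝[>] 0) atTop)
    (hq : Tendsto (fun t => q t / p t ^ 2) (𝓝[>] 0) (𝓝 (-Complex.I * (ellK k : ℂ) / 2)))
    (hu : Tendsto u (𝓝[>] 0) (𝓝 0)) :
    ∀ᶠ t in 𝓝[>] (0 : ℝ), theta1 (tau k) (u t) * theta3 (tau k) (u t) ≠ 0 ∧
      p t = abelZ k (u t) ∧ q t = abelH k (u t) := by
  have hp0 : ∀ᶠ t in 𝓝[>] (0 : ℝ), p t ≠ 0 := by
    filter_upwards [hp.eventually_gt_atTop 0] with t ht using norm_pos_iff.mp ht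
  obtain ⟨b, hb0, hb⟩ := (mem_nhdsGT_iff_exists_Ioo_subset).mp
    (hp0.and (Ioo_mem_nhdsGT (zero_lt_one (α := ℝ))))
  rw [Set.mem_Ioi] at hb0
  have hnh : 𝓝[Set.Ioo 0 b] (0 : ℝ) = 𝓝[>] 0 := nhdsWithin_Ioo_eq_nhdsGT hb0
  set F : ℂ → ℂ := fun a => Complex.I * (theta1 (tau k) a * theta3 (tau k) a)
        / (theta2 (tau k) a * theta4 (tau k) a) with hF
  set S : ℂ → ℂ := fun a => -(Complex.I * ellK k / 2 * (k * compl k) *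
    (theta1 (tau k) a ^ 4 + theta3 (tau k) a ^ 4)
      / (theta2 (tau k) a * theta4 (tau k) a) ^ 2) with hS
  have h24 := P.eventually_theta24_ne
  have hFa : AnalyticAt ℂ F 0 := by
    rw [Complex.analyticAt_iff_eventually_differentiableAt]
    filter_upwards [h24] with a ha using (P.hasDerivAt_inv_abelZ ha).differentiableAt
  have hS0 : S 0 = -Complex.I * ellK k / 2 := P.start_value
  have hF0 : F 0 = 0 := by simp [hF, theta1_zero]
  have : (𝓝[Set.Ioo 0 b] (0 : ℝ)).NeBot := by rw [hnh]; infer_instance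
  have hinv : Tendsto (fun t => (p t)⁻¹) (𝓝[>] (0 : ℝ)) (𝓝 0) := by
    rw [tendsto_zero_iff_norm_tendsto_zero]
    simp only [norm_inv]
    exact hp.inv_tendsto_atTop
  have hSc : ContinuousAt S 0 := by
    have h1 := P.continuous_theta1
    have h3 := P.continuous_theta3
    have h2 := P.continuous_theta2
    have h4 := P.continuous_theta4
    have hn : (theta2 (tau k) 0 * theta4 (tau k) 0) ^ 2 ≠ 0 := pow_ne_zero 2 h24.self_of_nhds
    exact (ContinuousAt.div (f := fun a => Complex.I * ellK k / 2 * (k * compl k) *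
      (theta1 (tau k) a ^ 4 + theta3 (tau k) a ^ 4))
      (g := fun a => (theta2 (tau k) a * theta4 (tau k) a) ^ 2)
      (by fun_prop) (by fun_prop) hn).neg
  -- Here γ = -4, since d(1/ζ) = -dζ/ζ² = -4(η/ζ²) da.
  have key := eventually_eq_comp_of_ode (F := F) (S := S) (γ := -4) (u₀ := 0)
    (Q := fun v => -((ellK k : ℂ) ^ 2 / 4 * (v ^ 4 + 2 * ((k : ℂ) ^ 2 - (compl k : ℂ) ^ 2)
        * v ^ 2 + 1))) (a := 0) (b := b) (t₀ := 0) (w := fun t => (p t)⁻¹)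
    (s := fun t => q t / p t ^ 2) (u := u) (w' := fun t => -deriv p t / p t ^ 2)
    (by norm_num)
    (by rw [hS0]; exact div_ne_zero (mul_ne_zero (neg_ne_zero.mpr Complex.I_ne_zero) P.ellK_ne)
          two_ne_zero)
    hSc
    hFa
    (by filter_upwards [h24] with a ha using P.hasDerivAt_inv_abelZ ha)
    (by filter_upwards [h24] with a ha using P.inv_curve ha)
    (by rw [hnh, hF0]; exact hinv)
    (by rw [hnh, hS0]; exact hq)
    (by rw [hnh]; exact hu)
    (fun t ht => (hpd t (hb ht).2).inv (hb ht).1)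
    (fun t ht => by
      refine (hud t (hb ht).2).congr_deriv ?_
      have h0 : p t ≠ 0 := (hb ht).1
      -- If q t = 0, both quotients are 0 by the convention x/0 = 0.
      by_cases hq0 : q t = 0
      · simp [hq0]
      · field_simp)
    (fun t ht => by
      have h0 : p t ≠ 0 := (hb ht).1
      have := hon t (hb ht).2
      rw [OnCurve] at this
      field_simp
      linear_combination 4 * this)
  rw [hnh] at key
  filter_upwards [key, hp0, hu.eventually h24] with t ht h0 h2
  obtain ⟨e1, e2⟩ := ht
  have h13 : theta1 (tau k) (u t) * theta3 (tau k) (u t) ≠ 0 := by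
    intro h
    simp only [hF] at e1
    rw [h, mul_zero, zero_div] at e1
    exact inv_ne_zero h0 e1
  have ep : p t = abelZ k (u t) := by
    rw [← inv_inv (p t), e1, abelZ]
    simp only [hF]
    rw [inv_div]
    field_simp
    rw [Complex.I_sq]; ring
  refine ⟨h13, ep, ?_⟩
  have : q t = S (u t) * p t ^ 2 := by rw [← e2]; field_simp
  rw [this, ep, abelZ, abelH]
  simp only [hS]
  generalize theta2 (tau k) (u t) * theta4 (tau k) (u t) = B at *
  generalize theta1 (tau k) (u t) * theta3 (tau k) (u t) = D at *
  field_simp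
  rw [Complex.I_sq]; ring

/-- Openness half of the continuation argument: local uniqueness applies at u(t), because `abelH`
equals q(t) ≠ 0 there. -/
lemma isOpen_abel_aux {p q u : ℝ → ℂ}
    (hpd : ∀ t ∈ Set.Ioo (0 : ℝ) 1, HasDerivAt p (deriv p t) t)
    (hqc : ContinuousOn q (Set.Ioo 0 1))
    (hud : ∀ t ∈ Set.Ioo (0 : ℝ) 1, HasDerivAt u (deriv p t / (4 * q t)) t)
    (hon : ∀ t ∈ Set.Ioo (0 : ℝ) 1, OnCurve k (p t) (q t))
    (hq0 : ∀ t ∈ Set.Ioo (0 : ℝ) 1, q t ≠ 0) :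
    IsOpen {t | t ∈ Set.Ioo (0 : ℝ) 1 ∧ theta1 (tau k) (u t) * theta3 (tau k) (u t) ≠ 0 ∧
      p t = abelZ k (u t) ∧ q t = abelH k (u t)} := by
  rw [isOpen_iff_mem_nhds]
  rintro t ⟨ht, h13, ep, eq⟩
  have hnh : 𝓝[Set.Ioo (0 : ℝ) 1] t = 𝓝 t := isOpen_Ioo.nhdsWithin_eq ht
  have hev := P.eventually_theta13_ne h13
  have : (𝓝[Set.Ioo (0 : ℝ) 1] t).NeBot := by rw [hnh]; infer_instance
  have huc : Tendsto u (𝓝 t) (𝓝 (u t)) := (hud t ht).continuousAt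
  have hZa : AnalyticAt ℂ (abelZ k) (u t) := by
    rw [Complex.analyticAt_iff_eventually_differentiableAt]
    filter_upwards [hev] with a ha using (P.hasDerivAt_abelZ ha).differentiableAt
  have key := eventually_eq_comp_of_ode (F := abelZ k) (S := abelH k) (γ := 4) (u₀ := u t)
    (Q := fun v => -((ellK k : ℂ) ^ 2 / 4 * (v ^ 4 + 2 * ((k : ℂ) ^ 2 - (compl k : ℂ) ^ 2)
        * v ^ 2 + 1))) (a := 0) (b := 1) (t₀ := t) (w := p) (s := q) (u := u) (w' := deriv p)
    (by norm_num) (by rw [← eq]; exact hq0 t ht) (P.continuousAt_abelH h13) hZa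
    (by filter_upwards [hev] with a ha using P.hasDerivAt_abelZ ha)
    (by
      filter_upwards [hev] with a ha
      have := P.onCurve_abel ha
      rw [OnCurve] at this
      linear_combination this)
    (by rw [hnh, ← ep]; exact (hpd t ht).continuousAt)
    (by rw [hnh, ← eq]; exact (hqc.continuousAt (isOpen_Ioo.mem_nhds ht)))
    (by rw [hnh]; exact huc) hpd hud
    (fun s hs => by
      have := hon s hs
      rw [OnCurve] at this
      linear_combination this)
  rw [hnh] at key
  filter_upwards [key, huc.eventually hev, isOpen_Ioo.mem_nhds ht] with s hs h1 h2
  exact ⟨h2, h1, hs⟩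

/-- Closedness half: the relations with denominators cleared pass to the limit. If θ₁θ₃ vanished at
u(t), finiteness of p(t) would make θ₂θ₄ vanish too, against `theta24_ne_zero`. -/
lemma closure_abel_aux {p q u : ℝ → ℂ} {A : Set ℝ} {t : ℝ}
    (hA : ∀ t ∈ A, theta1 (tau k) (u t) * theta3 (tau k) (u t) ≠ 0 ∧
      p t = abelZ k (u t) ∧ q t = abelH k (u t)) (ht : t ∈ closure A)
    (hp : ContinuousWithinAt p A t) (hq : ContinuousWithinAt q A t)
    (hu : ContinuousWithinAt u A t) :
    theta1 (tau k) (u t) * theta3 (tau k) (u t) ≠ 0 ∧ p t = abelZ k (u t) ∧ q t = abelH k (u t) := by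
  have c1 : ContinuousWithinAt (fun t => theta1 (tau k) (u t)) A t :=
    P.continuous_theta1.continuousAt.comp_continuousWithinAt hu
  have c2 : ContinuousWithinAt (fun t => theta2 (tau k) (u t)) A t :=
    P.continuous_theta2.continuousAt.comp_continuousWithinAt hu
  have c3 : ContinuousWithinAt (fun t => theta3 (tau k) (u t)) A t :=
    P.continuous_theta3.continuousAt.comp_continuousWithinAt hu
  have c4 : ContinuousWithinAt (fun t => theta4 (tau k) (u t)) A t :=
    P.continuous_theta4.continuousAt.comp_continuousWithinAt hu
  have r1 : p t * (theta1 (tau k) (u t) * theta3 (tau k) (u t))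
      + Complex.I * (theta2 (tau k) (u t) * theta4 (tau k) (u t)) = 0 := by
    have hc : ContinuousWithinAt (fun t => p t * (theta1 (tau k) (u t) * theta3 (tau k) (u t))
      + Complex.I * (theta2 (tau k) (u t) * theta4 (tau k) (u t))) A t := by fun_prop
    have := hc.mem_closure (t := {0}) ht (fun s hs => by
      obtain ⟨h1, h2, _⟩ := hA s hs
      simp only [Set.mem_singleton_iff]
      rw [h2, abelZ, div_mul_cancel₀ _ h1]; ring)
    simpa using this
  have r2 : q t * (theta1 (tau k) (u t) * theta3 (tau k) (u t)) ^ 2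
      - Complex.I * ellK k / 2 * (k * compl k) *
        (theta1 (tau k) (u t) ^ 4 + theta3 (tau k) (u t) ^ 4) = 0 := by
    have hc : ContinuousWithinAt (fun t => q t * (theta1 (tau k) (u t) * theta3 (tau k) (u t)) ^ 2
      - Complex.I * ellK k / 2 * (k * compl k) *
        (theta1 (tau k) (u t) ^ 4 + theta3 (tau k) (u t) ^ 4)) A t := by fun_prop
    have := hc.mem_closure (t := {0}) ht (fun s hs => by
      obtain ⟨h1, _, h2⟩ := hA s hs
      simp only [Set.mem_singleton_iff]
      rw [h2, abelH, div_mul_cancel₀ _ (pow_ne_zero 2 h1)]; ring)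
    simpa using this
  have h13 : theta1 (tau k) (u t) * theta3 (tau k) (u t) ≠ 0 := by
    intro h
    rw [h, mul_zero, zero_add] at r1
    exact theta24_ne_zero P.im_pos P.theta2_ne P.theta3_ne P.theta4_ne _ h
      ((mul_eq_zero.mp r1).resolve_left Complex.I_ne_zero)
  refine ⟨h13, ?_, ?_⟩
  · rw [abelZ, eq_div_iff h13]; linear_combination r1
  · rw [abelH, eq_div_iff (pow_ne_zero 2 h13)]; linear_combination r2

/-- The Abel map is inverted by the theta quotients `abelZ`, `abelH`. -/
theorem abelImage {ζ η a : ℂ} (h : IsAbelImage k ζ η a) :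
    theta1 (tau k) a * theta3 (tau k) a ≠ 0 ∧ ζ = abelZ k a ∧ η = abelH k a := by
  obtain ⟨p, q, hpc, hqc, hp1, hon, hq0, hpinf, hqinf, hp, hq, hint, rfl⟩ := h
  have hsub : Set.Ioo (0 : ℝ) 1 ⊆ Set.Ioc 0 1 := Set.Ioo_subset_Ioc_self
  have hpd : ∀ t ∈ Set.Ioo (0 : ℝ) 1, HasDerivAt p (deriv p t) t := fun t ht =>
    ((hp1.differentiableOn one_ne_zero t ht).differentiableAt (isOpen_Ioo.mem_nhds ht)).hasDerivAt
  have hdc : ContinuousOn (deriv p) (Set.Ioo 0 1) :=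
    hp1.continuousOn_deriv_of_isOpen isOpen_Ioo le_rfl
  have hfc : ContinuousOn (fun t => deriv p t / (4 * q t)) (Set.Ioo 0 1) :=
    hdc.div (continuousOn_const.mul (hqc.mono hsub))
      (fun t ht => mul_ne_zero (by norm_num) (hq0 t ht))
  set u : ℝ → ℂ := fun t => ∫ s in (0 : ℝ)..t, deriv p s / (4 * q s) with hu
  have hud : ∀ t ∈ Set.Ioo (0 : ℝ) 1, HasDerivAt u (deriv p t / (4 * q t)) t := fun t ht =>
    intervalIntegral.integral_hasDerivAt_right
      (hint.mono_set (Set.uIcc_subset_uIcc_left (by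
        rw [Set.uIcc_of_le zero_le_one]; exact ⟨ht.1.le, ht.2.le⟩)))
      (hfc.stronglyMeasurableAtFilter isOpen_Ioo t ht)
      (hfc.continuousAt (isOpen_Ioo.mem_nhds ht))
  have huc : ContinuousOn u (Set.Icc 0 1) := by
    have := intervalIntegral.continuousOn_primitive_interval' hint Set.left_mem_uIcc
    rwa [Set.uIcc_of_le zero_le_one] at this
  have hu0 : Tendsto u (𝓝[>] 0) (𝓝 0) := by
    have h0 := huc 0 ⟨le_rfl, zero_le_one⟩
    have h1 : u 0 = 0 := by simp [hu]
    rw [ContinuousWithinAt, h1] at h0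
    refine h0.mono_left ?_
    rw [← nhdsWithin_Ioo_eq_nhdsGT (zero_lt_one (α := ℝ))]
    exact nhdsWithin_mono _ Set.Ioo_subset_Icc_self
  have hon' : ∀ t ∈ Set.Ioo (0 : ℝ) 1, OnCurve k (p t) (q t) := fun t ht => hon t (hsub ht)
  set A := {t | t ∈ Set.Ioo (0 : ℝ) 1 ∧ theta1 (tau k) (u t) * theta3 (tau k) (u t) ≠ 0 ∧
      p t = abelZ k (u t) ∧ q t = abelH k (u t)} with hA
  have hAo : IsOpen A := P.isOpen_abel_aux hpd (hqc.mono hsub) hud hon' hq0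
  have hAne : (Set.Ioo (0 : ℝ) 1 ∩ A).Nonempty := by
    have h1 := P.eventually_eq_abel_start hpd hud hon' hpinf hqinf hu0
    obtain ⟨t, ht, ht'⟩ := (h1.and (Ioo_mem_nhdsGT (zero_lt_one (α := ℝ)))).exists
    exact ⟨t, ht', ht', ht⟩
  have hAI : A ⊆ Set.Ioo 0 1 := fun t ht => ht.1
  have hcl : ∀ t ∈ Set.Ioc (0 : ℝ) 1, t ∈ closure A →
      theta1 (tau k) (u t) * theta3 (tau k) (u t) ≠ 0 ∧ p t = abelZ k (u t) ∧
        q t = abelH k (u t) := fun t ht htA =>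
    P.closure_abel_aux (fun s hs => hs.2) htA ((hpc t ht).mono (hAI.trans hsub))
      ((hqc t ht).mono (hAI.trans hsub))
      ((huc t ⟨ht.1.le, ht.2⟩).mono (hAI.trans Set.Ioo_subset_Icc_self))
  have hsubA : Set.Ioo (0 : ℝ) 1 ⊆ A :=
    isPreconnected_Ioo.subset_of_closure_inter_subset hAo hAne
      (fun t ht => ⟨ht.2, hcl t (hsub ht.2) ht.1⟩)
  -- The end point may be a branch point, where local uniqueness fails; it is reached by closure
  -- only.
  have h1 := hcl 1 ⟨zero_lt_one, le_rfl⟩ (closure_mono hsubA (by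
    rw [closure_Ioo zero_ne_one]; exact ⟨zero_le_one, le_rfl⟩))
  rw [← hp, ← hq]
  exact h1

end Params

/-! ### Addition theorem on the spectral curve -/

/-- The mini-twistor quadratic in terms of `x₊`, `x₋`, `x₃`. -/
def quad (xp xm y ζ : ℂ) : ℂ := -Complex.I * xp - 2 * y * ζ - Complex.I * xm * ζ ^ 2

/-- The first divided difference of the Atiyah–Ward quartic. -/
def quarticDD (k : ℝ) (xp xm y w u : ℂ) : ℂ :=
  ((ellK k : ℂ) ^ 2 - 4 * xm ^ 2) / 4 * (w ^ 3 + w ^ 2 * u + w * u ^ 2 + u ^ 3)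
    + 4 * Complex.I * y * xm * (w ^ 2 + w * u + u ^ 2)
    + (4 * y ^ 2 - 2 * xp * xm + (ellK k : ℂ) ^ 2 * ((k : ℂ) ^ 2 - (compl k : ℂ) ^ 2) / 2) * (w + u)
    + 4 * Complex.I * y * xp

namespace Params

variable {k : ℝ} (P : Params k)
include P

lemma abelZ_sub {a b : ℂ} (ha : theta1 (tau k) a * theta3 (tau k) a ≠ 0)
    (hb : theta1 (tau k) b * theta3 (tau k) b ≠ 0) :
    (abelZ k a - abelZ k b) *
        (theta1 (tau k) a * theta3 (tau k) a * (theta1 (tau k) b * theta3 (tau k) b)) =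
      Complex.I * (theta1 (tau k) (a - b) * theta3 (tau k) (a + b)
        * (theta2 (tau k) 0 * theta4 (tau k) 0)) := by
  have h := theta1_add_theta3_sub P.im_pos a (-b)
  rw [← sub_eq_add_neg, sub_neg_eq_add, theta1_neg, theta2_neg, theta3_neg, theta4_neg] at h
  rw [h, abelZ, abelZ]
  simp only [neg_mul, mul_neg]
  generalize theta1 (tau k) a * theta3 (tau k) a = A at *
  generalize theta1 (tau k) b * theta3 (tau k) b = B at *
  field_simp
  ring

lemma abelZ_add {a b : ℂ} (ha : theta1 (tau k) a * theta3 (tau k) a ≠ 0)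
    (hb : theta1 (tau k) b * theta3 (tau k) b ≠ 0) :
    (abelZ k a + abelZ k b) *
        (theta1 (tau k) a * theta3 (tau k) a * (theta1 (tau k) b * theta3 (tau k) b)) =
      -Complex.I * (theta1 (tau k) (a + b) * theta3 (tau k) (a - b)
        * (theta2 (tau k) 0 * theta4 (tau k) 0)) := by
  have h := theta1_add_theta3_sub P.im_pos a b
  rw [h, abelZ, abelZ]
  generalize theta1 (tau k) a * theta3 (tau k) a = A at *
  generalize theta1 (tau k) b * theta3 (tau k) b = B at *
  field_simp
  ring

omit P in
lemma abelH_mul {a : ℂ} (ha : theta1 (tau k) a * theta3 (tau k) a ≠ 0) :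
    abelH k a * (theta1 (tau k) a * theta3 (tau k) a) ^ 2 =
      Complex.I * ellK k / 2 * (k * compl k) * (theta1 (tau k) a ^ 4 + theta3 (tau k) a ^ 4) := by
  rw [abelH, div_mul_cancel₀ _ (pow_ne_zero 2 ha)]

lemma abelZ_sq_mul {a : ℂ} (ha : theta1 (tau k) a * theta3 (tau k) a ≠ 0) :
    abelZ k a ^ 2 * (theta1 (tau k) a * theta3 (tau k) a) ^ 2 =
      k * compl k * (theta1 (tau k) a ^ 4 - theta3 (tau k) a ^ 4)
        - (k ^ 2 - compl k ^ 2) * (theta1 (tau k) a * theta3 (tau k) a) ^ 2 := by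
  rw [abelZ, div_pow, div_mul_cancel₀ _ (pow_ne_zero 2 ha), mul_pow, P.theta24_sq, neg_sq,
    Complex.I_sq]
  ring

/-- η + (iK/2)ζ² is an affine function of (θ₁/θ₃)², and `abelH_sub_mul` gives η - (iK/2)ζ² as one of
(θ₃/θ₁)². This is what makes the addition theorem linear in the divided difference of η. -/
lemma abelH_add_mul {a : ℂ} (ha : theta1 (tau k) a * theta3 (tau k) a ≠ 0) :
    (abelH k a + Complex.I * ellK k / 2 * abelZ k a ^ 2) * theta3 (tau k) a ^ 2 =
      Complex.I * ellK k * (k * compl k) * theta1 (tau k) a ^ 2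
        - Complex.I * ellK k / 2 * (k ^ 2 - compl k ^ 2) * theta3 (tau k) a ^ 2 := by
  apply mul_right_cancel₀ (pow_ne_zero 2 (left_ne_zero_of_mul ha))
  linear_combination abelH_mul ha + (Complex.I * ellK k / 2) * P.abelZ_sq_mul ha

lemma abelH_sub_mul {a : ℂ} (ha : theta1 (tau k) a * theta3 (tau k) a ≠ 0) :
    (abelH k a - Complex.I * ellK k / 2 * abelZ k a ^ 2) * theta1 (tau k) a ^ 2 =
      Complex.I * ellK k * (k * compl k) * theta3 (tau k) a ^ 2
        + Complex.I * ellK k / 2 * (k ^ 2 - compl k ^ 2) * theta1 (tau k) a ^ 2 := by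
  apply mul_right_cancel₀ (pow_ne_zero 2 (right_ne_zero_of_mul ha))
  linear_combination abelH_mul ha - (Complex.I * ellK k / 2) * P.abelZ_sq_mul ha

lemma ellK_mul_kk : (ellK k : ℂ) * (k * compl k) * theta3 (tau k) 0 ^ 2 =
    Real.pi * (theta2 (tau k) 0 * theta4 (tau k) 0) / 2 * (theta2 (tau k) 0 * theta4 (tau k) 0) := by
  rw [P.ellK_eq, show ∀ t₂ t₄ : ℂ, (Real.pi : ℂ) * (t₂ * t₄) / 2 * (t₂ * t₄)
    = Real.pi / 2 * (t₂ ^ 2 * t₄ ^ 2) from fun _ _ => by ring, ← P.mul_k, ← P.mul_compl]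
  ring

/-- The two forms of the addition theorem for `θ₁/θ₃` on the spectral curve. `δ` is the divided
difference of `η` with respect to `ζ`. -/
theorem addition {a b δ : ℂ} (ha : theta1 (tau k) a * theta3 (tau k) a ≠ 0)
    (hb : theta1 (tau k) b * theta3 (tau k) b ≠ 0) (hs : theta3 (tau k) (a + b) ≠ 0)
    (h1 : abelH k a - abelH k b = δ * (abelZ k a - abelZ k b))
    (h2 : (abelH k a + abelH k b) * δ + (ellK k : ℂ) ^ 2 / 4 * (abelZ k a + abelZ k b)
      * (abelZ k a ^ 2 + abelZ k b ^ 2 + 2 * ((k : ℂ) ^ 2 - (compl k : ℂ) ^ 2)) = 0) :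
    Real.pi * (theta2 (tau k) 0 * theta4 (tau k) 0) / 2
        * (theta1 (tau k) a * theta1 (tau k) b * theta1 (tau k) (a + b)) =
      (δ + Complex.I * ellK k / 2 * (abelZ k a + abelZ k b))
        * (theta3 (tau k) a * theta3 (tau k) b * theta3 (tau k) (a + b)) ∧
    -(Real.pi * (theta2 (tau k) 0 * theta4 (tau k) 0) / 2)
        * (theta3 (tau k) a * theta3 (tau k) b * theta1 (tau k) (a + b)) =
      (δ - Complex.I * ellK k / 2 * (abelZ k a + abelZ k b))
        * (theta1 (tau k) a * theta1 (tau k) b * theta3 (tau k) (a + b)) := by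
  have e1 := P.abelZ_sub ha hb
  have e2 := P.abelZ_add ha hb
  have e33 := theta3_add_theta3_sub P.im_pos a b
  have e11 := theta1_add_theta1_sub P.im_pos a b
  have Ua := P.abelH_add_mul ha
  have Ub := P.abelH_add_mul hb
  have Va := P.abelH_sub_mul ha
  have Vb := P.abelH_sub_mul hb
  have Hm := abelH_mul ha
  have Zm := P.abelZ_sq_mul ha
  have hc := P.ellK_mul_kk
  have hK := P.ellK_eq
  have hkk : Complex.I * ellK k * ((k : ℂ) * compl k) ≠ 0 :=
    mul_ne_zero (mul_ne_zero Complex.I_ne_zero P.ellK_ne) (mul_ne_zero P.k_ne P.compl_ne)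
  have A1 := left_ne_zero_of_mul ha
  have A3 := right_ne_zero_of_mul ha
  have B1 := left_ne_zero_of_mul hb
  have B3 := right_ne_zero_of_mul hb
  have t3 := P.theta3_ne
  have t24 := mul_ne_zero P.theta2_ne P.theta4_ne
  have hcom := not_theta1_theta3_common_zero P.im_pos t3 (a - b)
  generalize abelZ k a = Za at *
  generalize abelZ k b = Zb at *
  generalize abelH k a = Ha at *
  generalize abelH k b = Hb at *
  generalize theta1 (tau k) a = a1 at *
  generalize theta3 (tau k) a = a3 at *
  generalize theta1 (tau k) b = b1 at *
  generalize theta3 (tau k) b = b3 at *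
  generalize theta1 (tau k) (a + b) = s1 at *
  generalize theta3 (tau k) (a + b) = s3 at *
  generalize theta1 (tau k) (a - b) = d1 at *
  generalize theta3 (tau k) (a - b) = d3 at *
  generalize theta2 (tau k) 0 * theta4 (tau k) 0 = t at *
  generalize theta3 (tau k) 0 = u at *
  generalize (ellK k : ℂ) = K at *
  generalize (k : ℂ) * compl k = κ at *
  generalize (k : ℂ) ^ 2 - (compl k : ℂ) ^ 2 = c at *
  -- For ζ_a = ζ_b the relation `h1` says nothing about δ; then θ₁(a - b) = 0, and δ is the tangent
  -- slope fixed by `h2`. Otherwise `h1` alone suffices, after multiplication by ζ_a - ζ_b.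
  by_cases hZ : Za = Zb
  · subst hZ
    have hd1s : d1 * s3 = 0 := by
      have : Complex.I * (d1 * s3 * t) = 0 := by rw [← e1]; ring
      have := (mul_eq_zero.mp this).resolve_left Complex.I_ne_zero
      exact (mul_eq_zero.mp this).resolve_right t24
    have hd1 : d1 = 0 := (mul_eq_zero.mp hd1s).resolve_right hs
    have hd3 : d3 ≠ 0 := fun h => hcom hd1 h
    have hH : Ha = Hb := by linear_combination h1
    have h11 : a1 ^ 2 * b3 ^ 2 = a3 ^ 2 * b1 ^ 2 := by
      linear_combination -e11 + s1 * u ^ 2 * hd1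
    have hE : δ * (a1 ^ 4 + a3 ^ 4) = Complex.I * K * Za * (a1 ^ 4 - a3 ^ 4) := by
      apply mul_left_cancel₀ hkk
      linear_combination (a1 * a3) ^ 2 * h2 - 2 * δ * Hm - K ^ 2 * Za * Zm
        + δ * (a1 * a3) ^ 2 * hH - K ^ 2 * κ * Za * (a1 ^ 4 - a3 ^ 4) * Complex.I_sq
    have hs1 : s1 * d3 * t = 2 * Complex.I * Za * (a1 * a3 * (b1 * b3)) := by
      linear_combination -Complex.I * e2 + s1 * d3 * t * Complex.I_sq
    have hs3 : s3 * d3 * u ^ 2 * a3 ^ 2 = b3 ^ 2 * (a1 ^ 4 + a3 ^ 4) := by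
      linear_combination a3 ^ 2 * e33 - a1 ^ 2 * h11
    have hne : d3 * u ^ 2 * a3 ^ 2 ≠ 0 :=
      mul_ne_zero (mul_ne_zero hd3 (pow_ne_zero 2 t3)) (pow_ne_zero 2 A3)
    constructor
    · apply mul_right_cancel₀ hne
      linear_combination (Real.pi * u ^ 2 / 2 * a1 * b1 * a3 ^ 2) * hs1
        - (δ + Complex.I * K * Za) * a3 * b3 * hs3 - a3 * b3 ^ 3 * hE
        - 2 * Complex.I * Za * a1 ^ 2 * b1 ^ 2 * a3 ^ 3 * b3 * hK
        - 2 * Complex.I * K * Za * a1 ^ 2 * a3 * b3 * h11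
    · apply mul_right_cancel₀ hne
      linear_combination -(Real.pi * u ^ 2 / 2 * a3 ^ 3 * b3) * hs1
        - (δ - Complex.I * K * Za) * a1 * b1 * hs3 - a1 * b1 * b3 ^ 2 * hE
        + 2 * Complex.I * Za * a3 ^ 4 * a1 * b1 * b3 ^ 2 * hK
  · have hD : Za - Zb ≠ 0 := sub_ne_zero.mpr hZ
    constructor
    · apply mul_right_cancel₀ (mul_ne_zero hD (mul_ne_zero A3 B3))
      linear_combination (Real.pi * t / 2 * s1) * e1 - (Complex.I * s1 * d1 * s3) * hc
        + a3 ^ 2 * b3 ^ 2 * s3 * h1 - b3 ^ 2 * s3 * Ua + a3 ^ 2 * s3 * Ub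
        + (Complex.I * K * κ * s3) * e11
    · apply mul_right_cancel₀ (mul_ne_zero hD (mul_ne_zero A1 B1))
      linear_combination -(Real.pi * t / 2 * s1) * e1 + (Complex.I * s1 * d1 * s3) * hc
        + a1 ^ 2 * b1 ^ 2 * s3 * h1 - b1 ^ 2 * s3 * Va + a1 ^ 2 * s3 * Vb
        - (Complex.I * K * κ * s3) * e11

/-- Two distinct intersection points of the curve with a mini-twistor line. -/
theorem addition_of_quarticDD {a b xp xm y : ℂ} (ha : theta1 (tau k) a * theta3 (tau k) a ≠ 0)
    (hb : theta1 (tau k) b * theta3 (tau k) b ≠ 0)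
    (hHa : abelH k a = quad xp xm y (abelZ k a)) (hHb : abelH k b = quad xp xm y (abelZ k b))
    (hDD : quarticDD k xp xm y (abelZ k a) (abelZ k b) = 0) :
    theta3 (tau k) (a + b) ≠ 0 ∧
    Real.pi * (theta2 (tau k) 0 * theta4 (tau k) 0) / 2
        * (theta1 (tau k) a * theta1 (tau k) b * theta1 (tau k) (a + b)) =
      (-2 * y + Complex.I * (ellK k / 2 - xm) * (abelZ k a + abelZ k b))
        * (theta3 (tau k) a * theta3 (tau k) b * theta3 (tau k) (a + b)) ∧
    -(Real.pi * (theta2 (tau k) 0 * theta4 (tau k) 0) / 2)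
        * (theta3 (tau k) a * theta3 (tau k) b * theta1 (tau k) (a + b)) =
      (-2 * y - Complex.I * (ellK k / 2 + xm) * (abelZ k a + abelZ k b))
        * (theta1 (tau k) a * theta1 (tau k) b * theta3 (tau k) (a + b)) := by
  have h1 : abelH k a - abelH k b =
      (-2 * y - Complex.I * xm * (abelZ k a + abelZ k b)) * (abelZ k a - abelZ k b) := by
    rw [hHa, hHb, quad, quad]; ring
  have h2 : (abelH k a + abelH k b) * (-2 * y - Complex.I * xm * (abelZ k a + abelZ k b))
      + (ellK k : ℂ) ^ 2 / 4 * (abelZ k a + abelZ k b)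
      * (abelZ k a ^ 2 + abelZ k b ^ 2 + 2 * ((k : ℂ) ^ 2 - (compl k : ℂ) ^ 2)) = 0 := by
    rw [hHa, hHb, quad, quad, ← hDD, quarticDD]
    linear_combination (2 * xm * xp * (abelZ k a + abelZ k b)
      + xm ^ 2 * (abelZ k a ^ 2 + abelZ k b ^ 2) * (abelZ k a + abelZ k b)) * Complex.I_sq
  -- If θ₃(a + b) = 0, the values of ζ agree and those of η are opposite. On a mini-twistor line
  -- equal ζ gives equal η, so η = 0, and `h2` makes ζ a double root of ζ⁴ + 2(k² - k'²)ζ² + 1. The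
  -- roots of that polynomial are simple because kk' ≠ 0.
  have hs : theta3 (tau k) (a + b) ≠ 0 := by
    intro hs
    have e1 := P.abelZ_sub ha hb
    rw [hs, mul_zero, zero_mul, mul_zero] at e1
    have hZ : abelZ k a = abelZ k b :=
      sub_eq_zero.mp ((mul_eq_zero.mp e1).resolve_right (mul_ne_zero ha hb))
    have e33 := theta3_add_theta3_sub P.im_pos a b
    rw [hs] at e33
    have hHab : abelH k a = abelH k b := by rw [hHa, hHb, hZ]
    have hsum : abelH k a + abelH k b = 0 := by
      apply mul_right_cancel₀ (pow_ne_zero 2 (mul_ne_zero ha hb))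
      linear_combination (theta1 (tau k) b * theta3 (tau k) b) ^ 2 * abelH_mul ha
        + (theta1 (tau k) a * theta3 (tau k) a) ^ 2 * abelH_mul hb
        - Complex.I * ellK k / 2 * (k * compl k) * (theta1 (tau k) a ^ 2 * theta3 (tau k) b ^ 2
          + theta3 (tau k) a ^ 2 * theta1 (tau k) b ^ 2) * e33
    have hH0 : abelH k a = 0 := by linear_combination (hsum + hHab) / 2
    have hcur := P.onCurve_abel ha
    rw [hsum, ← hZ] at h2
    rw [OnCurve, hH0] at hcur
    have hks := P.k_sq_add
    have hkk := mul_ne_zero P.k_ne P.compl_ne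
    have hKne := P.ellK_ne
    generalize abelZ k a = Z at *
    generalize (k : ℂ) = κ at *
    generalize (compl k : ℂ) = κ' at *
    generalize (ellK k : ℂ) = K at *
    have hK2 := pow_ne_zero 2 hKne
    have h3 : Z * (Z ^ 2 + (κ ^ 2 - κ' ^ 2)) = 0 := by
      apply mul_left_cancel₀ hK2
      linear_combination h2
    have h4 : Z ^ 4 + 2 * (κ ^ 2 - κ' ^ 2) * Z ^ 2 + 1 = 0 := by
      apply mul_left_cancel₀ hK2
      linear_combination 4 * hcur
    rcases mul_eq_zero.mp h3 with h5 | h5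
    · rw [h5] at h4; norm_num at h4
    · apply pow_ne_zero 2 hkk
      linear_combination (h4 - (Z ^ 2 + (κ ^ 2 - κ' ^ 2)) * h5) / 4
        + (κ ^ 2 + κ' ^ 2 + 1) / 4 * hks
  obtain ⟨f1, f2⟩ := P.addition ha hb hs h1 h2
  exact ⟨hs, f1.trans (by ring), f2.trans (by ring)⟩

/-- The ratio of the products of `θ₁` and `θ₃` over the four intersection points. -/
theorem prod_theta_relation {a b c d xp xm y : ℂ} (hsum : a + b + c + d = 0)
    (ha : theta1 (tau k) a * theta3 (tau k) a ≠ 0) (hb : theta1 (tau k) b * theta3 (tau k) b ≠ 0)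
    (hc : theta1 (tau k) c * theta3 (tau k) c ≠ 0) (hd : theta1 (tau k) d * theta3 (tau k) d ≠ 0)
    (hHa : abelH k a = quad xp xm y (abelZ k a)) (hHb : abelH k b = quad xp xm y (abelZ k b))
    (hHc : abelH k c = quad xp xm y (abelZ k c)) (hHd : abelH k d = quad xp xm y (abelZ k d))
    (hab : quarticDD k xp xm y (abelZ k a) (abelZ k b) = 0)
    (hac : quarticDD k xp xm y (abelZ k a) (abelZ k c) = 0)
    (had : quarticDD k xp xm y (abelZ k a) (abelZ k d) = 0)
    (hbc : quarticDD k xp xm y (abelZ k b) (abelZ k c) = 0)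
    (hbd : quarticDD k xp xm y (abelZ k b) (abelZ k d) = 0)
    (hcd : quarticDD k xp xm y (abelZ k c) (abelZ k d) = 0)
    (hV : (ellK k / 2 - xm) * (ellK k / 2 + xm)
      * (abelZ k a + abelZ k b + abelZ k c + abelZ k d) = -4 * Complex.I * y * xm)
    (hX : (ellK k / 2 - xm) * (ellK k / 2 + xm) ≠ 0) (hZa : abelZ k a ≠ 0) :
    (ellK k / 2 + xm) * (theta1 (tau k) a * theta1 (tau k) b * theta1 (tau k) c * theta1 (tau k) d)
      = (ellK k / 2 - xm)
        * (theta3 (tau k) a * theta3 (tau k) b * theta3 (tau k) c * theta3 (tau k) d) := by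
  have key : ∀ a b c d : ℂ, a + b + c + d = 0 →
      theta1 (tau k) a * theta3 (tau k) a ≠ 0 → theta1 (tau k) b * theta3 (tau k) b ≠ 0 →
      theta1 (tau k) c * theta3 (tau k) c ≠ 0 → theta1 (tau k) d * theta3 (tau k) d ≠ 0 →
      abelH k a = quad xp xm y (abelZ k a) → abelH k b = quad xp xm y (abelZ k b) →
      abelH k c = quad xp xm y (abelZ k c) → abelH k d = quad xp xm y (abelZ k d) →
      quarticDD k xp xm y (abelZ k a) (abelZ k b) = 0 →
      quarticDD k xp xm y (abelZ k c) (abelZ k d) = 0 →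
      (ellK k / 2 - xm) * (ellK k / 2 + xm)
        * (abelZ k a + abelZ k b + abelZ k c + abelZ k d) = -4 * Complex.I * y * xm →
      theta1 (tau k) (a + b) ≠ 0 →
      (ellK k / 2 + xm) * (theta1 (tau k) a * theta1 (tau k) b * theta1 (tau k) c
        * theta1 (tau k) d) = (ellK k / 2 - xm)
        * (theta3 (tau k) a * theta3 (tau k) b * theta3 (tau k) c * theta3 (tau k) d) := by
    intro a b c d hs ha hb hc hd hHa hHb hHc hHd hab hcd hV h1
    -- The first form is used for (a, b) and the second for (c, d), where c + d = -(a + b). Weighted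
    -- by K/2 + x₋ and K/2 - x₋, their coefficients agree by the formula `hV` for the sum of the
    -- roots.
    obtain ⟨hs3, f1, -⟩ := P.addition_of_quarticDD ha hb hHa hHb hab
    obtain ⟨-, -, f2⟩ := P.addition_of_quarticDD hc hd hHc hHd hcd
    have hcd' : c + d = -(a + b) := by linear_combination hs
    rw [hcd', theta1_neg, theta3_neg] at f2
    have ht : (Real.pi : ℂ) * (theta2 (tau k) 0 * theta4 (tau k) 0) / 2 ≠ 0 :=
      div_ne_zero (mul_ne_zero (by exact_mod_cast Real.pi_ne_zero)
        (mul_ne_zero P.theta2_ne P.theta4_ne)) two_ne_zero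
    apply mul_left_cancel₀ (mul_ne_zero ht h1)
    apply mul_right_cancel₀ hs3
    generalize abelZ k a = Za at *
    generalize abelZ k b = Zb at *
    generalize abelZ k c = Zc at *
    generalize abelZ k d = Zd at *
    linear_combination (ellK k / 2 + xm) * theta1 (tau k) c * theta1 (tau k) d
        * theta3 (tau k) (a + b) * f1
      - (ellK k / 2 - xm) * theta3 (tau k) a * theta3 (tau k) b * theta3 (tau k) (a + b) * f2
      + Complex.I * theta3 (tau k) a * theta3 (tau k) b * theta3 (tau k) (a + b)
        * theta1 (tau k) c * theta1 (tau k) d * theta3 (tau k) (a + b) * hV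
      - 4 * y * xm * theta3 (tau k) a * theta3 (tau k) b * theta3 (tau k) (a + b)
        * theta1 (tau k) c * theta1 (tau k) d * theta3 (tau k) (a + b) * Complex.I_sq
  by_cases h1 : theta1 (tau k) (a + b) = 0
  swap
  · exact key a b c d hsum ha hb hc hd hHa hHb hHc hHd hab hcd hV h1
  by_cases h2 : theta1 (tau k) (a + c) = 0
  swap
  · have := key a c b d (by linear_combination hsum) ha hc hb hd hHa hHc hHb hHd hac hbd
      (by linear_combination hV) h2
    linear_combination this
  by_cases h3 : theta1 (tau k) (a + d) = 0
  swap
  · have := key a d b c (by linear_combination hsum) ha hd hb hc hHa hHd hHb hHc had hbc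
      (by linear_combination hV) h3
    linear_combination this
  -- θ₁(a + e) = 0 for all three other points would give ζ_e = -ζ_a each time. The addition theorem
  -- then forces y = 0, so the sum -2ζ_a of the roots vanishes, against `hZa`.
  exfalso
  have hz : ∀ e, theta1 (tau k) e * theta3 (tau k) e ≠ 0 → theta1 (tau k) (a + e) = 0 →
      abelZ k a + abelZ k e = 0 := by
    intro e he h
    have := P.abelZ_add ha he
    rw [h, zero_mul, zero_mul, mul_zero] at this
    exact (mul_eq_zero.mp this).resolve_right (mul_ne_zero ha he)
  have zb := hz b hb h1
  have zc := hz c hc h2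
  have zd := hz d hd h3
  obtain ⟨hs3, f1, -⟩ := P.addition_of_quarticDD ha hb hHa hHb hab
  rw [h1, zb, mul_zero, mul_zero, mul_zero, add_zero] at f1
  have hy := (mul_eq_zero.mp f1.symm).resolve_right
    (mul_ne_zero (mul_ne_zero (right_ne_zero_of_mul ha) (right_ne_zero_of_mul hb)) hs3)
  have hy0 : y = 0 := by linear_combination -hy / 2
  rw [hy0] at hV
  apply mul_ne_zero hX hZa
  linear_combination -hV / 2 + ((ellK k : ℂ) / 2 - xm) * (ellK k / 2 + xm) / 2 * (zb + zc + zd)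

end Params

/-! ### Roots of the Atiyah–Ward quartic and period shifts -/

lemma twistor_eval (x₁ x₂ x₃ : ℝ) (t : ℂ) :
    (twistor x₁ x₂ x₃).eval t = quad (xPlus x₁ x₂) (xMinus x₁ x₂) x₃ t := by
  simp only [twistor, quad, xPlus, xMinus, eval_sub, eval_mul, eval_C, eval_X, eval_pow]
  linear_combination (x₂ - x₂ * t ^ 2) * (Complex.I_sq)

lemma atiyahWard_eval (k x₁ x₂ x₃ : ℝ) (t : ℂ) :
    (atiyahWard k x₁ x₂ x₃).eval t =
      quad (xPlus x₁ x₂) (xMinus x₁ x₂) x₃ t ^ 2 + (ellK k : ℂ) ^ 2 / 4 *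
        (t ^ 4 + 2 * ((k : ℂ) ^ 2 - (compl k : ℂ) ^ 2) * t ^ 2 + 1) := by
  simp only [atiyahWard, eval_add, eval_pow, eval_mul, eval_C, eval_X, eval_one, twistor_eval]

lemma atiyahWard_eq (k x₁ x₂ x₃ : ℝ) : atiyahWard k x₁ x₂ x₃ =
    C (bigX k x₁ x₂ / 4) * X ^ 4 + C (4 * Complex.I * x₃ * xMinus x₁ x₂) * X ^ 3
      + C (4 * (x₃ : ℂ) ^ 2 - 2 * xPlus x₁ x₂ * xMinus x₁ x₂
        + (ellK k : ℂ) ^ 2 * ((k : ℂ) ^ 2 - (compl k : ℂ) ^ 2) / 2) * X ^ 2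
      + C (4 * Complex.I * x₃ * xPlus x₁ x₂) * X
      + C (((ellK k : ℂ) ^ 2 - 4 * xPlus x₁ x₂ ^ 2) / 4) := by
  refine Polynomial.funext fun t => ?_
  rw [atiyahWard_eval]
  simp only [eval_add, eval_pow, eval_mul, eval_C, eval_X, quad, bigX]
  linear_combination (xPlus x₁ x₂ + xMinus x₁ x₂ * t ^ 2) ^ 2 * Complex.I_sq

/-- Vieta's relations for the four roots of the Atiyah–Ward quartic. -/
structure IsQuadruple (k : ℝ) (xp xm y z₁ z₂ z₃ z₄ : ℂ) : Prop where
  ne : (ellK k : ℂ) ^ 2 - 4 * xm ^ 2 ≠ 0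
  esymm1 : 4 * Complex.I * y * xm =
    -(((ellK k : ℂ) ^ 2 - 4 * xm ^ 2) / 4 * (z₁ + z₂ + z₃ + z₄))
  esymm2 : 4 * y ^ 2 - 2 * xp * xm + (ellK k : ℂ) ^ 2 * ((k : ℂ) ^ 2 - (compl k : ℂ) ^ 2) / 2 =
    ((ellK k : ℂ) ^ 2 - 4 * xm ^ 2) / 4 *
      (z₁ * z₂ + z₁ * z₃ + z₁ * z₄ + z₂ * z₃ + z₂ * z₄ + z₃ * z₄)
  esymm3 : 4 * Complex.I * y * xp =
    -(((ellK k : ℂ) ^ 2 - 4 * xm ^ 2) / 4 *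
      (z₁ * z₂ * z₃ + z₁ * z₂ * z₄ + z₁ * z₃ * z₄ + z₂ * z₃ * z₄))
  esymm4 : ((ellK k : ℂ) ^ 2 - 4 * xp ^ 2) / 4 =
    ((ellK k : ℂ) ^ 2 - 4 * xm ^ 2) / 4 * (z₁ * z₂ * z₃ * z₄)

namespace IsQuadruple

variable {k : ℝ} {xp xm y z₁ z₂ z₃ z₄ : ℂ}

lemma rotate (h : IsQuadruple k xp xm y z₁ z₂ z₃ z₄) : IsQuadruple k xp xm y z₂ z₃ z₄ z₁ :=
  ⟨h.ne, by rw [h.esymm1]; ring, by rw [h.esymm2]; ring, by rw [h.esymm3]; ring,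
    by rw [h.esymm4]; ring⟩

/-- Vieta's relations express the divided difference through the roots, so it vanishes even when the
two roots coincide; this covers tangency. -/
lemma quarticDD12 (h : IsQuadruple k xp xm y z₁ z₂ z₃ z₄) : quarticDD k xp xm y z₁ z₂ = 0 := by
  rw [quarticDD, h.esymm1, h.esymm2, h.esymm3]
  ring

lemma quarticDD13 (h : IsQuadruple k xp xm y z₁ z₂ z₃ z₄) : quarticDD k xp xm y z₁ z₃ = 0 := by
  rw [quarticDD, h.esymm1, h.esymm2, h.esymm3]
  ring

lemma quarticDD14 (h : IsQuadruple k xp xm y z₁ z₂ z₃ z₄) : quarticDD k xp xm y z₁ z₄ = 0 := by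
  rw [quarticDD, h.esymm1, h.esymm2, h.esymm3]
  ring

end IsQuadruple

/-- A product over the four values of an injective labelling. -/
lemma prod_univ_of_injective {M : Type*} [CommMonoid M] {i j m l : Fin 4}
    (h : Function.Injective ![i, j, m, l]) (f : Fin 4 → M) :
    ∏ r, f r = f i * f j * f m * f l := by
  have hb : Function.Bijective ![i, j, m, l] := Finite.injective_iff_bijective.mp h
  rw [← Function.Bijective.prod_comp hb f, Fin.prod_univ_four]
  rfl

lemma sum_univ_of_injective {M : Type*} [AddCommMonoid M] {i j m l : Fin 4}
    (h : Function.Injective ![i, j, m, l]) (f : Fin 4 → M) :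
    ∑ r, f r = f i + f j + f m + f l := by
  have hb : Function.Bijective ![i, j, m, l] := Finite.injective_iff_bijective.mp h
  rw [← Function.Bijective.sum_comp hb f, Fin.sum_univ_four]
  rfl

lemma conj_xMinus (x₁ x₂ : ℝ) : (starRingEnd ℂ) (xMinus x₁ x₂) = xPlus x₁ x₂ := by
  simp [xMinus, xPlus]

/-- A root multiset with four elements forces degree four, hence leading coefficient X/4 ≠ 0. This
is how the hypothesis X ≠ 0 is encoded. -/
lemma isQuadruple_of_roots {k x₁ x₂ x₃ : ℝ} {ζ : Fin 4 → ℂ}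
    (hζ : (atiyahWard k x₁ x₂ x₃).roots = Multiset.map ζ Finset.univ.val)
    {i j m l : Fin 4} (h : Function.Injective ![i, j, m, l]) :
    IsQuadruple k (xPlus x₁ x₂) (xMinus x₁ x₂) x₃ (ζ i) (ζ j) (ζ m) (ζ l) := by
  set p := atiyahWard k x₁ x₂ x₃ with hp
  have hcard : Multiset.card p.roots = 4 := by rw [hζ]; simp
  have hdeg : p.natDegree ≤ 4 := by
    rw [hp, atiyahWard_eq]; compute_degree
  have hdeg' : p.natDegree = 4 := le_antisymm hdeg (hcard ▸ card_roots' p)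
  have hp0 : p ≠ 0 := by
    rintro h0
    rw [h0] at hcard
    simp at hcard
  have hlead : p.leadingCoeff = bigX k x₁ x₂ / 4 := by
    rw [leadingCoeff, hdeg', hp, atiyahWard_eq]
    simp only [coeff_add, coeff_C_mul, coeff_X_pow, coeff_X, coeff_C]
    norm_num
  have hne : bigX k x₁ x₂ ≠ 0 := by
    intro h0
    rw [h0, zero_div, leadingCoeff_eq_zero] at hlead
    exact hp0 hlead
  have hprod := C_leadingCoeff_mul_prod_multiset_X_sub_C (hcard.trans hdeg'.symm)
  rw [hζ, hlead, Multiset.map_map] at hprod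
  have hev : ∀ t : ℂ, bigX k x₁ x₂ / 4 * ((t - ζ i) * (t - ζ j) * (t - ζ m) * (t - ζ l)) =
      p.eval t := by
    intro t
    rw [← hprod]
    change _ = eval t (C (bigX k x₁ x₂ / 4) * ∏ r, (X - C (ζ r)))
    rw [prod_univ_of_injective h]
    simp
  rw [hp, atiyahWard_eq] at hev
  simp only [eval_add, eval_pow, eval_mul, eval_C, eval_X, bigX] at hev
  -- Five values, at 0, ±1 and ±2, determine the coefficients of the quartic.
  have f0 := hev 0
  have f1 := hev 1
  have f2 := hev (-1)
  have f3 := hev 2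
  have f4 := hev (-2)
  refine ⟨hne, ?_, ?_, ?_, ?_⟩
  · linear_combination ((f1 - f2) / 2 - (f3 - f4) / 4) / 3
  · linear_combination f0 - (f1 + f2) / 2
  · linear_combination ((f3 - f4) / 4 - 4 * (f1 - f2) / 2) / 3
  · linear_combination -f0

/-- Since K is real, the constant coefficient (K² - 4x₊²)/4 is the complex conjugate of the leading
one, so a root 0 would force X = 0. -/
lemma root_ne_zero {k x₁ x₂ : ℝ} {y z₁ z₂ z₃ z₄ : ℂ}
    (h : IsQuadruple k (xPlus x₁ x₂) (xMinus x₁ x₂) y z₁ z₂ z₃ z₄) : z₁ ≠ 0 := by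
  rintro rfl
  have h4 := h.esymm4
  apply h.ne
  have : (starRingEnd ℂ) ((ellK k : ℂ) ^ 2 - 4 * xPlus x₁ x₂ ^ 2) = 0 := by
    rw [show (ellK k : ℂ) ^ 2 - 4 * xPlus x₁ x₂ ^ 2 = 0 by linear_combination 4 * h4, map_zero]
  rw [← conj_xMinus] at this
  simpa [map_ofNat] using this

/-! ### Behaviour of the uniformisation and of β₁ under translation by τ. -/

namespace Params

variable {k : ℝ} (P : Params k)
include P

/-- The quasi-periodicity factors cancel in ζ and η, while the logarithmic derivatives of θ₁ and θ₃
each drop by 2πi. This permits shifting αᵢ so that the four Abel images sum to zero. -/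
lemma add_tau (a : ℂ) :
    (theta1 (tau k) (a + tau k) * theta3 (tau k) (a + tau k) ≠ 0 ↔
      theta1 (tau k) a * theta3 (tau k) a ≠ 0) ∧
    abelZ k (a + tau k) = abelZ k a ∧ abelH k (a + tau k) = abelH k a ∧
    (theta1 (tau k) a * theta3 (tau k) a ≠ 0 →
      beta1 k (a + tau k) = beta1 k a - Complex.I * Real.pi) := by
  have he := Complex.exp_ne_zero (-Real.pi * Complex.I * (tau k + 2 * a))
  have h1 := theta1_add_tau (tau k) a
  have h2 := theta2_add_tau (tau k) a
  have h3 := theta3_add_tau (tau k) a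
  have h4 := theta4_add_tau (tau k) a
  refine ⟨?_, ?_, ?_, ?_⟩
  · rw [h1, h3]
    simp [he]
  · rw [abelZ, abelZ, h1, h2, h3, h4]
    generalize Complex.exp (-Real.pi * Complex.I * (tau k + 2 * a)) = e at *
    rw [show -e * theta1 (tau k) a * (e * theta3 (tau k) a)
        = -e ^ 2 * (theta1 (tau k) a * theta3 (tau k) a) by ring,
      show -Complex.I * (e * theta2 (tau k) a * (-e * theta4 (tau k) a))
        = -e ^ 2 * (-Complex.I * (theta2 (tau k) a * theta4 (tau k) a)) by ring,
      mul_div_mul_left _ _ (neg_ne_zero.mpr (pow_ne_zero 2 he))]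
  · rw [abelH, abelH, h1, h3]
    generalize Complex.exp (-Real.pi * Complex.I * (tau k + 2 * a)) = e at *
    rw [show (-e * theta1 (tau k) a * (e * theta3 (tau k) a)) ^ 2
        = e ^ 4 * (theta1 (tau k) a * theta3 (tau k) a) ^ 2 by ring,
      show Complex.I * ellK k / 2 * (k * compl k) *
        ((-e * theta1 (tau k) a) ^ 4 + (e * theta3 (tau k) a) ^ 4)
        = e ^ 4 * (Complex.I * ellK k / 2 * (k * compl k) *
          (theta1 (tau k) a ^ 4 + theta3 (tau k) a ^ 4)) by ring,
      mul_div_mul_left _ _ (pow_ne_zero 4 he)]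
  · intro ha
    have key : ∀ (f : ℂ → ℂ) (s : ℂ), s ≠ 0 → Differentiable ℂ f → f a ≠ 0 →
        (∀ z, f (z + tau k) = s * Complex.exp (-Real.pi * Complex.I * (tau k + 2 * z)) * f z) →
        logDeriv f (a + tau k) = logDeriv f a - 2 * Real.pi * Complex.I := by
      intro f s hs hf hfa hsh
      have hd1 : HasDerivAt (fun z => f (z + tau k)) (deriv f (a + tau k)) a := by
        simpa using ((hf (a + tau k)).hasDerivAt.comp_add_const a (tau k))
      have hE : HasDerivAt (fun z : ℂ => s * Complex.exp (-Real.pi * Complex.I * (tau k + 2 * z)))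
          (s * (Complex.exp (-Real.pi * Complex.I * (tau k + 2 * a)) *
            (-Real.pi * Complex.I * (2 * 1)))) a :=
        ((((hasDerivAt_id a).const_mul 2).const_add (tau k)).const_mul
          (-Real.pi * Complex.I)).cexp.const_mul s
      have hd2 := hE.mul (hf a).hasDerivAt
      have heq := hd1.unique (hd2.congr_of_eventuallyEq (Eventually.of_forall hsh))
      rw [logDeriv_apply, logDeriv_apply, heq, hsh]
      generalize Complex.exp (-Real.pi * Complex.I * (tau k + 2 * a)) = e at *
      field_simp
      ring
    rw [beta1, beta1,
      key (theta1 (tau k)) (-1) (by norm_num) (differentiable_theta1 P.im_pos)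
        (left_ne_zero_of_mul ha) (fun z => by rw [theta1_add_tau]; ring),
      key (theta3 (tau k)) 1 one_ne_zero (differentiable_theta3 P.im_pos)
        (right_ne_zero_of_mul ha) (fun z => by rw [theta3_add_tau]; ring)]
    ring

lemma add_int_mul_tau (n : ℤ) {a : ℂ} (ha : theta1 (tau k) a * theta3 (tau k) a ≠ 0) :
    theta1 (tau k) (a + n * tau k) * theta3 (tau k) (a + n * tau k) ≠ 0 ∧
    abelZ k (a + n * tau k) = abelZ k a ∧ abelH k (a + n * tau k) = abelH k a ∧
    beta1 k (a + n * tau k) = beta1 k a - Complex.I * Real.pi * n := by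
  induction n using Int.induction_on with
  | zero => simpa using ha
  | succ n ih =>
    obtain ⟨i1, i2, i3, i4⟩ := ih
    obtain ⟨s1, s2, s3, s4⟩ := P.add_tau (a + (n : ℤ) * tau k)
    have hh : a + ((n + 1 : ℤ) : ℂ) * tau k = a + ((n : ℤ) : ℂ) * tau k + tau k := by
      push_cast; ring
    rw [hh]
    refine ⟨s1.mpr i1, s2.trans i2, s3.trans i3, ?_⟩
    rw [s4 i1, i4]; push_cast; ring
  | pred n ih =>
    obtain ⟨i1, i2, i3, i4⟩ := ih
    obtain ⟨s1, s2, s3, s4⟩ := P.add_tau (a + (-n - 1 : ℤ) * tau k)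
    have hh : a + ((-n - 1 : ℤ) : ℂ) * tau k + tau k = a + ((-n : ℤ) : ℂ) * tau k := by
      push_cast; ring
    rw [hh] at s1 s2 s3 s4
    refine ⟨s1.mp i1, s2.symm.trans i2, s3.symm.trans i3, ?_⟩
    have := s4 (s1.mp i1)
    rw [i4] at this
    push_cast at this ⊢
    linear_combination -this

end Params

/-! ### Second order expansions at the origin -/

/-- `f(w) = c₀ + c₁ w + c₂ w² + O(w³)` as `w → 0`, `w ≠ 0`. -/
def Expands (f : ℂ → ℂ) (c₀ c₁ c₂ : ℂ) : Prop :=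
  (fun w => f w - (c₀ + c₁ * w + c₂ * w ^ 2)) =O[𝓝[≠] (0 : ℂ)] fun w => w ^ 3

namespace Expands

variable {f g : ℂ → ℂ} {a₀ a₁ a₂ b₀ b₁ b₂ : ℂ}

lemma congr (hf : Expands f a₀ a₁ a₂) (h : f =ᶠ[𝓝[≠] 0] g) : Expands g a₀ a₁ a₂ :=
  Asymptotics.IsBigO.congr' hf (h.mono fun w hw => by simp only [hw]) EventuallyEq.rfl

lemma cast (hf : Expands f a₀ a₁ a₂) (h₀ : a₀ = b₀) (h₁ : a₁ = b₁) (h₂ : a₂ = b₂) :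
    Expands f b₀ b₁ b₂ := by
  rwa [← h₀, ← h₁, ← h₂]

lemma pow_isBigO {n : ℕ} (hn : 3 ≤ n) :
    (fun w : ℂ => w ^ n) =O[𝓝[≠] (0 : ℂ)] fun w => w ^ 3 := by
  obtain ⟨m, rfl⟩ := Nat.exists_eq_add_of_le hn
  have h : (fun w : ℂ => w ^ m) =O[𝓝[≠] (0 : ℂ)] fun _ => (1 : ℂ) :=
    (((continuous_pow m).tendsto (0 : ℂ)).mono_left nhdsWithin_le_nhds).isBigO_one ℂ
  simpa [pow_add] using (Asymptotics.isBigO_refl (fun w : ℂ => w ^ 3) (𝓝[≠] 0)).mul h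

lemma poly_isBigO_one (c₀ c₁ c₂ : ℂ) :
    (fun w : ℂ => c₀ + c₁ * w + c₂ * w ^ 2) =O[𝓝[≠] (0 : ℂ)] fun _ => (1 : ℂ) := by
  have hc : Continuous fun w : ℂ => c₀ + c₁ * w + c₂ * w ^ 2 := by fun_prop
  exact ((hc.tendsto 0).mono_left nhdsWithin_le_nhds).isBigO_one ℂ

lemma isBigO_one (hf : Expands f a₀ a₁ a₂) : f =O[𝓝[≠] (0 : ℂ)] fun _ => (1 : ℂ) := by
  have h := (Asymptotics.IsBigO.trans hf (by
    simpa using (((continuous_pow 3).tendsto (0 : ℂ)).mono_left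
      nhdsWithin_le_nhds).isBigO_one ℂ)).add (poly_isBigO_one a₀ a₁ a₂)
  simpa using h

lemma add (hf : Expands f a₀ a₁ a₂) (hg : Expands g b₀ b₁ b₂) :
    Expands (fun w => f w + g w) (a₀ + b₀) (a₁ + b₁) (a₂ + b₂) :=
  (Asymptotics.IsBigO.add hf hg).congr_left fun w => by ring

lemma sub (hf : Expands f a₀ a₁ a₂) (hg : Expands g b₀ b₁ b₂) :
    Expands (fun w => f w - g w) (a₀ - b₀) (a₁ - b₁) (a₂ - b₂) :=
  (Asymptotics.IsBigO.sub hf hg).congr_left fun w => by ring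

lemma const_mul (c : ℂ) (hf : Expands f a₀ a₁ a₂) :
    Expands (fun w => c * f w) (c * a₀) (c * a₁) (c * a₂) :=
  (Asymptotics.IsBigO.const_mul_left hf c).congr_left fun w => by ring

lemma mul (hf : Expands f a₀ a₁ a₂) (hg : Expands g b₀ b₁ b₂) :
    Expands (fun w => f w * g w) (a₀ * b₀) (a₀ * b₁ + a₁ * b₀) (a₀ * b₂ + a₁ * b₁ + a₂ * b₀) := by
  have h1 := Asymptotics.IsBigO.mul hf hg.isBigO_one
  have h2 := (poly_isBigO_one a₀ a₁ a₂).mul hg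
  have h3 := (pow_isBigO le_rfl).const_mul_left (a₁ * b₂ + a₂ * b₁)
  have h4 := (pow_isBigO (n := 4) (by norm_num)).const_mul_left (a₂ * b₂)
  simp only [mul_one, one_mul] at h1 h2
  exact (((h1.add h2).add h3).add h4).congr_left fun w => by ring

lemma id : Expands (fun w => w) 0 1 0 :=
  (Asymptotics.isBigO_zero _ _).congr_left fun w => by ring

lemma const (c : ℂ) : Expands (fun _ => c) c 0 0 :=
  (Asymptotics.isBigO_zero _ _).congr_left fun w => by ring

lemma id_mul (hf : Expands f a₀ a₁ a₂) : Expands (fun w => w * f w) 0 a₀ a₁ :=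
  (id.mul hf).cast (by ring) (by ring) (by ring)

lemma tendsto (hf : Expands f a₀ a₁ a₂) : Tendsto f (𝓝[≠] 0) (𝓝 a₀) := by
  have h3 : Tendsto (fun w : ℂ => w ^ 3) (𝓝[≠] 0) (𝓝 0) := by
    simpa using ((continuous_pow 3).tendsto (0 : ℂ)).mono_left nhdsWithin_le_nhds
  have h := Asymptotics.IsBigO.trans_tendsto hf h3
  have hc : Continuous fun w : ℂ => a₀ + a₁ * w + a₂ * w ^ 2 := by fun_prop
  have h' := h.add ((hc.tendsto 0).mono_left nhdsWithin_le_nhds)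
  simpa using h'

lemma eq_zero (h : Expands (fun _ => 0) a₀ a₁ a₂) : a₀ = 0 ∧ a₁ = 0 ∧ a₂ = 0 := by
  have h0 : a₀ = 0 := tendsto_nhds_unique h.tendsto tendsto_const_nhds
  subst h0
  have shift : ∀ {u v : ℂ}, Expands (fun _ => 0) 0 u v →
      (fun w : ℂ => u + v * w) =O[𝓝[≠] (0 : ℂ)] fun w => w ^ 2 := by
    intro u v h
    have := (Asymptotics.isBigO_refl (fun w : ℂ => w⁻¹) (𝓝[≠] 0)).mul h
    refine (this.congr' ?_ ?_).neg_left.congr_left fun w => neg_neg _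
    · filter_upwards [self_mem_nhdsWithin] with w hw
      have hw : w ≠ 0 := hw
      field_simp
      ring
    · filter_upwards [self_mem_nhdsWithin] with w hw
      have hw : w ≠ 0 := hw
      field_simp
  have h1 := shift h
  have t2 : Tendsto (fun w : ℂ => w ^ 2) (𝓝[≠] 0) (𝓝 0) := by
    simpa using ((continuous_pow 2).tendsto (0 : ℂ)).mono_left nhdsWithin_le_nhds
  have hu : a₁ = 0 := by
    have hc : Continuous fun w : ℂ => a₁ + a₂ * w := by fun_prop
    have := (hc.tendsto 0).mono_left (nhdsWithin_le_nhds (s := {0}ᶜ))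
    rw [mul_zero, add_zero] at this
    exact tendsto_nhds_unique this (h1.trans_tendsto t2)
  subst hu
  refine ⟨rfl, rfl, ?_⟩
  have h2 := (Asymptotics.isBigO_refl (fun w : ℂ => w⁻¹) (𝓝[≠] 0)).mul h1
  have h3 : (fun _ : ℂ => a₂) =O[𝓝[≠] (0 : ℂ)] fun w => w := by
    refine h2.congr' ?_ ?_
    · filter_upwards [self_mem_nhdsWithin] with w hw
      have hw : w ≠ 0 := hw
      field_simp
      ring
    · filter_upwards [self_mem_nhdsWithin] with w hw
      have hw : w ≠ 0 := hw
      field_simp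
  exact tendsto_nhds_unique tendsto_const_nhds
    (h3.trans_tendsto (tendsto_id.mono_left nhdsWithin_le_nhds))

/-- Expanding both sides of a differential equation and comparing coefficients through this lemma
determines the germs below. -/
lemma unique (hf : Expands f a₀ a₁ a₂) (hg : Expands g b₀ b₁ b₂) (h : f =ᶠ[𝓝[≠] 0] g) :
    a₀ = b₀ ∧ a₁ = b₁ ∧ a₂ = b₂ := by
  have := ((hf.congr h).sub hg).congr (Eventually.of_forall fun w => sub_self (g w))
  obtain ⟨h0, h1, h2⟩ := this.eq_zero
  exact ⟨sub_eq_zero.mp h0, sub_eq_zero.mp h1, sub_eq_zero.mp h2⟩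

lemma of_analyticAt (hf : AnalyticAt ℂ f 0) :
    Expands f (f 0) (deriv f 0) (deriv (deriv f) 0 / 2) := by
  have h := hf.hasFPowerSeriesAt.isBigO_sub_partialSum_pow 3
  have h' := (h.mono (nhdsWithin_le_nhds (s := {0}ᶜ)))
  refine (h'.trans ?_).congr_left ?_
  · exact Asymptotics.IsBigO.of_norm_right (by simpa using Asymptotics.isBigO_refl _ _)
  · intro w
    simp only [FormalMultilinearSeries.partialSum, Finset.sum_range_succ, Finset.sum_range_zero,
      FormalMultilinearSeries.ofScalars_apply_eq, iteratedDeriv_succ, iteratedDeriv_zero,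
      Nat.factorial]
    simp

/-- The expansion along the real axis with `w = ξ/2`. -/
lemma isBigO_rpow (hf : Expands f a₀ a₁ a₂) :
    (fun ξ : ℝ => (ξ ^ (-(3 / 2) : ℝ) : ℝ) * f (ξ / 2) - ((ξ ^ (-(3 / 2) : ℝ) : ℝ) * a₀
      + (ξ ^ (-(1 / 2) : ℝ) : ℝ) * (a₁ / 2) + (ξ ^ (1 / 2 : ℝ) : ℝ) * (a₂ / 4)))
        =O[𝓝[>] (0 : ℝ)] fun ξ : ℝ => ξ ^ (3 / 2 : ℝ) := by
  have ht : Tendsto (fun ξ : ℝ => (ξ / 2 : ℂ)) (𝓝[>] 0) (𝓝[≠] 0) := by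
    refine tendsto_nhdsWithin_iff.mpr ⟨?_, ?_⟩
    · have hc : Continuous fun ξ : ℝ => (ξ / 2 : ℂ) := by fun_prop
      simpa using (hc.tendsto 0).mono_left (nhdsWithin_le_nhds (s := Set.Ioi 0))
    · filter_upwards [self_mem_nhdsWithin] with ξ hξ
      have hξ : (0 : ℝ) < ξ := hξ
      simp [hξ.ne']
  have h := (Asymptotics.IsBigO.comp_tendsto hf ht)
  have h2 := (Asymptotics.isBigO_refl (fun ξ : ℝ => ((ξ ^ (-(3 / 2) : ℝ) : ℝ) : ℂ)) (𝓝[>] 0)).mul h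
  refine (h2.congr' ?_ EventuallyEq.rfl).trans ?_
  · filter_upwards [self_mem_nhdsWithin] with ξ hξ
    have hξ : (0 : ℝ) < ξ := hξ
    have e1 : ξ ^ (-(1 / 2) : ℝ) = ξ ^ (-(3 / 2) : ℝ) * ξ := by
      rw [← Real.rpow_add_one hξ.ne']; norm_num
    have e2 : ξ ^ (1 / 2 : ℝ) = ξ ^ (-(3 / 2) : ℝ) * ξ * ξ := by
      rw [← Real.rpow_add_one hξ.ne', ← Real.rpow_add_one hξ.ne']; norm_num
    rw [e1, e2]
    push_cast
    simp only [Function.comp]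
    ring
  · refine Asymptotics.IsBigO.of_bound 1 ?_
    filter_upwards [self_mem_nhdsWithin] with ξ hξ
    have hξ : (0 : ℝ) < ξ := hξ
    have e3 : ξ ^ (3 / 2 : ℝ) = ξ ^ (-(3 / 2) : ℝ) * ξ ^ 3 := by
      rw [← Real.rpow_natCast ξ 3, ← Real.rpow_add hξ]; norm_num
    have hp : 0 < ξ ^ (-(3 / 2) : ℝ) := Real.rpow_pos_of_pos hξ _
    rw [e3]
    simp only [Function.comp, norm_mul, norm_pow, norm_div, Complex.norm_real, Real.norm_eq_abs,
      abs_of_pos hξ, abs_of_pos hp, one_mul]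
    gcongr
    norm_num
    linarith

end Expands

/-! ### Germs of the gauge functions -/

lemma analyticAt_dslope_zero {f : ℂ → ℂ} (hf : Differentiable ℂ f) (z : ℂ) :
    AnalyticAt ℂ (dslope f 0) z := by
  have h : DifferentiableOn ℂ (dslope f 0) Set.univ :=
    (Complex.differentiableOn_dslope univ_mem).mpr hf.differentiableOn
  exact h.analyticAt univ_mem

lemma id_mul_dslope {f : ℂ → ℂ} (hf : f 0 = 0) (w : ℂ) : w * dslope f 0 w = f w := by
  have := sub_smul_dslope f 0 w
  rwa [sub_zero, hf, sub_zero, smul_eq_mul] at this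

lemma deriv_dslope_zero {f : ℂ → ℂ} (hf : Differentiable ℂ f) (h0 : f 0 = 0) :
    deriv (dslope f 0) 0 = deriv (deriv f) 0 / 2 := by
  have ha := analyticAt_dslope_zero hf 0
  have h1 := (Expands.of_analyticAt ha).id_mul
  have h2 := Expands.of_analyticAt (hf.analyticAt 0)
  exact (h1.unique h2 (Eventually.of_forall (id_mul_dslope h0))).2.2

/-- If an analytic germ agrees with `f` off the origin, so do the derivatives. -/
lemma eventually_deriv_eq {f g : ℂ → ℂ} (h : f =ᶠ[𝓝[≠] 0] g) :
    ∀ᶠ w in 𝓝[≠] (0 : ℂ), f w = g w ∧ deriv f w = deriv g w := by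
  have h' := eventually_eventually_nhdsWithin.mpr h
  filter_upwards [h, h', self_mem_nhdsWithin] with w hw hw' hne
  refine ⟨hw, EventuallyEq.deriv_eq ?_⟩
  rw [IsOpen.nhdsWithin_eq isOpen_compl_singleton hne] at hw'
  exact hw'

/-- The function `ρ = π θ₂ θ₄ θ₃(w)/θ₁(w)`. -/
def rho (k : ℝ) (w : ℂ) : ℂ :=
  Real.pi * (theta2 (tau k) 0 * theta4 (tau k) 0) * (theta3 (tau k) w / theta1 (tau k) w)

/-- The analytic germ of `θ₁(w)/w`. -/
def sigma (k : ℝ) : ℂ → ℂ := dslope (theta1 (tau k)) 0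

/-- The analytic germ of `w ρ(w)`. -/
def rhoGerm (k : ℝ) (w : ℂ) : ℂ :=
  Real.pi * (theta2 (tau k) 0 * theta4 (tau k) 0) * (theta3 (tau k) w / sigma k w)

/-- The analytic germ of `w θ₂θ₄/(θ₁θ₃)(w/2)`. -/
def gaugeGerm (k : ℝ) (w : ℂ) : ℂ :=
  2 * (theta2 (tau k) (w / 2) * theta4 (tau k) (w / 2)) /
    (sigma k (w / 2) * theta3 (tau k) (w / 2))

/-- The analytic square root of `K w θ₂θ₄/(θ₁θ₃)(w/2)` with value `1` at `0`. -/
def gaugeRoot (k : ℝ) (w : ℂ) : ℂ := (ellK k * gaugeGerm k w) ^ (1 / 2 : ℂ)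

lemma id_mul_sigma (k : ℝ) (w : ℂ) : w * sigma k w = theta1 (tau k) w :=
  id_mul_dslope (theta1_zero (tau k)) w

namespace Params

variable {k : ℝ} (P : Params k)
include P

lemma pi_mul_ne : (Real.pi : ℂ) * (theta2 (tau k) 0 * theta4 (tau k) 0) ≠ 0 :=
  mul_ne_zero (by exact_mod_cast Real.pi_ne_zero) (mul_ne_zero P.theta2_ne P.theta4_ne)

lemma deriv_theta1_eq : deriv (theta1 (tau k)) 0 =
    Real.pi * (theta2 (tau k) 0 * theta4 (tau k) 0) * theta3 (tau k) 0 := by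
  rw [P.deriv_theta1]; ring

lemma deriv_theta1_ne : deriv (theta1 (tau k)) 0 ≠ 0 := by
  rw [P.deriv_theta1_eq]
  exact mul_ne_zero P.pi_mul_ne P.theta3_ne

lemma analyticAt_sigma (z : ℂ) : AnalyticAt ℂ (sigma k) z :=
  analyticAt_dslope_zero (differentiable_theta1 P.im_pos) z

omit P in
lemma sigma_zero : sigma k 0 = deriv (theta1 (tau k)) 0 := dslope_same _ _

lemma sigma_zero_ne : sigma k 0 ≠ 0 := by
  rw [sigma_zero]; exact P.deriv_theta1_ne

lemma eventually_theta1_ne : ∀ᶠ w in 𝓝[≠] (0 : ℂ), theta1 (tau k) w ≠ 0 := by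
  have h := (P.analyticAt_sigma 0).continuousAt.eventually_ne P.sigma_zero_ne
  filter_upwards [h.filter_mono nhdsWithin_le_nhds, self_mem_nhdsWithin] with w hw hne
  rw [← id_mul_sigma]
  exact mul_ne_zero hne hw

lemma analyticAt_rhoGerm : AnalyticAt ℂ (rhoGerm k) 0 :=
  analyticAt_const.mul (((differentiable_theta3 P.im_pos).analyticAt 0).div
    (P.analyticAt_sigma 0) P.sigma_zero_ne)

lemma rhoGerm_zero : rhoGerm k 0 = 1 := by
  rw [rhoGerm, sigma_zero, P.deriv_theta1_eq]
  have h1 := P.pi_mul_ne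
  have h2 := P.theta3_ne
  generalize (Real.pi : ℂ) * (theta2 (tau k) 0 * theta4 (tau k) 0) = A at *
  field_simp

omit P in
lemma rhoGerm_eq {w : ℂ} (hw : w ≠ 0) : rhoGerm k w = w * rho k w := by
  rw [rhoGerm, rho, ← id_mul_sigma k w]
  field_simp

lemma hasDerivAt_rho {w : ℂ} (hw : theta1 (tau k) w ≠ 0) :
    HasDerivAt (rho k) (-(Real.pi * deriv (theta1 (tau k)) 0 * theta3 (tau k) 0
      * (theta2 (tau k) w * theta4 (tau k) w)) / theta1 (tau k) w ^ 2) w := by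
  have h := ((hasDerivAt_theta3 P.im_pos w).div (hasDerivAt_theta1 P.im_pos w) hw).const_mul
    ((Real.pi : ℂ) * (theta2 (tau k) 0 * theta4 (tau k) 0))
  refine h.congr_deriv ?_
  have e := wronskian_theta13 P.im_pos w
  rw [← mul_div_assoc]
  congr 1
  linear_combination -(Real.pi : ℂ) * e

/-- The differential equation `ρ'² = ρ⁴ + 4K²(k² - k'²)ρ² - const`. -/
lemma deriv_rho_sq {w : ℂ} (hw : theta1 (tau k) w ≠ 0) :
    deriv (rho k) w ^ 2 = rho k w ^ 4
      + 4 * (ellK k : ℂ) ^ 2 * ((k : ℂ) ^ 2 - (compl k : ℂ) ^ 2) * rho k w ^ 2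
      - k * compl k * (Real.pi * deriv (theta1 (tau k)) 0 * theta3 (tau k) 0) ^ 2 := by
  rw [(P.hasDerivAt_rho hw).deriv, rho, P.deriv_theta1_eq]
  have e := P.theta24_sq w
  have hK := P.ellK_eq
  have hcc : (k : ℂ) * compl k * theta3 (tau k) 0 ^ 4
      = (theta2 (tau k) 0 * theta4 (tau k) 0) ^ 2 := by
    rw [mul_pow, ← P.mul_k, ← P.mul_compl]; ring
  generalize theta2 (tau k) w * theta4 (tau k) w = s at *
  generalize theta2 (tau k) 0 * theta4 (tau k) 0 = t at *
  generalize theta3 (tau k) 0 = u at *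
  generalize theta1 (tau k) w = a at *
  generalize theta3 (tau k) w = b at *
  generalize (k : ℂ) = κ at *
  generalize (compl k : ℂ) = κ' at *
  rw [hK]
  field_simp
  linear_combination 4 * t ^ 2 * (u ^ 4 * e + b ^ 4 * hcc)

/-- The equation of `deriv_rho_sq` multiplied by w⁴, which clears the pole of ρ. Powers are written
as nested products so that the two sides match `Expands.mul` and `Expands.id_mul`. -/
lemma rhoGerm_ode : ∀ᶠ w in 𝓝[≠] (0 : ℂ),
    (w * deriv (rhoGerm k) w - rhoGerm k w) * (w * deriv (rhoGerm k) w - rhoGerm k w) =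
      (rhoGerm k w * rhoGerm k w) * (rhoGerm k w * rhoGerm k w)
      + w * (w * (4 * (ellK k : ℂ) ^ 2 * ((k : ℂ) ^ 2 - (compl k : ℂ) ^ 2)
        * (rhoGerm k w * rhoGerm k w)))
      - w * (w * (w * (k * compl k * (Real.pi * deriv (theta1 (tau k)) 0 * theta3 (tau k) 0) ^ 2
        * w))) := by
  have h : rhoGerm k =ᶠ[𝓝[≠] 0] fun w => w * rho k w := by
    filter_upwards [self_mem_nhdsWithin] with w hw using rhoGerm_eq hw
  filter_upwards [eventually_deriv_eq h, P.eventually_theta1_ne] with w hw h1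
  have hd := ((hasDerivAt_id w).fun_mul (P.hasDerivAt_rho h1).differentiableAt.hasDerivAt).deriv
  have hd' : deriv (fun w => w * rho k w) w = rho k w + w * deriv (rho k) w := by
    simpa using hd
  rw [hw.2, hw.1, hd']
  have e := P.deriv_rho_sq h1
  linear_combination w ^ 4 * e

/-- `wρ(w) = 1 - (2/3)K²(k² - k'²)w² + O(w³)`. -/
lemma expands_rhoGerm : Expands (rhoGerm k) 1 0
    (-(2 / 3) * (ellK k : ℂ) ^ 2 * ((k : ℂ) ^ 2 - (compl k : ℂ) ^ 2)) := by
  have ha := P.analyticAt_rhoGerm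
  have hR := Expands.of_analyticAt ha
  have hN := (Expands.of_analyticAt ha.deriv).id_mul.sub hR
  have hL := hN.mul hN
  have h2 := hR.mul hR
  have hRHS := ((h2.mul h2).add (h2.const_mul
    (4 * (ellK k : ℂ) ^ 2 * ((k : ℂ) ^ 2 - (compl k : ℂ) ^ 2))).id_mul.id_mul).sub
    ((Expands.id.const_mul (k * compl k
      * (Real.pi * deriv (theta1 (tau k)) 0 * theta3 (tau k) 0) ^ 2)).id_mul.id_mul.id_mul)
  -- With germ r₀ + r₁w + r₂w² and r₀ = 1, order one gives 0 = 4r₁, and order two gives -2r₂ = 4r₂ +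
  -- 4K²(k² - k'²).
  obtain ⟨-, e1, e2⟩ := hL.unique hRHS P.rhoGerm_ode
  rw [P.rhoGerm_zero] at hR e1 e2
  have r1 : deriv (rhoGerm k) 0 = 0 := by linear_combination -e1 / 4
  rw [r1] at hR e2
  exact hR.cast rfl rfl (by linear_combination -e2 / 6)

lemma analyticAt_gaugeGerm : AnalyticAt ℂ (gaugeGerm k) 0 := by
  have hh : AnalyticAt ℂ (fun w : ℂ => w / 2) 0 := analyticAt_id.div_const
  have key : ∀ f : ℂ → ℂ, AnalyticAt ℂ f 0 → AnalyticAt ℂ (fun w => f (w / 2)) 0 := by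
    intro f hf
    exact AnalyticAt.fun_comp (by simpa using hf) hh
  refine (analyticAt_const.mul ((key _ ((differentiable_theta2 P.im_pos).analyticAt 0)).mul
    (key _ ((differentiable_theta4 P.im_pos).analyticAt 0)))).div
    ((key _ (P.analyticAt_sigma 0)).mul (key _ ((differentiable_theta3 P.im_pos).analyticAt 0))) ?_
  simpa using ⟨P.sigma_zero_ne, P.theta3_ne⟩

lemma ellK_mul_gaugeGerm_zero : ellK k * gaugeGerm k 0 = 1 := by
  rw [gaugeGerm, zero_div, sigma_zero, P.deriv_theta1_eq, P.ellK_eq]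
  have h1 := mul_ne_zero P.theta2_ne P.theta4_ne
  have h2 := P.theta3_ne
  have h3 : (Real.pi : ℂ) ≠ 0 := by exact_mod_cast Real.pi_ne_zero
  generalize theta2 (tau k) 0 * theta4 (tau k) 0 = A at *
  field_simp

omit P in
lemma gaugeGerm_eq {w : ℂ} (hw : w ≠ 0) :
    gaugeGerm k w = w * (Complex.I * abelZ k (w / 2)) := by
  rw [gaugeGerm, abelZ, ← id_mul_sigma k (w / 2)]
  field_simp
  linear_combination (theta2 (tau k) (w / 2) * theta4 (tau k) (w / 2) * (sigma k (w / 2))⁻¹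
    * (theta3 (tau k) (w / 2))⁻¹) * Complex.I_sq

/-- Duplication formula for `ρ`. -/
lemma abelH_half {w : ℂ} (hw : theta1 (tau k) w ≠ 0)
    (hh : theta1 (tau k) (w / 2) * theta3 (tau k) (w / 2) ≠ 0) :
    2 * abelH k (w / 2) = -rho k w * abelZ k (w / 2) := by
  have e3 := theta3_add_theta3_sub P.im_pos (w / 2) (w / 2)
  have e1 := theta1_add_theta3_sub P.im_pos (w / 2) (w / 2)
  rw [add_halves, sub_self] at e1 e3
  have hc := P.ellK_mul_kk
  have t3 := P.theta3_ne
  have t24 := mul_ne_zero P.theta2_ne P.theta4_ne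
  rw [rho, abelH, abelZ]
  generalize theta2 (tau k) (w / 2) * theta4 (tau k) (w / 2) = s at *
  generalize theta2 (tau k) 0 * theta4 (tau k) 0 = t at *
  rw [show theta1 (tau k) (w / 2) ^ 4 + theta3 (tau k) (w / 2) ^ 4
    = theta3 (tau k) w * theta3 (tau k) 0 ^ 3 by linear_combination -e3]
  generalize theta1 (tau k) (w / 2) * theta3 (tau k) (w / 2) = q at *
  generalize theta3 (tau k) 0 = u at *
  generalize theta1 (tau k) w = a at *
  generalize theta3 (tau k) w = b at *
  field_simp
  linear_combination b * (a * u * hc + Real.pi * t / 2 * e1)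

/-- The germ is w·iζ(w/2). From dζ = 4η da and the duplication formula `abelH_half`, the logarithmic
derivative of ζ(w/2) in w is -ρ(w). -/
lemma gaugeGerm_ode : ∀ᶠ w in 𝓝[≠] (0 : ℂ),
    w * deriv (gaugeGerm k) w = gaugeGerm k w - rhoGerm k w * gaugeGerm k w := by
  have h : gaugeGerm k =ᶠ[𝓝[≠] 0] fun w => w * (Complex.I * abelZ k (w / 2)) := by
    filter_upwards [self_mem_nhdsWithin] with w hw using gaugeGerm_eq hw
  have ht : Tendsto (fun w : ℂ => w / 2) (𝓝[≠] 0) (𝓝[≠] 0) := by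
    refine tendsto_nhdsWithin_iff.mpr ⟨?_, ?_⟩
    · have hc : Continuous fun w : ℂ => w / 2 := by fun_prop
      simpa using (hc.tendsto 0).mono_left (nhdsWithin_le_nhds (s := {0}ᶜ))
    · filter_upwards [self_mem_nhdsWithin] with w hw
      have hw : w ≠ 0 := hw
      simpa using hw
  have h3 : ∀ᶠ w in 𝓝[≠] (0 : ℂ), theta3 (tau k) w ≠ 0 :=
    (P.continuous_theta3.continuousAt.eventually_ne P.theta3_ne).filter_mono nhdsWithin_le_nhds
  filter_upwards [eventually_deriv_eq h, P.eventually_theta1_ne, ht.eventually h3,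
    ht.eventually P.eventually_theta1_ne, self_mem_nhdsWithin] with w hw h1 h3 h1' hne
  have hh := mul_ne_zero h1' h3
  have hz := (P.hasDerivAt_abelZ hh).comp w ((hasDerivAt_id w).div_const 2)
  have hd := ((hasDerivAt_id w).fun_mul (hz.const_mul Complex.I)).deriv
  have hd' : deriv (fun w => w * (Complex.I * abelZ k (w / 2))) w =
      Complex.I * abelZ k (w / 2) + w * (Complex.I * (4 * abelH k (w / 2) * (1 / 2))) := by
    simpa [Function.comp_def] using hd
  rw [hw.2, hw.1, hd', rhoGerm_eq hne]
  linear_combination w ^ 2 * Complex.I * P.abelH_half h1 hh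

lemma expands_gaugeGerm : Expands (fun w => ellK k * gaugeGerm k w) 1 0
    ((ellK k : ℂ) ^ 2 * ((k : ℂ) ^ 2 - (compl k : ℂ) ^ 2) / 3) := by
  have ha := P.analyticAt_gaugeGerm
  have hV := Expands.of_analyticAt ha
  have hL := (Expands.of_analyticAt ha.deriv).id_mul
  have hR := hV.sub (P.expands_rhoGerm.mul hV)
  obtain ⟨-, e1, e2⟩ := hL.unique hR P.gaugeGerm_ode
  have e0 := P.ellK_mul_gaugeGerm_zero
  have v1 : deriv (gaugeGerm k) 0 = 0 := by linear_combination e1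
  refine (hV.const_mul (ellK k : ℂ)).cast e0 (by rw [v1, mul_zero]) ?_
  linear_combination ellK k / 2 * e2 + (ellK k : ℂ) ^ 2 * ((k : ℂ) ^ 2 - (compl k : ℂ) ^ 2) / 3 * e0

lemma analyticAt_gaugeRoot : AnalyticAt ℂ (gaugeRoot k) 0 := by
  refine (analyticAt_const.mul P.analyticAt_gaugeGerm).cpow analyticAt_const ?_
  change ellK k * gaugeGerm k 0 ∈ Complex.slitPlane
  rw [P.ellK_mul_gaugeGerm_zero]
  exact Complex.one_mem_slitPlane

lemma gaugeRoot_zero : gaugeRoot k 0 = 1 := by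
  rw [gaugeRoot, P.ellK_mul_gaugeGerm_zero, Complex.one_cpow]

omit P in
lemma gaugeRoot_sq (w : ℂ) : gaugeRoot k w * gaugeRoot k w = ellK k * gaugeGerm k w := by
  rw [gaugeRoot, ← sq, ← Complex.cpow_nat_mul]
  norm_num

lemma expands_gaugeRoot : Expands (gaugeRoot k) 1 0
    ((ellK k : ℂ) ^ 2 * ((k : ℂ) ^ 2 - (compl k : ℂ) ^ 2) / 6) := by
  have hS := Expands.of_analyticAt P.analyticAt_gaugeRoot
  obtain ⟨-, e1, e2⟩ := (hS.mul hS).unique P.expands_gaugeGerm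
    (Eventually.of_forall gaugeRoot_sq)
  rw [P.gaugeRoot_zero] at hS e1 e2
  have s1 : deriv (gaugeRoot k) 0 = 0 := by linear_combination e1 / 2
  rw [s1] at hS e2
  exact hS.cast rfl rfl (by linear_combination e2 / 2)

lemma expands_inv_gaugeRoot : Expands (fun w => (gaugeRoot k w)⁻¹) 1 0
    (-((ellK k : ℂ) ^ 2 * ((k : ℂ) ^ 2 - (compl k : ℂ) ^ 2) / 6)) := by
  have h0 : gaugeRoot k 0 ≠ 0 := by rw [P.gaugeRoot_zero]; exact one_ne_zero
  have hi := Expands.of_analyticAt (P.analyticAt_gaugeRoot.inv h0)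
  have hne := (P.analyticAt_gaugeRoot.continuousAt.eventually_ne h0).filter_mono
    (nhdsWithin_le_nhds (s := {0}ᶜ))
  obtain ⟨e0, e1, e2⟩ := (P.expands_gaugeRoot.mul hi).unique (Expands.const 1)
    (hne.mono fun w hw => by simp [hw])
  rw [one_mul] at e0
  rw [e0] at hi e1 e2
  have s1 : deriv (gaugeRoot k)⁻¹ 0 = 0 := by linear_combination e1
  rw [s1] at hi e2
  exact hi.cast rfl rfl (by linear_combination e2)

end Params

/-! ### The functions `y₁`, `y₃` and their expansions -/

/-- `y₁(w) = -θ₁'(0) θ₁(w - a) e^{2wμ} / (θ₁(a) θ₁(w))`. -/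
def yOne (k : ℝ) (a μ w : ℂ) : ℂ :=
  -(deriv (theta1 (tau k)) 0 / theta1 (tau k) a
    * (theta1 (tau k) (w - a) / theta1 (tau k) w * Complex.exp (w * (2 * μ))))

/-- `y₃(w) = θ₁'(0) θ₃(w - a) e^{2wμ} / (θ₃(a) θ₁(w))`. -/
def yThree (k : ℝ) (a μ w : ℂ) : ℂ :=
  deriv (theta1 (tau k)) 0 / theta3 (tau k) a
    * (theta3 (tau k) (w - a) / theta1 (tau k) w * Complex.exp (w * (2 * μ)))

/-- The analytic germ of `θ₁'(0) w e^{2wμ} / θ₁(w)`. -/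
def expGerm (k : ℝ) (μ w : ℂ) : ℂ :=
  deriv (theta1 (tau k)) 0 * Complex.exp (w * (2 * μ)) / sigma k w

/-- The analytic germ of `w (y₁ + y₃)`. -/
def sumGerm (k : ℝ) (a μ w : ℂ) : ℂ :=
  (theta3 (tau k) (w - a) / theta3 (tau k) a - theta1 (tau k) (w - a) / theta1 (tau k) a)
    * expGerm k μ w

/-- The numerator of `y₃ - y₁`. -/
def diffNum (k : ℝ) (a w : ℂ) : ℂ :=
  theta3 (tau k) (w - a) / theta3 (tau k) a + theta1 (tau k) (w - a) / theta1 (tau k) a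

/-- The analytic germ of `y₃ - y₁`. -/
def diffGerm (k : ℝ) (a μ w : ℂ) : ℂ := dslope (diffNum k a) 0 w * expGerm k μ w

lemma deriv_neg_of_odd {f : ℂ → ℂ} (hf : ∀ z, f (-z) = -f z) (z : ℂ) :
    deriv f (-z) = deriv f z := by
  have h : (fun z => f (-z)) = fun z => -f z := funext hf
  have h' := deriv_comp_neg f z
  rw [h, deriv.fun_neg] at h'
  linear_combination h'

lemma deriv_neg_of_even {f : ℂ → ℂ} (hf : ∀ z, f (-z) = f z) (z : ℂ) :
    deriv f (-z) = -deriv f z := by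
  have h : (fun z => f (-z)) = f := funext hf
  have h' := deriv_comp_neg f z
  rw [h] at h'
  linear_combination h'

namespace Params

variable {k : ℝ} (P : Params k)
include P

/-- `θ₁'/θ₁ - θ₃'/θ₃ = 2iK ζ` in product form. -/
lemma wronskian_abelZ {x : ℂ} (hx : theta1 (tau k) x * theta3 (tau k) x ≠ 0) :
    deriv (theta1 (tau k)) x * theta3 (tau k) x - theta1 (tau k) x * deriv (theta3 (tau k)) x =
      2 * Complex.I * ellK k * (abelZ k x * (theta1 (tau k) x * theta3 (tau k) x)) := by
  have e := wronskian_theta13 P.im_pos x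
  have t24 := mul_ne_zero P.theta2_ne P.theta4_ne
  rw [abelZ, div_mul_cancel₀ _ hx]
  apply mul_right_cancel₀ t24
  rw [e, P.deriv_theta1_eq, P.ellK_eq]
  linear_combination (theta2 (tau k) x * theta4 (tau k) x * Real.pi * theta3 (tau k) 0 ^ 2
    * (theta2 (tau k) 0 * theta4 (tau k) 0)) * Complex.I_sq

lemma logDeriv_sub {a : ℂ} (ha : theta1 (tau k) a * theta3 (tau k) a ≠ 0) :
    deriv (theta1 (tau k)) a / theta1 (tau k) a - deriv (theta3 (tau k)) a / theta3 (tau k) a =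
      2 * (Complex.I * ellK k * abelZ k a) := by
  have e := P.wronskian_abelZ ha
  have h1 := left_ne_zero_of_mul ha
  have h3 := right_ne_zero_of_mul ha
  field_simp
  linear_combination e

lemma second_wronskian {a : ℂ} (ha : theta1 (tau k) a * theta3 (tau k) a ≠ 0) :
    deriv (deriv (theta1 (tau k))) a * theta3 (tau k) a
        - theta1 (tau k) a * deriv (deriv (theta3 (tau k))) a =
      2 * Complex.I * ellK k * (4 * abelH k a * (theta1 (tau k) a * theta3 (tau k) a)
        + abelZ k a * (deriv (theta1 (tau k)) a * theta3 (tau k) a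
          + theta1 (tau k) a * deriv (theta3 (tau k)) a)) := by
  have h1 := hasDerivAt_theta1 P.im_pos a
  have h3 := hasDerivAt_theta3 P.im_pos a
  have d1 : HasDerivAt (deriv (theta1 (tau k))) (deriv (deriv (theta1 (tau k))) a) a :=
    (((differentiable_theta1 P.im_pos).analyticAt a).deriv).differentiableAt.hasDerivAt
  have d3 : HasDerivAt (deriv (theta3 (tau k))) (deriv (deriv (theta3 (tau k))) a) a :=
    (((differentiable_theta3 P.im_pos).analyticAt a).deriv).differentiableAt.hasDerivAt
  have hL := (d1.fun_mul h3).fun_sub (h1.fun_mul d3)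
  have hR := ((P.hasDerivAt_abelZ ha).fun_mul (h1.fun_mul h3)).const_mul (2 * Complex.I * ellK k)
  have hev : ∀ᶠ x in 𝓝 a, theta1 (tau k) x * theta3 (tau k) x ≠ 0 :=
    (P.continuous_theta1.mul P.continuous_theta3).continuousAt.eventually_ne ha
  have := (hL.congr_of_eventuallyEq (hev.mono fun x hx => (P.wronskian_abelZ hx).symm)).unique hR
  linear_combination this

/-- The differential equation for `y₁`. -/
lemma hasDerivAt_yOne {a μ p w : ℂ} (ha : theta1 (tau k) a * theta3 (tau k) a ≠ 0)
    (hμ : 2 * μ = 2 * beta1 k a + p) (hw : theta1 (tau k) w ≠ 0) :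
    HasDerivAt (yOne k a μ)
      ((p + Complex.I * ellK k * abelZ k a) * yOne k a μ w - rho k w * yThree k a μ w) w := by
  have h1 := left_ne_zero_of_mul ha
  have h3 := right_ne_zero_of_mul ha
  have hs : HasDerivAt (fun w => theta1 (tau k) (w - a)) (deriv (theta1 (tau k)) (w - a)) w :=
    (hasDerivAt_theta1 P.im_pos (w - a)).comp_sub_const w a
  have hE : HasDerivAt (fun w : ℂ => Complex.exp (w * (2 * μ)))
      (Complex.exp (w * (2 * μ)) * (1 * (2 * μ))) w :=
    ((hasDerivAt_id w).mul_const (2 * μ)).cexp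
  have h := (((hs.fun_div (hasDerivAt_theta1 P.im_pos w) hw).fun_mul hE).const_mul
    (deriv (theta1 (tau k)) 0 / theta1 (tau k) a)).fun_neg
  refine h.congr_deriv ?_
  have e := wronskian_theta11_shift P.im_pos w a
  have eL := P.logDeriv_sub ha
  have e2 : 2 * μ = p + Complex.I * ellK k * abelZ k a
      + deriv (theta3 (tau k)) a / theta3 (tau k) a := by
    rw [hμ, beta1, logDeriv_apply, logDeriv_apply]
    linear_combination eL / 2
  have t3 := P.theta3_ne
  have hd := P.deriv_theta1_eq
  rw [yOne, yThree, rho, e2]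
  generalize Complex.exp _ = ε
  have hρ : (Real.pi : ℂ) * (theta2 (tau k) 0 * theta4 (tau k) 0)
      = deriv (theta1 (tau k)) 0 / theta3 (tau k) 0 := by
    rw [hd, mul_div_cancel_right₀ _ t3]
  rw [hρ]
  have e3 : deriv (theta1 (tau k)) (w - a) * theta1 (tau k) w
      - theta1 (tau k) (w - a) * deriv (theta1 (tau k)) w =
      (theta1 (tau k) a * deriv (theta1 (tau k)) 0 * (theta3 (tau k) w * theta3 (tau k) (w - a))
        - deriv (theta3 (tau k)) a * theta3 (tau k) 0
          * (theta1 (tau k) w * theta1 (tau k) (w - a))) / (theta3 (tau k) 0 * theta3 (tau k) a) := by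
    rw [eq_div_iff (mul_ne_zero t3 h3), e]
  rw [e3]
  field_simp
  ring

/-- The differential equation for `y₃`. -/
lemma hasDerivAt_yThree {a μ p w : ℂ} (ha : theta1 (tau k) a * theta3 (tau k) a ≠ 0)
    (hμ : 2 * μ = 2 * beta1 k a + p) (hw : theta1 (tau k) w ≠ 0) :
    HasDerivAt (yThree k a μ)
      ((p - Complex.I * ellK k * abelZ k a) * yThree k a μ w - rho k w * yOne k a μ w) w := by
  have h1 := left_ne_zero_of_mul ha
  have h3 := right_ne_zero_of_mul ha
  have hs : HasDerivAt (fun w => theta3 (tau k) (w - a)) (deriv (theta3 (tau k)) (w - a)) w :=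
    (hasDerivAt_theta3 P.im_pos (w - a)).comp_sub_const w a
  have hE : HasDerivAt (fun w : ℂ => Complex.exp (w * (2 * μ)))
      (Complex.exp (w * (2 * μ)) * (1 * (2 * μ))) w :=
    ((hasDerivAt_id w).mul_const (2 * μ)).cexp
  have h := ((hs.fun_div (hasDerivAt_theta1 P.im_pos w) hw).fun_mul hE).const_mul
    (deriv (theta1 (tau k)) 0 / theta3 (tau k) a)
  refine h.congr_deriv ?_
  have e := wronskian_theta31_shift P.im_pos w a
  have eL := P.logDeriv_sub ha
  have e2 : 2 * μ = p - Complex.I * ellK k * abelZ k a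
      + deriv (theta1 (tau k)) a / theta1 (tau k) a := by
    rw [hμ, beta1, logDeriv_apply, logDeriv_apply]
    linear_combination -eL / 2
  have t3 := P.theta3_ne
  have hd := P.deriv_theta1_eq
  rw [yOne, yThree, rho, e2]
  generalize Complex.exp _ = ε
  have hρ : (Real.pi : ℂ) * (theta2 (tau k) 0 * theta4 (tau k) 0)
      = deriv (theta1 (tau k)) 0 / theta3 (tau k) 0 := by
    rw [hd, mul_div_cancel_right₀ _ t3]
  rw [hρ]
  have e3 : deriv (theta3 (tau k)) (w - a) * theta1 (tau k) w
      - theta3 (tau k) (w - a) * deriv (theta1 (tau k)) w =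
      (theta3 (tau k) a * deriv (theta1 (tau k)) 0 * (theta3 (tau k) w * theta1 (tau k) (w - a))
        - deriv (theta1 (tau k)) a * theta3 (tau k) 0
          * (theta1 (tau k) w * theta3 (tau k) (w - a))) / (theta3 (tau k) 0 * theta1 (tau k) a) := by
    rw [eq_div_iff (mul_ne_zero t3 h1), e]
  rw [e3]
  field_simp
  ring

lemma analyticAt_expGerm (μ : ℂ) : AnalyticAt ℂ (expGerm k μ) 0 := by
  refine AnalyticAt.div (analyticAt_const.mul ?_) (P.analyticAt_sigma 0) P.sigma_zero_ne
  have : Differentiable ℂ fun w : ℂ => Complex.exp (w * (2 * μ)) := by fun_prop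
  exact this.analyticAt 0

lemma expGerm_zero (μ : ℂ) : expGerm k μ 0 = 1 := by
  rw [expGerm, sigma_zero, zero_mul, Complex.exp_zero, mul_one, div_self P.deriv_theta1_ne]

lemma deriv_sigma_zero : deriv (sigma k) 0 = 0 := by
  rw [sigma, deriv_dslope_zero (differentiable_theta1 P.im_pos) (theta1_zero _),
    deriv_zero_of_even (deriv_neg_of_odd (theta1_neg (tau k))), zero_div]

lemma deriv_expGerm_zero (μ : ℂ) : deriv (expGerm k μ) 0 = 2 * μ := by
  have hE : HasDerivAt (fun w : ℂ => Complex.exp (w * (2 * μ)))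
      (Complex.exp (0 * (2 * μ)) * (1 * (2 * μ))) 0 :=
    ((hasDerivAt_id (0 : ℂ)).mul_const (2 * μ)).cexp
  have h := (hE.const_mul (deriv (theta1 (tau k)) 0)).fun_div
    (P.analyticAt_sigma 0).differentiableAt.hasDerivAt P.sigma_zero_ne
  have h' := h.deriv
  rw [P.deriv_sigma_zero, sigma_zero] at h'
  have hd := P.deriv_theta1_ne
  refine Eq.trans h' ?_
  rw [zero_mul, Complex.exp_zero]
  field_simp
  ring

lemma differentiable_diffNum (a : ℂ) : Differentiable ℂ (diffNum k a) := by
  have h1 := differentiable_theta1 P.im_pos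
  have h3 := differentiable_theta3 P.im_pos
  unfold diffNum
  fun_prop

omit P in
lemma diffNum_zero {a : ℂ} (ha : theta1 (tau k) a * theta3 (tau k) a ≠ 0) :
    diffNum k a 0 = 0 := by
  rw [diffNum, zero_sub, theta3_neg, theta1_neg, neg_div, div_self (left_ne_zero_of_mul ha),
    div_self (right_ne_zero_of_mul ha)]
  ring

lemma deriv_diffNum (a : ℂ) : deriv (diffNum k a) = fun w =>
    deriv (theta3 (tau k)) (w - a) / theta3 (tau k) a
      + deriv (theta1 (tau k)) (w - a) / theta1 (tau k) a := by
  funext w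
  exact ((((hasDerivAt_theta3 P.im_pos (w - a)).comp_sub_const w a).div_const _).fun_add
    (((hasDerivAt_theta1 P.im_pos (w - a)).comp_sub_const w a).div_const _)).deriv

lemma deriv_diffNum_zero {a : ℂ} (ha : theta1 (tau k) a * theta3 (tau k) a ≠ 0) :
    deriv (diffNum k a) 0 = 2 * (Complex.I * ellK k * abelZ k a) := by
  rw [P.deriv_diffNum, ← P.logDeriv_sub ha]
  simp only [zero_sub]
  rw [deriv_neg_of_odd (theta1_neg (tau k)), deriv_neg_of_even (theta3_neg (tau k))]
  ring

lemma deriv_deriv_diffNum_zero {a : ℂ} (ha : theta1 (tau k) a * theta3 (tau k) a ≠ 0) :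
    deriv (deriv (diffNum k a)) 0 / 2 = -4 * Complex.I * ellK k * abelH k a
      - 4 * (Complex.I * ellK k * abelZ k a) * beta1 k a := by
  have h1 := left_ne_zero_of_mul ha
  have h3 := right_ne_zero_of_mul ha
  have d1 : HasDerivAt (deriv (theta1 (tau k))) (deriv (deriv (theta1 (tau k))) (0 - a)) (0 - a) :=
    (((differentiable_theta1 P.im_pos).analyticAt _).deriv).differentiableAt.hasDerivAt
  have d3 : HasDerivAt (deriv (theta3 (tau k))) (deriv (deriv (theta3 (tau k))) (0 - a)) (0 - a) :=
    (((differentiable_theta3 P.im_pos).analyticAt _).deriv).differentiableAt.hasDerivAt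
  have e := ((((d3.comp_sub_const 0 a).div_const (theta3 (tau k) a)).fun_add
    ((d1.comp_sub_const 0 a).div_const (theta1 (tau k) a)))).deriv
  rw [P.deriv_diffNum]
  refine (congrArg (· / 2) e).trans ?_
  simp only [zero_sub]
  rw [deriv_neg_of_even (deriv_neg_of_odd (theta1_neg (tau k))),
    deriv_neg_of_odd (deriv_neg_of_even (theta3_neg (tau k))), beta1, logDeriv_apply,
    logDeriv_apply]
  have e2 := P.second_wronskian ha
  field_simp
  linear_combination -e2

lemma analyticAt_diffGerm (a μ : ℂ) : AnalyticAt ℂ (diffGerm k a μ) 0 :=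
  (analyticAt_dslope_zero (P.differentiable_diffNum a) 0).mul (P.analyticAt_expGerm μ)

lemma diffGerm_zero {a : ℂ} (ha : theta1 (tau k) a * theta3 (tau k) a ≠ 0) (μ : ℂ) :
    diffGerm k a μ 0 = 2 * (Complex.I * ellK k * abelZ k a) := by
  rw [diffGerm, dslope_same, P.deriv_diffNum_zero ha, P.expGerm_zero, mul_one]

/-- This coefficient cannot come from `diffGerm_ode`: as wρ(w) = 1 + O(w²), it cancels from the
equation at order one. It is computed from the second derivatives of θ₁ and θ₃, and this is where η
enters. -/
lemma deriv_diffGerm_zero {a μ p : ℂ} (ha : theta1 (tau k) a * theta3 (tau k) a ≠ 0)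
    (hμ : 2 * μ = 2 * beta1 k a + p) :
    deriv (diffGerm k a μ) 0 = 2 * p * (Complex.I * ellK k * abelZ k a)
      - 4 * Complex.I * ellK k * abelH k a := by
  have hd := (analyticAt_dslope_zero (P.differentiable_diffNum a) 0).differentiableAt.hasDerivAt
  have h := (hd.fun_mul (P.analyticAt_expGerm μ).differentiableAt.hasDerivAt).deriv
  refine Eq.trans h ?_
  rw [deriv_dslope_zero (P.differentiable_diffNum a) (diffNum_zero ha),
    P.deriv_deriv_diffNum_zero ha, dslope_same, P.deriv_diffNum_zero ha, P.expGerm_zero,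
    P.deriv_expGerm_zero, hμ]
  ring

omit P in
lemma diffGerm_eq {a : ℂ} (ha : theta1 (tau k) a * theta3 (tau k) a ≠ 0) (μ : ℂ) {w : ℂ}
    (hw : w ≠ 0) : diffGerm k a μ w = yThree k a μ w - yOne k a μ w := by
  have h : dslope (diffNum k a) 0 w = diffNum k a w / w := by
    rw [← id_mul_dslope (diffNum_zero ha), mul_div_cancel_left₀ _ hw]
  rw [diffGerm, h, diffNum, expGerm, yThree, yOne, ← id_mul_sigma k w]
  have h1 := left_ne_zero_of_mul ha
  have h3 := right_ne_zero_of_mul ha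
  field_simp
  ring

lemma analyticAt_sumGerm (a μ : ℂ) : AnalyticAt ℂ (sumGerm k a μ) 0 := by
  refine AnalyticAt.mul ?_ (P.analyticAt_expGerm μ)
  have h1 := differentiable_theta1 P.im_pos
  have h3 := differentiable_theta3 P.im_pos
  have : Differentiable ℂ fun w => theta3 (tau k) (w - a) / theta3 (tau k) a
      - theta1 (tau k) (w - a) / theta1 (tau k) a := by fun_prop
  exact this.analyticAt 0

lemma sumGerm_zero {a : ℂ} (ha : theta1 (tau k) a * theta3 (tau k) a ≠ 0) (μ : ℂ) :
    sumGerm k a μ 0 = 2 := by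
  rw [sumGerm, P.expGerm_zero, zero_sub, theta3_neg, theta1_neg, neg_div,
    div_self (left_ne_zero_of_mul ha), div_self (right_ne_zero_of_mul ha)]
  norm_num

omit P in
lemma sumGerm_eq {a μ w : ℂ} (hw : w ≠ 0) :
    sumGerm k a μ w = w * (yOne k a μ w + yThree k a μ w) := by
  rw [sumGerm, expGerm, yThree, yOne, ← id_mul_sigma k w]
  field_simp
  ring

/-- Passing to y₁ + y₃ and y₃ - y₁ diagonalises the coupling through ρ, with coefficients -ρ and +ρ.
As ρ ~ 1/w, the exponents at w = 0 are -1 and +1: the sum has the pole, and the exponent +1 is the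
resonance of the regular difference. -/
lemma sumGerm_ode {a μ p : ℂ} (ha : theta1 (tau k) a * theta3 (tau k) a ≠ 0)
    (hμ : 2 * μ = 2 * beta1 k a + p) : ∀ᶠ w in 𝓝[≠] (0 : ℂ),
    w * deriv (sumGerm k a μ) w = sumGerm k a μ w + w * (p * sumGerm k a μ w)
      - w * (w * (Complex.I * ellK k * abelZ k a * diffGerm k a μ w))
      - rhoGerm k w * sumGerm k a μ w := by
  have h : sumGerm k a μ =ᶠ[𝓝[≠] 0] fun w => w * (yOne k a μ w + yThree k a μ w) := by
    filter_upwards [self_mem_nhdsWithin] with w hw using sumGerm_eq hw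
  filter_upwards [eventually_deriv_eq h, P.eventually_theta1_ne, self_mem_nhdsWithin]
    with w hw h1 hne
  have hd := ((hasDerivAt_id w).fun_mul ((P.hasDerivAt_yOne ha hμ h1).fun_add
    (P.hasDerivAt_yThree ha hμ h1))).deriv
  simp only [id] at hd
  rw [hw.2, hw.1, hd, rhoGerm_eq hne, diffGerm_eq ha μ hne]
  ring

lemma diffGerm_ode {a μ p : ℂ} (ha : theta1 (tau k) a * theta3 (tau k) a ≠ 0)
    (hμ : 2 * μ = 2 * beta1 k a + p) : ∀ᶠ w in 𝓝[≠] (0 : ℂ),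
    w * deriv (diffGerm k a μ) w = w * (p * diffGerm k a μ w)
      - Complex.I * ellK k * abelZ k a * sumGerm k a μ w + rhoGerm k w * diffGerm k a μ w := by
  have h : diffGerm k a μ =ᶠ[𝓝[≠] 0] fun w => yThree k a μ w - yOne k a μ w := by
    filter_upwards [self_mem_nhdsWithin] with w hw using diffGerm_eq ha μ hw
  filter_upwards [eventually_deriv_eq h, P.eventually_theta1_ne, self_mem_nhdsWithin]
    with w hw h1 hne
  have hd := ((P.hasDerivAt_yThree ha hμ h1).fun_sub (P.hasDerivAt_yOne ha hμ h1)).deriv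
  rw [hw.2, hw.1, hd, rhoGerm_eq hne, sumGerm_eq hne]
  ring

/-- `w (y₁ + y₃) = 2 + 2pw + (p² - q² + 2β) w² + O(w³)`. -/
lemma expands_sumGerm {a μ p : ℂ} (ha : theta1 (tau k) a * theta3 (tau k) a ≠ 0)
    (hμ : 2 * μ = 2 * beta1 k a + p) :
    Expands (sumGerm k a μ) 2 (2 * p) (p ^ 2 - (Complex.I * ellK k * abelZ k a) ^ 2
      + 2 / 3 * (ellK k : ℂ) ^ 2 * ((k : ℂ) ^ 2 - (compl k : ℂ) ^ 2)) := by
  have hG := Expands.of_analyticAt (P.analyticAt_sumGerm a μ)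
  have hW := Expands.of_analyticAt (P.analyticAt_diffGerm a μ)
  have hL := (Expands.of_analyticAt (P.analyticAt_sumGerm a μ).deriv).id_mul
  have hR := ((hG.add (hG.const_mul p).id_mul).sub
    (hW.const_mul (Complex.I * ellK k * abelZ k a)).id_mul.id_mul).sub (P.expands_rhoGerm.mul hG)
  obtain ⟨-, e1, e2⟩ := hL.unique hR (P.sumGerm_ode ha hμ)
  rw [P.sumGerm_zero ha] at hG e1 e2
  rw [P.diffGerm_zero ha] at e2
  have g1 : deriv (sumGerm k a μ) 0 = 2 * p := by linear_combination e1
  rw [g1] at hG e2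
  exact hG.cast rfl rfl (by linear_combination e2 / 2)

/-- `y₃ - y₁ = 2q + W₁ w + W₂ w² + O(w³)`. -/
lemma expands_diffGerm {a μ p : ℂ} (ha : theta1 (tau k) a * theta3 (tau k) a ≠ 0)
    (hμ : 2 * μ = 2 * beta1 k a + p) :
    Expands (diffGerm k a μ) (2 * (Complex.I * ellK k * abelZ k a))
      (2 * p * (Complex.I * ellK k * abelZ k a) - 4 * Complex.I * ellK k * abelH k a)
      (p * (2 * p * (Complex.I * ellK k * abelZ k a) - 4 * Complex.I * ellK k * abelH k a)
        - Complex.I * ellK k * abelZ k a * (p ^ 2 - (Complex.I * ellK k * abelZ k a) ^ 2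
          + 2 / 3 * (ellK k : ℂ) ^ 2 * ((k : ℂ) ^ 2 - (compl k : ℂ) ^ 2))
        - 4 / 3 * (ellK k : ℂ) ^ 2 * ((k : ℂ) ^ 2 - (compl k : ℂ) ^ 2)
          * (Complex.I * ellK k * abelZ k a)) := by
  have hW := Expands.of_analyticAt (P.analyticAt_diffGerm a μ)
  have hL := (Expands.of_analyticAt (P.analyticAt_diffGerm a μ).deriv).id_mul
  have hR := ((hW.const_mul p).id_mul.sub ((P.expands_sumGerm ha hμ).const_mul
    (Complex.I * ellK k * abelZ k a))).add (P.expands_rhoGerm.mul hW)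
  -- Orders zero and one hold identically once the first two coefficients are known; only order two
  -- carries information.
  obtain ⟨-, -, e2⟩ := hL.unique hR (P.diffGerm_ode ha hμ)
  rw [P.diffGerm_zero ha, P.deriv_diffGerm_zero ha hμ] at e2
  exact hW.cast (P.diffGerm_zero ha μ) (P.deriv_diffGerm_zero ha hμ) (by linear_combination e2)

end Params

/-! ### The gauge transformation -/

lemma theta2_sub_half (τ z : ℂ) : theta2 τ (z - 1 / 2) = theta1 τ z := by
  rw [← theta1_add_half, sub_add_cancel]

lemma theta4_sub_half (τ z : ℂ) : theta4 τ (z - 1 / 2) = theta3 τ z := by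
  rw [← theta3_add_half, sub_add_cancel]

lemma theta2_half_sub (τ w : ℂ) : theta2 τ (1 / 2 - w) = theta1 τ w := by
  rw [← theta2_neg, neg_sub, theta2_sub_half]

lemma theta4_half_sub (τ w : ℂ) : theta4 τ (1 / 2 - w) = theta3 τ w := by
  rw [← theta4_neg, neg_sub, theta4_sub_half]

lemma nahmF3_eq (k s : ℝ) : nahmF3 k s = rho k ((1 - s) / 2) / 2 := by
  rw [nahmF3, rho, show (s : ℂ) / 2 = 1 / 2 - (1 - s) / 2 by ring, theta2_half_sub,
    theta4_half_sub]
  ring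

/-- The combination `θ₂θ₄/(θ₁θ₃)` is positive on `(0, 1/4]`. -/
lemma Params.abelZ_pos {k : ℝ} (P : Params k) {x : ℝ} (h0 : 0 < x) (h1 : x ≤ 1 / 4) :
    theta1 (tau k) x * theta3 (tau k) x ≠ 0 ∧ ∃ r : ℝ, 0 < r ∧ Complex.I * abelZ k x = r := by
  obtain ⟨a, ha, ea⟩ := theta1_real_pos P.T_pos x h0 (by linarith)
  obtain ⟨b, hb, eb⟩ := theta2_real_pos P.T_pos x h0.le (by linarith)
  obtain ⟨c, hc, ec⟩ := theta3_real_pos P.T_pos x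
  obtain ⟨d, hd, ed⟩ := theta4_real_pos P.T_pos x
  rw [← P.tau_eq] at ea eb ec ed
  have ha' : (a : ℂ) ≠ 0 := by exact_mod_cast ha.ne'
  have hc' : (c : ℂ) ≠ 0 := by exact_mod_cast hc.ne'
  refine ⟨by rw [ea, ec]; exact mul_ne_zero ha' hc', b * d / (a * c), by positivity, ?_⟩
  rw [abelZ, ea, eb, ec, ed]
  push_cast
  field_simp
  linear_combination -(b : ℂ) * d * Complex.I_sq

/-- The point 1/4 is fixed by a ↦ 1/2 - a, which exchanges θ₁ with θ₂ and θ₃ with θ₄. It corresponds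
to z = 0 and fixes the integration constant of the gauge exponent as log 1 = 0. -/
lemma abelZ_quarter {k : ℝ} (P : Params k) : Complex.I * abelZ k (1 / 4) = 1 := by
  have h := (P.abelZ_pos (x := 1 / 4) (by norm_num) le_rfl).1
  push_cast at h
  have e2 : theta2 (tau k) (1 / 4) = theta1 (tau k) (1 / 4) := by
    rw [← theta2_half_sub]; norm_num
  have e4 : theta4 (tau k) (1 / 4) = theta3 (tau k) (1 / 4) := by
    rw [← theta4_half_sub]; norm_num
  rw [abelZ, e2, e4, mul_div_assoc, div_self h, mul_one]
  linear_combination -Complex.I_sq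

/-- The gauge exponent `∫₀^z f₃` is the logarithm of `θ₂θ₄/(θ₁θ₃)((1 - z)/4)`. -/
theorem Params.integral_nahmF3 {k : ℝ} (P : Params k) {z : ℝ} (h0 : 0 ≤ z) (h1 : z < 1) :
    ∫ s in (0 : ℝ)..z, nahmF3 k s = Complex.log (Complex.I * abelZ k ((1 - z) / 4)) := by
  have hmem : ∀ s ∈ Set.uIcc 0 z, 0 ≤ s ∧ s < 1 := by
    intro s hs
    rw [Set.uIcc_of_le h0] at hs
    exact ⟨hs.1, hs.2.trans_lt h1⟩
  have hθ : ∀ s ∈ Set.uIcc 0 z, theta1 (tau k) ((1 - s) / 2) ≠ 0 := by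
    intro s hs
    obtain ⟨hs0, hs1⟩ := hmem s hs
    have := theta1_ne_zero P.T_pos ((1 - s) / 2) (by linarith) (by linarith)
    rw [← P.tau_eq] at this
    push_cast at this
    exact this
  have hderiv : ∀ s ∈ Set.uIcc 0 z,
      HasDerivAt (fun s : ℝ => Complex.log (Complex.I * abelZ k ((1 - s) / 4))) (nahmF3 k s) s := by
    intro s hs
    obtain ⟨hs0, hs1⟩ := hmem s hs
    obtain ⟨hne, r, hr, er⟩ := P.abelZ_pos (x := (1 - s) / 4) (by linarith) (by linarith)
    push_cast at hne er
    have hin : HasDerivAt (fun s : ℝ => ((1 : ℂ) - s) / 4) (-1 / 4) s :=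
      ((Complex.ofRealCLM.hasDerivAt (x := s)).const_sub 1).div_const 4
    have hz := (((P.hasDerivAt_abelZ hne).comp s hin).const_mul Complex.I)
    have hlog := hz.clog_real (by
      change Complex.I * abelZ k ((1 - s) / 4) ∈ Complex.slitPlane
      rw [er]; exact Or.inl (by simpa using hr))
    refine hlog.congr_deriv ?_
    have hne' : Complex.I * abelZ k ((1 - s) / 4) ≠ 0 := by
      rw [er]; exact_mod_cast hr.ne'
    have hdup := P.abelH_half (w := (1 - s) / 2) (hθ s hs) (by
      rwa [show ((1 : ℂ) - s) / 2 / 2 = (1 - s) / 4 by ring])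
    rw [show ((1 : ℂ) - s) / 2 / 2 = (1 - s) / 4 by ring] at hdup
    simp only [Function.comp]
    rw [div_eq_iff hne', nahmF3_eq]
    linear_combination -Complex.I / 2 * hdup
  have hint : IntervalIntegrable (nahmF3 k) MeasureTheory.volume 0 z := by
    apply ContinuousOn.intervalIntegrable
    have : nahmF3 k = fun s : ℝ => rho k ((1 - s) / 2) / 2 := funext (nahmF3_eq k)
    rw [this]
    intro s hs
    apply ContinuousAt.continuousWithinAt
    have hc : ContinuousAt (fun s : ℝ => ((1 : ℂ) - s) / 2) s := by fun_prop
    exact (ContinuousAt.comp (f := fun s : ℝ => ((1 : ℂ) - s) / 2)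
      (P.hasDerivAt_rho (hθ s hs)).continuousAt hc).div_const 2
  rw [intervalIntegral.integral_eq_sub_of_hasDerivAt hderiv hint]
  have hq : Complex.I * abelZ k 4⁻¹ = 1 := by simpa using abelZ_quarter P
  simp [hq]

lemma Params.ellK_pos {k : ℝ} (P : Params k) : 0 < ellK k := by
  have := P.pi_mul
  have := mul_pos Real.pi_pos (pow_pos P.r₃_pos 2)
  linarith

/-- The gauge factor `e^{∫₀^z f₃/2}` at `z = 1 - ξ`. -/
theorem Params.exp_gauge {k : ℝ} (P : Params k) {ξ : ℝ} (h0 : 0 < ξ) (h1 : ξ ≤ 1) :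
    Complex.exp ((∫ s in (0 : ℝ)..(1 - ξ), nahmF3 k s) / 2) * Real.sqrt (ellK k * ξ / 2) =
      gaugeRoot k (ξ / 2) := by
  obtain ⟨-, r, hr, er⟩ := P.abelZ_pos (x := ξ / 4) (by linarith) (by linarith)
  have hK := P.ellK_pos
  have hpos : 0 ≤ ellK k * ξ / 2 := by positivity
  push_cast at er
  rw [P.integral_nahmF3 (by linarith) (by linarith)]
  have e : ((1 : ℂ) - ((1 - ξ : ℝ) : ℂ)) / 4 = ξ / 4 := by push_cast; ring
  have hξ : (ξ : ℂ) / 2 ≠ 0 := by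
    have : (ξ : ℂ) ≠ 0 := by exact_mod_cast h0.ne'
    exact div_ne_zero this two_ne_zero
  rw [e, er, gaugeRoot, gaugeGerm_eq hξ, show (ξ : ℂ) / 2 / 2 = ξ / 4 by ring, er,
    ← Complex.ofReal_log hr.le]
  have h2 : Complex.exp ((Real.log r : ℂ) / 2) = (Real.sqrt r : ℂ) := by
    rw [show (Real.log r : ℂ) / 2 = ((Real.log r / 2 : ℝ) : ℂ) by push_cast; ring,
      ← Complex.ofReal_exp, Real.sqrt_eq_rpow, Real.rpow_def_of_pos hr]
    norm_num [div_eq_mul_inv]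
  rw [h2, ← Complex.ofReal_mul, ← Real.sqrt_mul hr.le,
    show (ellK k : ℂ) * (ξ / 2 * r) = ((r * (ellK k * ξ / 2) : ℝ) : ℂ) by push_cast; ring,
    show (1 / 2 : ℂ) = ((1 / 2 : ℝ) : ℂ) by push_cast; ring,
    ← Complex.ofReal_cpow (by positivity), Real.sqrt_eq_rpow]

/-- C is the exponential of a multiple of the swap matrix, and the rows (1, -1) and (1, 1) of √2·𝒪
are eigenvectors of the swap. In the last two entries of v̄ᵢ this brings in y₁ + y₃ and y₃ - y₁. -/
lemma orthO_mul_inv_gaugeC (k z : ℝ) : orthO * (gaugeC k z)⁻¹ =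
    (1 / (Real.sqrt 2 : ℂ)) •
      !![Complex.exp ((∫ s in (0 : ℝ)..z, nahmF3 k s) / 2),
          -Complex.exp ((∫ s in (0 : ℝ)..z, nahmF3 k s) / 2);
        (Complex.exp ((∫ s in (0 : ℝ)..z, nahmF3 k s) / 2))⁻¹,
          (Complex.exp ((∫ s in (0 : ℝ)..z, nahmF3 k s) / 2))⁻¹] := by
  rw [gaugeC]
  generalize (∫ s in (0 : ℝ)..z, nahmF3 k s) / 2 = J
  have hinv : (!![Complex.cosh J, Complex.sinh J; Complex.sinh J, Complex.cosh J])⁻¹ =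
      !![Complex.cosh J, -Complex.sinh J; -Complex.sinh J, Complex.cosh J] := by
    apply Matrix.inv_eq_right_inv
    have h := Complex.cosh_sq_sub_sinh_sq J
    ext a b
    fin_cases a <;> fin_cases b <;> simp [Matrix.mul_apply, Fin.sum_univ_two] <;>
      first | linear_combination h | ring
  rw [hinv, orthO, Matrix.smul_mul, ← Complex.exp_neg]
  have hp := Complex.cosh_add_sinh J
  have hm := Complex.cosh_sub_sinh J
  congr 1
  ext a b
  fin_cases a <;> fin_cases b <;> simp [Matrix.mul_apply, Fin.sum_univ_two] <;>
    first | linear_combination -hp | linear_combination hm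

lemma oneTensor_mulVec (M : Matrix (Fin 2) (Fin 2) ℂ) (v : Fin 4 → ℂ) :
    (oneTensor M).mulVec v = ![M 0 0 * v 0 + M 0 1 * v 1, M 1 0 * v 0 + M 1 1 * v 1,
      M 0 0 * v 2 + M 0 1 * v 3, M 1 0 * v 2 + M 1 1 * v 3] := by
  have e0 : (finProdFinEquiv (m := 2) (n := 2)).symm 0 = (0, 0) := by decide
  have e1 : (finProdFinEquiv (m := 2) (n := 2)).symm 1 = (0, 1) := by decide
  have e2 : (finProdFinEquiv (m := 2) (n := 2)).symm 2 = (1, 0) := by decide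
  have e3 : (finProdFinEquiv (m := 2) (n := 2)).symm 3 = (1, 1) := by decide
  have key : ∀ a b : Fin (2 * 2), oneTensor M a b =
      (1 : Matrix (Fin 2) (Fin 2) ℂ) (finProdFinEquiv.symm a).1 (finProdFinEquiv.symm b).1
      * M (finProdFinEquiv.symm a).2 (finProdFinEquiv.symm b).2 :=
    fun _ _ => rfl
  have row : ∀ a : Fin 4, (oneTensor M).mulVec v a =
      oneTensor M a 0 * v 0 + oneTensor M a 1 * v 1 + oneTensor M a 2 * v 2
        + oneTensor M a 3 * v 3 := by
    intro a
    simp only [Matrix.mulVec, dotProduct, Fin.sum_univ_four]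
  have r0 := row 0
  have r1 := row 1
  have r2 := row 2
  have r3 := row 3
  erw [key, key, key, key, e0, e1, e2, e3] at r0 r1 r2 r3
  ext a
  fin_cases a
  · simpa using r0
  · simpa using r1
  · simpa using r2
  · simpa using r3

/-! ### The entries of `Λ̄ᵢ` -/

/-- The four intersection points of a mini-twistor line with the curve, given by Abel images
with sum zero. -/
structure LinePoints (k : ℝ) (xp xm y a b c d : ℂ) : Prop where
  sum : a + b + c + d = 0
  ne_a : theta1 (tau k) a * theta3 (tau k) a ≠ 0
  ne_b : theta1 (tau k) b * theta3 (tau k) b ≠ 0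
  ne_c : theta1 (tau k) c * theta3 (tau k) c ≠ 0
  ne_d : theta1 (tau k) d * theta3 (tau k) d ≠ 0
  eta_a : abelH k a = quad xp xm y (abelZ k a)
  eta_b : abelH k b = quad xp xm y (abelZ k b)
  eta_c : abelH k c = quad xp xm y (abelZ k c)
  eta_d : abelH k d = quad xp xm y (abelZ k d)
  quadruple : IsQuadruple k xp xm y (abelZ k a) (abelZ k b) (abelZ k c) (abelZ k d)
  zeta_ne : abelZ k a ≠ 0

/-- `θ₃(0) θ₃(b + c) θ₃(b + d) θ₃(c + d)`. -/
def tripleQ (k : ℝ) (b c d : ℂ) : ℂ :=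
  theta3 (tau k) 0 * (theta3 (tau k) (b + c) * theta3 (tau k) (b + d) * theta3 (tau k) (c + d))

/-- `∏ θ₁θ₃` over three points. -/
def tripleD (k : ℝ) (b c d : ℂ) : ℂ :=
  theta1 (tau k) b * theta3 (tau k) b * (theta1 (tau k) c * theta3 (tau k) c)
    * (theta1 (tau k) d * theta3 (tau k) d)

namespace LinePoints

variable {k : ℝ} {xp xm y a b c d : ℂ}

lemma tripleD_ne (h : LinePoints k xp xm y a b c d) : tripleD k b c d ≠ 0 :=
  mul_ne_zero (mul_ne_zero h.ne_b h.ne_c) h.ne_d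

lemma tripleQ_ne (P : Params k) (h : LinePoints k xp xm y a b c d) : tripleQ k b c d ≠ 0 := by
  refine mul_ne_zero P.theta3_ne (mul_ne_zero (mul_ne_zero ?_ ?_) ?_)
  · exact (P.addition_of_quarticDD h.ne_b h.ne_c h.eta_b h.eta_c
      h.quadruple.rotate.quarticDD12).1
  · exact (P.addition_of_quarticDD h.ne_b h.ne_d h.eta_b h.eta_d
      h.quadruple.rotate.quarticDD13).1
  · exact (P.addition_of_quarticDD h.ne_c h.ne_d h.eta_c h.eta_d
      h.quadruple.rotate.rotate.quarticDD12).1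

lemma prod_relation (P : Params k) (h : LinePoints k xp xm y a b c d) :
    (ellK k / 2 + xm) * (theta1 (tau k) a * theta1 (tau k) b * theta1 (tau k) c * theta1 (tau k) d)
      = (ellK k / 2 - xm)
        * (theta3 (tau k) a * theta3 (tau k) b * theta3 (tau k) c * theta3 (tau k) d) := by
  have hq := h.quadruple
  refine P.prod_theta_relation h.sum h.ne_a h.ne_b h.ne_c h.ne_d h.eta_a h.eta_b h.eta_c h.eta_d
    hq.quarticDD12 hq.quarticDD13 hq.quarticDD14 hq.rotate.quarticDD12 hq.rotate.quarticDD13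
    hq.rotate.rotate.quarticDD12 ?_ ?_ h.zeta_ne
  · linear_combination hq.esymm1
  · intro h0
    exact hq.ne (by linear_combination 4 * h0)

lemma riemann (P : Params k) (h : LinePoints k xp xm y a b c d) :
    theta3 (tau k) a * theta3 (tau k) b * theta3 (tau k) c * theta3 (tau k) d
      + theta1 (tau k) a * theta1 (tau k) b * theta1 (tau k) c * theta1 (tau k) d =
      tripleQ k b c d := by
  have e := theta_riemann P.im_pos b c d
  rw [show b + c + d = -a by linear_combination h.sum, theta1_neg, theta3_neg] at e
  rw [tripleQ, ← e]
  ring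

/-- `prod_relation` and `riemann` are two linear equations for ∏θ₁ and ∏θ₃ over the four points.
Solving them replaces products over b, c, d by values at a and the common factor `tripleQ`. -/
lemma prod_theta1 (P : Params k) (h : LinePoints k xp xm y a b c d) :
    ellK k * (theta1 (tau k) a * theta1 (tau k) b * theta1 (tau k) c * theta1 (tau k) d) =
      (ellK k / 2 - xm) * tripleQ k b c d := by
  linear_combination h.prod_relation P + (ellK k / 2 - xm) * h.riemann P

lemma prod_theta3 (P : Params k) (h : LinePoints k xp xm y a b c d) :
    ellK k * (theta3 (tau k) a * theta3 (tau k) b * theta3 (tau k) c * theta3 (tau k) d) =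
      (ellK k / 2 + xm) * tripleQ k b c d := by
  linear_combination -h.prod_relation P + (ellK k / 2 + xm) * h.riemann P

lemma third_row (P : Params k) (h : LinePoints k xp xm y a b c d) (w : ℂ) :
    theta1 (tau k) w * theta1 (tau k) (w - a)
        / (theta3 (tau k) b * theta3 (tau k) c * theta3 (tau k) d) =
      tripleQ k b c d / (ellK k * tripleD k b c d) * ((ellK k / 2 - xm)
        * (theta1 (tau k) w * (theta1 (tau k) (w - a) / theta1 (tau k) a))) := by
  have e := h.prod_theta1 P
  have hK := P.ellK_ne
  have a1 := left_ne_zero_of_mul h.ne_a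
  have b1 := left_ne_zero_of_mul h.ne_b
  have b3 := right_ne_zero_of_mul h.ne_b
  have c1 := left_ne_zero_of_mul h.ne_c
  have c3 := right_ne_zero_of_mul h.ne_c
  have d1 := left_ne_zero_of_mul h.ne_d
  have d3 := right_ne_zero_of_mul h.ne_d
  rw [tripleD]
  generalize tripleQ k b c d = Q at *
  generalize (ellK k : ℂ) = K at *
  generalize theta1 (tau k) (w - a) = T1
  rw [div_mul_eq_mul_div, div_eq_div_iff (by positivity) (by positivity), ← mul_div_assoc,
    ← mul_div_assoc, ← mul_div_assoc, div_mul_eq_mul_div, eq_div_iff a1]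
  linear_combination (theta1 (tau k) w * T1 * theta3 (tau k) b * theta3 (tau k) c
    * theta3 (tau k) d) * e

lemma fourth_row (P : Params k) (h : LinePoints k xp xm y a b c d) (w : ℂ) :
    theta1 (tau k) w * theta3 (tau k) (w - a)
        / (theta1 (tau k) b * theta1 (tau k) c * theta1 (tau k) d) =
      tripleQ k b c d / (ellK k * tripleD k b c d) * ((ellK k / 2 + xm)
        * (theta1 (tau k) w * (theta3 (tau k) (w - a) / theta3 (tau k) a))) := by
  have e := h.prod_theta3 P
  have hK := P.ellK_ne
  have a3 := right_ne_zero_of_mul h.ne_a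
  have b1 := left_ne_zero_of_mul h.ne_b
  have b3 := right_ne_zero_of_mul h.ne_b
  have c1 := left_ne_zero_of_mul h.ne_c
  have c3 := right_ne_zero_of_mul h.ne_c
  have d1 := left_ne_zero_of_mul h.ne_d
  have d3 := right_ne_zero_of_mul h.ne_d
  rw [tripleD]
  generalize tripleQ k b c d = Q at *
  generalize (ellK k : ℂ) = K at *
  generalize theta3 (tau k) (w - a) = T1
  rw [div_mul_eq_mul_div, div_eq_div_iff (by positivity) (by positivity), ← mul_div_assoc,
    ← mul_div_assoc, ← mul_div_assoc, div_mul_eq_mul_div, eq_div_iff a3]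
  linear_combination (theta1 (tau k) w * T1 * theta1 (tau k) b * theta1 (tau k) c
    * theta1 (tau k) d) * e

/-- `theta33_decomp` separates w from b. The coefficient θ₁(a + b)θ₁(b), taken relative to θ₃(a +
b)θ₃(b), is then evaluated by the first form of the addition theorem. -/
lemma first_row (P : Params k) (h : LinePoints k xp xm y a b c d) (w : ℂ) :
    theta2 (tau k) 0 * theta4 (tau k) 0 * theta3 (tau k) (b + c) * theta3 (tau k) (b + d)
        * theta3 (tau k) (w + b) * theta3 (tau k) (w - a - b)
        / (theta3 (tau k) b * tripleD k b c d) =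
      tripleQ k b c d / (ellK k * tripleD k b c d) *
        (Real.pi * (theta2 (tau k) 0 * theta4 (tau k) 0) / 2
            * (theta3 (tau k) w * (theta3 (tau k) (w - a) / theta3 (tau k) a))
          + (-2 * y + Complex.I * (ellK k / 2 - xm) * (abelZ k a + abelZ k b))
            * (theta1 (tau k) w * (theta1 (tau k) (w - a) / theta1 (tau k) a))) := by
  obtain ⟨-, f, -⟩ := P.addition_of_quarticDD h.ne_a h.ne_b h.eta_a h.eta_b h.quadruple.quarticDD12
  have e := theta33_decomp P.im_pos w a b
  have hK := P.ellK_eq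
  have hKne := P.ellK_ne
  have hD := h.tripleD_ne
  have a1 := left_ne_zero_of_mul h.ne_a
  have a3 := right_ne_zero_of_mul h.ne_a
  have b3 := right_ne_zero_of_mul h.ne_b
  have t3 := P.theta3_ne
  rw [tripleQ, show c + d = -(a + b) by linear_combination h.sum, theta3_neg]
  generalize tripleD k b c d = D at *
  generalize -2 * y + Complex.I * (ellK k / 2 - xm) * (abelZ k a + abelZ k b) = g at *
  generalize (ellK k : ℂ) = K at *
  generalize theta3 (tau k) (w - a) = T3 at *
  generalize theta1 (tau k) (w - a) = T1 at *
  generalize theta3 (tau k) (w - a - b) = M at *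
  generalize theta3 (tau k) (w + b) = M' at *
  generalize theta3 (tau k) w = w3 at *
  generalize theta1 (tau k) w = w1 at *
  generalize theta2 (tau k) 0 * theta4 (tau k) 0 = t at *
  generalize theta3 (tau k) 0 = u at *
  generalize theta3 (tau k) (b + c) = m1 at *
  generalize theta3 (tau k) (b + d) = m2 at *
  generalize theta3 (tau k) (a + b) = s3 at *
  generalize theta1 (tau k) (a + b) = s1 at *
  generalize theta1 (tau k) a = A1 at *
  generalize theta3 (tau k) a = A3 at *
  generalize theta1 (tau k) b = B1 at *
  generalize theta3 (tau k) b = B3 at *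
  field_simp
  linear_combination (Real.pi * t * u * m1 * m2 * A1) * e
    + 2 * t * m1 * m2 * M' * M * A1 * A3 * hK + 2 * u * m1 * m2 * w1 * T1 * f

lemma second_row (P : Params k) (h : LinePoints k xp xm y a b c d) (w : ℂ) :
    theta2 (tau k) 0 * theta4 (tau k) 0 * theta3 (tau k) (b + c) * theta3 (tau k) (b + d)
        * theta1 (tau k) (w + b) * theta3 (tau k) (w - a - b)
        / (theta1 (tau k) b * tripleD k b c d) =
      tripleQ k b c d / (ellK k * tripleD k b c d) *
        (-(Real.pi * (theta2 (tau k) 0 * theta4 (tau k) 0) / 2)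
            * (theta3 (tau k) w * (theta1 (tau k) (w - a) / theta1 (tau k) a))
          - (-2 * y - Complex.I * (ellK k / 2 + xm) * (abelZ k a + abelZ k b))
            * (theta1 (tau k) w * (theta3 (tau k) (w - a) / theta3 (tau k) a))) := by
  obtain ⟨-, -, f⟩ := P.addition_of_quarticDD h.ne_a h.ne_b h.eta_a h.eta_b h.quadruple.quarticDD12
  have e := theta31_decomp P.im_pos w a b
  have hK := P.ellK_eq
  have hKne := P.ellK_ne
  have hD := h.tripleD_ne
  have a1 := left_ne_zero_of_mul h.ne_a
  have a3 := right_ne_zero_of_mul h.ne_a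
  have b1 := left_ne_zero_of_mul h.ne_b
  have t3 := P.theta3_ne
  rw [tripleQ, show c + d = -(a + b) by linear_combination h.sum, theta3_neg]
  generalize tripleD k b c d = D at *
  generalize -2 * y - Complex.I * (ellK k / 2 + xm) * (abelZ k a + abelZ k b) = g at *
  generalize (ellK k : ℂ) = K at *
  generalize theta3 (tau k) (w - a) = T3 at *
  generalize theta1 (tau k) (w - a) = T1 at *
  generalize theta3 (tau k) (w - a - b) = M at *
  generalize theta1 (tau k) (w + b) = M' at *
  generalize theta3 (tau k) w = w3 at *
  generalize theta1 (tau k) w = w1 at *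
  generalize theta2 (tau k) 0 * theta4 (tau k) 0 = t at *
  generalize theta3 (tau k) 0 = u at *
  generalize theta3 (tau k) (b + c) = m1 at *
  generalize theta3 (tau k) (b + d) = m2 at *
  generalize theta3 (tau k) (a + b) = s3 at *
  generalize theta1 (tau k) (a + b) = s1 at *
  generalize theta1 (tau k) a = A1 at *
  generalize theta3 (tau k) a = A3 at *
  generalize theta1 (tau k) b = B1 at *
  generalize theta3 (tau k) b = B3 at *
  field_simp
  linear_combination (Real.pi * t * u * m1 * m2 * A3) * e
    + 2 * t * m1 * m2 * M' * M * A1 * A3 * hK - 2 * u * m1 * m2 * w1 * T3 * f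

end LinePoints

/-! ### Products and sums over a labelling of the four points. -/

lemma erase_eq_of_injective {i j m l : Fin 4} (h : Function.Injective ![i, j, m, l]) :
    (Finset.univ : Finset (Fin 4)).erase i = {j, m, l} ∧ j ≠ m ∧ j ≠ l ∧ m ≠ l ∧
      i ≠ j ∧ i ≠ m ∧ i ≠ l := by
  have hd : ∀ p q : Fin 4, p ≠ q → ![i, j, m, l] p ≠ ![i, j, m, l] q := fun p q hpq => h.ne hpq
  have h01 : i ≠ j := hd 0 1 (by decide)
  have h02 : i ≠ m := hd 0 2 (by decide)
  have h03 : i ≠ l := hd 0 3 (by decide)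
  have h12 : j ≠ m := hd 1 2 (by decide)
  have h13 : j ≠ l := hd 1 3 (by decide)
  have h23 : m ≠ l := hd 2 3 (by decide)
  refine ⟨?_, h12, h13, h23, h01, h02, h03⟩
  ext r
  simp only [Finset.mem_erase, Finset.mem_univ, and_true, Finset.mem_insert,
    Finset.mem_singleton, ne_eq]
  omega

lemma prod_erase_of_injective {M : Type*} [CommMonoid M] {i j m l : Fin 4}
    (h : Function.Injective ![i, j, m, l]) (f : Fin 4 → M) :
    ∏ r ∈ Finset.univ.erase i, f r = f j * f m * f l := by
  obtain ⟨e, h12, h13, h23, -⟩ := erase_eq_of_injective h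
  rw [e, Finset.prod_insert (by simp [h12, h13]), Finset.prod_insert (by simp [h23]),
    Finset.prod_singleton, mul_assoc]

lemma sum_erase_of_injective {M : Type*} [AddCommMonoid M] {i j m l : Fin 4}
    (h : Function.Injective ![i, j, m, l]) (f : Fin 4 → M) :
    ∑ r ∈ Finset.univ.erase i, f r = f j + f m + f l := by
  obtain ⟨e, h12, h13, h23, -⟩ := erase_eq_of_injective h
  rw [e, Finset.sum_insert (by simp [h12, h13]), Finset.sum_insert (by simp [h23]),
    Finset.sum_singleton, add_assoc]

set_option maxRecDepth 10000 in
lemma filter_pairs_eq : ∀ i j m l : Fin 4, i ≠ j → i ≠ m → i ≠ l → j ≠ m → j ≠ l → m ≠ l →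
    (Finset.univ : Finset (Fin 4 × Fin 4)).filter
      (fun p => p.1 < p.2 ∧ p.1 ≠ i ∧ p.2 ≠ i) =
      {(min j m, max j m), (min j l, max j l), (min m l, max m l)} := by
  decide

lemma pairs_ne : ∀ i j m l : Fin 4, i ≠ j → i ≠ m → i ≠ l → j ≠ m → j ≠ l → m ≠ l →
    (min j m, max j m) ∉ ({(min j l, max j l), (min m l, max m l)} : Finset (Fin 4 × Fin 4)) ∧
    (min j l, max j l) ≠ (min m l, max m l) := by decide

lemma prod_pairs_of_injective {M : Type*} [CommMonoid M] {i j m l : Fin 4}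
    (h : Function.Injective ![i, j, m, l]) (f : Fin 4 → Fin 4 → M) (hf : ∀ p q, f p q = f q p) :
    ∏ p ∈ (Finset.univ : Finset (Fin 4 × Fin 4)).filter
      (fun p => p.1 < p.2 ∧ p.1 ≠ i ∧ p.2 ≠ i), f p.1 p.2 = f j m * f j l * f m l := by
  obtain ⟨-, h12, h13, h23, h01, h02, h03⟩ := erase_eq_of_injective h
  have hs : ∀ p q : Fin 4, f (min p q) (max p q) = f p q := by
    intro p q
    rcases le_total p q with hpq | hpq
    · rw [min_eq_left hpq, max_eq_right hpq]
    · rw [min_eq_right hpq, max_eq_left hpq, hf]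
  obtain ⟨n1, n2⟩ := pairs_ne i j m l h01 h02 h03 h12 h13 h23
  rw [filter_pairs_eq i j m l h01 h02 h03 h12 h13 h23, Finset.prod_insert n1,
    Finset.prod_insert (by simpa using n2), Finset.prod_singleton, hs, hs, hs, mul_assoc]

/-! ### The entries as combinations of y₁ and y₃. -/

namespace LinePoints

variable {k : ℝ} {xp xm y a b c d : ℂ}

lemma third_entry (P : Params k) (h : LinePoints k xp xm y a b c d) (μ : ℂ) {w : ℂ}
    (hw : theta1 (tau k) w ≠ 0) :
    1 / theta1 (tau k) w ^ 2 * (Complex.exp (w * (2 * μ)) *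
      (theta1 (tau k) w * theta1 (tau k) (w - a)
        / (theta3 (tau k) b * theta3 (tau k) c * theta3 (tau k) d))) =
      tripleQ k b c d / (ellK k * tripleD k b c d * deriv (theta1 (tau k)) 0) *
        (-(ellK k / 2 - xm) * yOne k a μ w) := by
  rw [h.third_row P, yOne]
  have hK := P.ellK_ne
  have hd := P.deriv_theta1_ne
  have hD := h.tripleD_ne
  have a1 := left_ne_zero_of_mul h.ne_a
  field_simp

lemma fourth_entry (P : Params k) (h : LinePoints k xp xm y a b c d) (μ : ℂ) {w : ℂ}
    (hw : theta1 (tau k) w ≠ 0) :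
    1 / theta1 (tau k) w ^ 2 * (Complex.exp (w * (2 * μ)) *
      (theta1 (tau k) w * theta3 (tau k) (w - a)
        / (theta1 (tau k) b * theta1 (tau k) c * theta1 (tau k) d))) =
      tripleQ k b c d / (ellK k * tripleD k b c d * deriv (theta1 (tau k)) 0) *
        ((ellK k / 2 + xm) * yThree k a μ w) := by
  rw [h.fourth_row P, yThree]
  have hK := P.ellK_ne
  have hd := P.deriv_theta1_ne
  have hD := h.tripleD_ne
  have a3 := right_ne_zero_of_mul h.ne_a
  field_simp

/-- The term -iζ_b times the third row cancels the ζ_b part of `first_row`. The outcome depends on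
b, c, d only through the common constant, hence not on the choice of j. -/
lemma first_entry (P : Params k) (h : LinePoints k xp xm y a b c d) (μ : ℂ) {w : ℂ}
    (hw : theta1 (tau k) w ≠ 0) :
    1 / theta1 (tau k) w ^ 2 * (Complex.exp (w * (2 * μ)) *
      (-Complex.I * abelZ k b * (theta1 (tau k) w * theta1 (tau k) (w - a)
        / (theta3 (tau k) b * theta3 (tau k) c * theta3 (tau k) d)) +
        theta2 (tau k) 0 * theta4 (tau k) 0 * theta3 (tau k) (b + c) * theta3 (tau k) (b + d)
        * theta3 (tau k) (w + b) * theta3 (tau k) (w - a - b)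
        / (theta3 (tau k) b * tripleD k b c d))) =
      tripleQ k b c d / (ellK k * tripleD k b c d * deriv (theta1 (tau k)) 0) *
        (rho k w / 2 * yThree k a μ w
          + (2 * y - Complex.I * (ellK k / 2 - xm) * abelZ k a) * yOne k a μ w) := by
  rw [h.third_row P, h.first_row P, yThree, yOne, rho]
  have hK := P.ellK_ne
  have hd := P.deriv_theta1_ne
  have hD := h.tripleD_ne
  have a1 := left_ne_zero_of_mul h.ne_a
  have a3 := right_ne_zero_of_mul h.ne_a
  field_simp
  ring

lemma second_entry (P : Params k) (h : LinePoints k xp xm y a b c d) (μ : ℂ) {w : ℂ}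
    (hw : theta1 (tau k) w ≠ 0) :
    1 / theta1 (tau k) w ^ 2 * (Complex.exp (w * (2 * μ)) *
      (-Complex.I * abelZ k b * (theta1 (tau k) w * theta3 (tau k) (w - a)
        / (theta1 (tau k) b * theta1 (tau k) c * theta1 (tau k) d)) +
        theta2 (tau k) 0 * theta4 (tau k) 0 * theta3 (tau k) (b + c) * theta3 (tau k) (b + d)
        * theta1 (tau k) (w + b) * theta3 (tau k) (w - a - b)
        / (theta1 (tau k) b * tripleD k b c d))) =
      tripleQ k b c d / (ellK k * tripleD k b c d * deriv (theta1 (tau k)) 0) *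
        (rho k w / 2 * yOne k a μ w
          + (2 * y + Complex.I * (ellK k / 2 + xm) * abelZ k a) * yThree k a μ w) := by
  rw [h.fourth_row P, h.second_row P, yThree, yOne, rho]
  have hK := P.ellK_ne
  have hd := P.deriv_theta1_ne
  have hD := h.tripleD_ne
  have a1 := left_ne_zero_of_mul h.ne_a
  have a3 := right_ne_zero_of_mul h.ne_a
  field_simp
  ring

end LinePoints

lemma smul_smul_vec_eq {s t u v₀ v₁ v₂ v₃ r₀ r₁ r₂ r₃ : ℂ} (h₀ : s * (t * v₀) = u * r₀)
    (h₁ : s * (t * v₁) = u * r₁) (h₂ : s * (t * v₂) = u * r₂) (h₃ : s * (t * v₃) = u * r₃) :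
    s • t • ![v₀, v₁, v₂, v₃] = u • ![r₀, r₁, r₂, r₃] := by
  ext n
  fin_cases n
  · exact h₀
  · exact h₁
  · exact h₂
  · exact h₃

/-- The entries of `θ₂(z/2)⁻² Λ̄ᵢ` at `z = 1 - 2w`, in terms of `y₁`, `y₃`. -/
lemma lambdaBar_eq {k x₁ x₂ x₃ : ℝ} (P : Params k) {N : ℤ} {ζ α : Fin 4 → ℂ} {i j m l : Fin 4}
    (hinj : Function.Injective ![i, j, m, l]) {a : ℂ}
    (h : LinePoints k (xPlus x₁ x₂) (xMinus x₁ x₂) x₃ a (α j) (α m) (α l))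
    (hζ : ζ j = abelZ k (α j)) {ξ : ℝ} (hξ : theta1 (tau k) (ξ / 2) ≠ 0) :
    (1 / theta2 (tau k) ((1 - ξ : ℝ) / 2) ^ 2) •
        lambdaBar k x₁ x₂ x₃ N ζ α i j m l (1 - ξ) =
      (tripleQ k (α j) (α m) (α l) / (ellK k * tripleD k (α j) (α m) (α l)
          * deriv (theta1 (tau k)) 0) * Complex.exp (-mu k x₁ x₂ x₃ N (ζ i) (α i))) •
        ![rho k (ξ / 2) / 2 * yThree k a (mu k x₁ x₂ x₃ N (ζ i) (α i)) (ξ / 2)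
            + (2 * x₃ - Complex.I * (ellK k / 2 - xMinus x₁ x₂) * abelZ k a)
              * yOne k a (mu k x₁ x₂ x₃ N (ζ i) (α i)) (ξ / 2),
          rho k (ξ / 2) / 2 * yOne k a (mu k x₁ x₂ x₃ N (ζ i) (α i)) (ξ / 2)
            + (2 * x₃ + Complex.I * (ellK k / 2 + xMinus x₁ x₂) * abelZ k a)
              * yThree k a (mu k x₁ x₂ x₃ N (ζ i) (α i)) (ξ / 2),
          -(ellK k / 2 - xMinus x₁ x₂) * yOne k a (mu k x₁ x₂ x₃ N (ζ i) (α i)) (ξ / 2),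
          (ellK k / 2 + xMinus x₁ x₂) * yThree k a (mu k x₁ x₂ x₃ N (ζ i) (α i)) (ξ / 2)] := by
  set μ := mu k x₁ x₂ x₃ N (ζ i) (α i) with hμ
  have e1 := h.first_entry P μ hξ
  have e2 := h.second_entry P μ hξ
  have e3 := h.third_entry P μ hξ
  have e4 := h.fourth_entry P μ hξ
  -- z/2 = 1/2 - ξ/2, so every theta function in Λ̄ᵢ is moved by a half period and becomes a θ₁ or
  -- θ₃ whose argument contains w = ξ/2.
  have hz : (((1 - ξ : ℝ) : ℝ) : ℂ) / 2 = 1 / 2 - ξ / 2 := by push_cast; ring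
  have hexp : Complex.exp (-((1 - ξ : ℝ) : ℂ) * μ) =
      Complex.exp (-μ) * Complex.exp (ξ / 2 * (2 * μ)) := by
    rw [← Complex.exp_add]; congr 1; push_cast; ring
  have hsub : ∀ s : ℂ, s - (1 / 2 - (ξ : ℂ) / 2) = (ξ / 2 + s) - 1 / 2 := fun s => by ring
  have hS : α j + α m + α l = -a := by linear_combination h.sum
  have hml : (ξ : ℂ) / 2 + (α m + α l) = ξ / 2 - a - α j := by linear_combination h.sum
  rw [lambdaBar]
  simp only [hz, hexp, ← hμ, prod_erase_of_injective hinj, sum_erase_of_injective hinj,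
    theta2_half_sub, hsub, theta2_sub_half, theta4_sub_half, hS, hml, hζ, ← sub_eq_add_neg]
  rw [show theta1 (tau k) (α j) * theta3 (tau k) (α j) * (theta1 (tau k) (α m)
    * theta3 (tau k) (α m)) * (theta1 (tau k) (α l) * theta3 (tau k) (α l))
    = tripleD k (α j) (α m) (α l) from rfl]
  refine smul_smul_vec_eq ?_ ?_ ?_ ?_
  · linear_combination Complex.exp (-μ) * e1
  · linear_combination Complex.exp (-μ) * e2
  · linear_combination Complex.exp (-μ) * e3
  · linear_combination Complex.exp (-μ) * e4

/-- By Jacobi's derivative formula and K = πθ₃²/2, the factor 4θ₂θ₄/θ₁'(0)² equals 2θ₃/(Kθ₁'(0)),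
which is the constant collected in `lambdaBar_eq` up to 2√K. -/
lemma normN_eq {k x₁ x₂ x₃ : ℝ} (P : Params k) {N : ℤ} {ζ α : Fin 4 → ℂ} {i j m l : Fin 4}
    (hinj : Function.Injective ![i, j, m, l]) :
    normN k x₁ x₂ x₃ N ζ α i = 2 * Real.sqrt (ellK k) *
      (tripleQ k (α j) (α m) (α l) / (ellK k * tripleD k (α j) (α m) (α l)
          * deriv (theta1 (tau k)) 0) * Complex.exp (-mu k x₁ x₂ x₃ N (ζ i) (α i))) := by
  rw [normN, prod_erase_of_injective hinj, prod_pairs_of_injective hinj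
    (fun p q => theta3 (tau k) (α p + α q)) (fun p q => by rw [add_comm])]
  rw [show theta1 (tau k) (α j) * theta3 (tau k) (α j) * (theta1 (tau k) (α m)
    * theta3 (tau k) (α m)) * (theta1 (tau k) (α l) * theta3 (tau k) (α l))
    = tripleD k (α j) (α m) (α l) from rfl, tripleQ]
  have hd := P.deriv_theta1_eq
  have hdne := P.deriv_theta1_ne
  have hK := P.ellK_eq
  have hKne := P.ellK_ne
  generalize theta3 (tau k) (α j + α m) * theta3 (tau k) (α j + α l)
    * theta3 (tau k) (α m + α l) = M
  generalize tripleD k (α j) (α m) (α l) = D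
  have t3 := P.theta3_ne
  have key : 4 / deriv (theta1 (tau k)) 0 ^ 2 * (theta2 (tau k) 0 * theta4 (tau k) 0) =
      2 * theta3 (tau k) 0 / (ellK k * deriv (theta1 (tau k)) 0) := by
    rw [div_mul_eq_mul_div, div_eq_div_iff (pow_ne_zero 2 hdne) (mul_ne_zero hKne hdne)]
    rw [hd, hK]
    ring
  calc _ = (4 / deriv (theta1 (tau k)) 0 ^ 2 * (theta2 (tau k) 0 * theta4 (tau k) 0))
        * (Real.sqrt (ellK k) * (M / D) * Complex.exp (-mu k x₁ x₂ x₃ N (ζ i) (α i))) := by ring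
    _ = _ := by
      rw [key]
      field_simp

/-! ### The expansion of `v̄ᵢ` -/

/-- The four entries of `ξ^{3/2} v̄ᵢ / Nᵢ` as analytic germs in `w = ξ/2`. -/
def entryGerm (k : ℝ) (xm y a μ p : ℂ) : Fin 4 → ℂ → ℂ :=
  ![fun w => 1 / (2 * ellK k) * (gaugeRoot k w * ((w * (p * diffGerm k a μ w)
      - Complex.I * ellK k * abelZ k a * sumGerm k a μ w + rhoGerm k w * diffGerm k a μ w)
      - 2 * y * (w * diffGerm k a μ w))),
    fun w => 1 / 2 * ((gaugeRoot k w)⁻¹ * ((rhoGerm k w * sumGerm k a μ w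
      - w * (p * sumGerm k a μ w)
      + w * (w * (Complex.I * ellK k * abelZ k a * diffGerm k a μ w)))
      + 2 * y * (w * sumGerm k a μ w))),
    fun w => -(1 / (2 * ellK k)) * (gaugeRoot k w * (ellK k * sumGerm k a μ w
      + 2 * xm * (w * diffGerm k a μ w))),
    fun w => 1 / 2 * (w * ((gaugeRoot k w)⁻¹ * (ellK k * (w * diffGerm k a μ w)
      + 2 * xm * sumGerm k a μ w)))]

lemma rpow_neg_three_halves {ξ : ℝ} (hξ : 0 < ξ) :
    ξ ^ (-(3 / 2) : ℝ) = (Real.sqrt ξ ^ 3)⁻¹ := by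
  rw [Real.rpow_neg hξ.le, Real.sqrt_eq_rpow, ← Real.rpow_natCast, ← Real.rpow_mul hξ.le]
  norm_num

/-- By `exp_gauge` the factors e^{±∫f₃/2} are `gaugeRoot`^{±1} times (Kξ/2)^{∓1/2}. Together with
the poles of ρ and y₁ + y₃ all half-integer powers combine to ξ^{-3/2}, and an analytic germ in w
remains. -/
theorem Params.vBar_eq {k x₁ x₂ x₃ : ℝ} (P : Params k) {N : ℤ} {ζ α : Fin 4 → ℂ} {i j m l : Fin 4}
    (hinj : Function.Injective ![i, j, m, l]) {a : ℂ}
    (h : LinePoints k (xPlus x₁ x₂) (xMinus x₁ x₂) x₃ a (α j) (α m) (α l))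
    (hζ : ζ j = abelZ k (α j)) {ξ : ℝ} (h0 : 0 < ξ) (h1 : ξ ≤ 1) (n : Fin 4) :
    vBar k x₁ x₂ x₃ N ζ α i j m l (1 - ξ) n = normN k x₁ x₂ x₃ N ζ α i *
      ((ξ ^ (-(3 / 2) : ℝ) : ℝ) * entryGerm k (xMinus x₁ x₂) x₃ a
        (mu k x₁ x₂ x₃ N (ζ i) (α i))
        (-2 * Complex.I * xMinus x₁ x₂ * abelZ k a - 2 * x₃) n (ξ / 2)) := by
  have hw1 : theta1 (tau k) (ξ / 2) ≠ 0 := by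
    have := theta1_ne_zero P.T_pos (ξ / 2) (by linarith) (by linarith)
    rw [← P.tau_eq] at this
    push_cast at this
    exact this
  have hξ : (ξ : ℂ) / 2 ≠ 0 := by
    have : (ξ : ℂ) ≠ 0 := by exact_mod_cast h0.ne'
    exact div_ne_zero this two_ne_zero
  have hS := P.exp_gauge h0 h1
  have hKpos := P.ellK_pos
  rw [vBar, lambdaBar_eq P hinj h hζ hw1, orthO_mul_inv_gaugeC, oneTensor_mulVec,
    normN_eq P hinj, rpow_neg_three_halves h0]
  have eG := sumGerm_eq (k := k) (a := a) (μ := mu k x₁ x₂ x₃ N (ζ i) (α i)) hξ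
  have eW := diffGerm_eq h.ne_a (mu k x₁ x₂ x₃ N (ζ i) (α i)) hξ
  have eR := rhoGerm_eq (k := k) hξ
  have hsq : Real.sqrt (ellK k * ξ / 2) = Real.sqrt (ellK k) * Real.sqrt ξ / Real.sqrt 2 := by
    rw [Real.sqrt_div (by positivity), Real.sqrt_mul hKpos.le]
  have hK2 : (ellK k : ℂ) = (Real.sqrt (ellK k) : ℂ) ^ 2 := by
    exact_mod_cast (Real.sq_sqrt hKpos.le).symm
  have hξ2 : (ξ : ℂ) = (Real.sqrt ξ : ℂ) ^ 2 := by
    exact_mod_cast (Real.sq_sqrt h0.le).symm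
  have hr2 : (Real.sqrt 2 : ℂ) ^ 2 = 2 := by
    exact_mod_cast Real.sq_sqrt (by norm_num : (0 : ℝ) ≤ 2)
  have nh : (Real.sqrt (ellK k) : ℂ) ≠ 0 := by exact_mod_cast (Real.sqrt_pos.mpr hKpos).ne'
  have ns : (Real.sqrt ξ : ℂ) ≠ 0 := by exact_mod_cast (Real.sqrt_pos.mpr h0).ne'
  have nr : (Real.sqrt 2 : ℂ) ≠ 0 := by
    exact_mod_cast (Real.sqrt_pos.mpr (by norm_num : (0 : ℝ) < 2)).ne'
  have ne := Complex.exp_ne_zero ((∫ s in (0 : ℝ)..(1 - ξ), nahmF3 k s) / 2)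
  rw [hsq] at hS
  push_cast at hS ⊢
  generalize Complex.exp ((∫ s in (0 : ℝ)..(1 - ξ), nahmF3 k s) / 2) = e at *
  generalize tripleQ k (α j) (α m) (α l) / (ellK k * tripleD k (α j) (α m) (α l)
    * deriv (theta1 (tau k)) 0) * Complex.exp (-mu k x₁ x₂ x₃ N (ζ i) (α i)) = C at *
  generalize mu k x₁ x₂ x₃ N (ζ i) (α i) = μ at *
  fin_cases n
  all_goals
    simp only [entryGerm, Matrix.smul_apply, Pi.smul_apply, smul_eq_mul, Matrix.of_apply,
      Matrix.cons_val', Matrix.cons_val_zero, Matrix.cons_val_one, Matrix.cons_val,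
      Fin.zero_eta, Fin.mk_one, Fin.reduceFinMk]
    rw [eG, eW, ← hS]
  · rw [eR]
    generalize yOne k a μ _ = y1 at *
    generalize yThree k a μ _ = y3 at *
    generalize rho k _ = ρ at *
    rw [hK2, hξ2]
    generalize (Real.sqrt (ellK k) : ℂ) = κ at *
    generalize (Real.sqrt ξ : ℂ) = s at *
    generalize (Real.sqrt 2 : ℂ) = r at *
    field_simp
    ring
  · rw [eR]
    generalize yOne k a μ _ = y1 at *
    generalize yThree k a μ _ = y3 at *
    generalize rho k _ = ρ at *
    rw [hK2, hξ2]
    generalize (Real.sqrt (ellK k) : ℂ) = κ at *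
    generalize (Real.sqrt ξ : ℂ) = s at *
    generalize (Real.sqrt 2 : ℂ) = r at *
    field_simp
    rw [hr2]
    ring
  · generalize yOne k a μ _ = y1 at *
    generalize yThree k a μ _ = y3 at *
    rw [hK2, hξ2]
    generalize (Real.sqrt (ellK k) : ℂ) = κ at *
    generalize (Real.sqrt ξ : ℂ) = s at *
    generalize (Real.sqrt 2 : ℂ) = r at *
    field_simp
    ring
  · generalize yOne k a μ _ = y1 at *
    generalize yThree k a μ _ = y3 at *
    rw [hK2, hξ2]
    generalize (Real.sqrt (ellK k) : ℂ) = κ at *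
    generalize (Real.sqrt ξ : ℂ) = s at *
    generalize (Real.sqrt 2 : ℂ) = r at *
    field_simp
    rw [hr2]
    ring

section Expansion

variable {k x₁ x₂ x₃ : ℝ} (P : Params k) {a μ : ℂ}

include P in
lemma Params.lam_eq : lam k = -((ellK k : ℂ) ^ 2 * ((k : ℂ) ^ 2 - (compl k : ℂ) ^ 2) / 8) := by
  rw [lam]
  linear_combination -(ellK k : ℂ) ^ 2 / 8 * P.k_sq_add

lemma xPlus_mul_xMinus (x₁ x₂ : ℝ) : xPlus x₁ x₂ * xMinus x₁ x₂ = (x₁ : ℂ) ^ 2 + (x₂ : ℂ) ^ 2 := by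
  rw [xPlus, xMinus]
  linear_combination -(x₂ : ℂ) ^ 2 * Complex.I_sq

include P in
/-- The expansions of the four entries. -/
theorem Params.expands_entryGerm (ha : theta1 (tau k) a * theta3 (tau k) a ≠ 0)
    (hη : abelH k a = quad (xPlus x₁ x₂) (xMinus x₁ x₂) x₃ (abelZ k a))
    (hμ : 2 * μ = 2 * beta1 k a + (-2 * Complex.I * xMinus x₁ x₂ * abelZ k a - 2 * x₃))
    (n : Fin 4) :
    Expands (entryGerm k (xMinus x₁ x₂) x₃ a μ
        (-2 * Complex.I * xMinus x₁ x₂ * abelZ k a - 2 * x₃) n)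
      (poleVec0 n) (2 * poleVec1 x₁ x₂ x₃ n)
      (4 * finiteVec k x₁ x₂ x₃ (abelZ k a) (firstEntryB k x₁ x₂ x₃ (abelZ k a)) n) := by
  have hG := P.expands_sumGerm ha hμ
  have hW := P.expands_diffGerm ha hμ
  have hR := P.expands_rhoGerm
  have hS := P.expands_gaugeRoot
  have hS' := P.expands_inv_gaugeRoot
  have hK := P.ellK_ne
  have hlam := P.lam_eq
  have hxx := xPlus_mul_xMinus x₁ x₂
  have hp1 : poleVec1 x₁ x₂ x₃ = ![-xPlus x₁ x₂, (x₃ : ℂ), x₃, xMinus x₁ x₂] := by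
    rw [poleVec1, xPlus, xMinus]
    congr 1
    ring
  have hR' : bigR k x₁ x₂ x₃ = xPlus x₁ x₂ * xMinus x₁ x₂ - 2 * (x₃ : ℂ) ^ 2 + 2 * lam k := by
    rw [bigR, hxx]; ring
  rw [hη, quad] at hW
  rw [hp1]
  simp only [firstEntryB, finiteVec, poleVec0, hR', bigX, hlam]
  clear hμ hη hxx hp1 hR' hlam
  have i2 : Complex.I ^ 2 = -1 := Complex.I_sq
  have i3 : Complex.I ^ 3 = -Complex.I := Complex.I_pow_three
  have i4 : Complex.I ^ 4 = 1 := Complex.I_pow_four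
  have i5 : Complex.I ^ 5 = Complex.I := by rw [pow_succ, i4, one_mul]
  -- In each case `e` multiplies the expansions of the factors in the order of `entryGerm`. The
  -- factors 2 and 4 in the goal come from w = ξ/2, and reducing powers of i leaves polynomial
  -- identities in ζ, x₊, x₋, x₃.
  fin_cases n
  · have e := (hS.mul ((((hW.const_mul (-2 * Complex.I * xMinus x₁ x₂ * abelZ k a - 2 * x₃)).id_mul.sub
      (hG.const_mul (Complex.I * ellK k * abelZ k a))).add (hR.mul hW)).sub
      (hW.id_mul.const_mul (2 * x₃)))).const_mul (1 / (2 * ellK k))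
    refine e.cast ?_ ?_ ?_ <;>
      simp only [Matrix.cons_val_zero, Matrix.cons_val_one, Matrix.cons_val, Fin.zero_eta,
        Fin.mk_one, Fin.reduceFinMk] <;> field_simp <;> ring_nf <;>
      simp only [i2, i3, i4, i5] <;> ring
  · have e := (hS'.mul (((hR.mul hG).sub
      (hG.const_mul (-2 * Complex.I * xMinus x₁ x₂ * abelZ k a - 2 * x₃)).id_mul).add
      (hW.const_mul (Complex.I * ellK k * abelZ k a)).id_mul.id_mul |>.add
      (hG.id_mul.const_mul (2 * x₃)))).const_mul (1 / 2)
    refine e.cast ?_ ?_ ?_ <;>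
      simp only [Matrix.cons_val_zero, Matrix.cons_val_one, Matrix.cons_val, Fin.zero_eta,
        Fin.mk_one, Fin.reduceFinMk] <;> ring_nf <;>
      simp only [i2, i3, i4, i5] <;> ring
  · have e := (hS.mul ((hG.const_mul (ellK k : ℂ)).add
      (hW.id_mul.const_mul (2 * xMinus x₁ x₂)))).const_mul (-(1 / (2 * ellK k)))
    refine e.cast ?_ ?_ ?_ <;>
      simp only [Matrix.cons_val_zero, Matrix.cons_val_one, Matrix.cons_val, Fin.zero_eta,
        Fin.mk_one, Fin.reduceFinMk] <;> field_simp <;> ring_nf <;>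
      simp only [i2, i3, i4, i5] <;> ring
  · have e := (hS'.mul ((hW.id_mul.const_mul (ellK k : ℂ)).add
      (hG.const_mul (2 * xMinus x₁ x₂)))).id_mul.const_mul (1 / 2)
    refine e.cast ?_ ?_ ?_ <;>
      simp only [Matrix.cons_val_zero, Matrix.cons_val_one, Matrix.cons_val, Fin.zero_eta,
        Fin.mk_one, Fin.reduceFinMk] <;> ring

end Expansion

/-- The two forms differ by i times the divided difference of the quartic at w and u. -/
lemma firstEntryA_eq {k x₁ x₂ x₃ : ℝ} (P : Params k) {w u : ℂ}
    (h : quarticDD k (xPlus x₁ x₂) (xMinus x₁ x₂) x₃ w u = 0) :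
    firstEntryA k x₁ x₂ x₃ w u = firstEntryB k x₁ x₂ x₃ w := by
  rw [quarticDD] at h
  rw [firstEntryA, firstEntryB, bigR, ← xPlus_mul_xMinus, P.lam_eq, bigX]
  linear_combination Complex.I * h - (4 * x₃ * xMinus x₁ x₂ * (w ^ 2 + w * u + u ^ 2)
    + 4 * x₃ * xPlus x₁ x₂) * Complex.I_sq

/-- Multiplied by ζᵢ, the difference of the two forms is i times the quartic evaluated at its root
ζᵢ. -/
lemma firstEntryC_eq {k x₁ x₂ x₃ : ℝ} (P : Params k) {z₁ z₂ z₃ z₄ : ℂ} (hz : z₁ ≠ 0)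
    (h : IsQuadruple k (xPlus x₁ x₂) (xMinus x₁ x₂) x₃ z₁ z₂ z₃ z₄) :
    firstEntryC k x₁ x₂ x₃ z₁ = firstEntryB k x₁ x₂ x₃ z₁ := by
  have h1 := h.esymm1
  have h2 := h.esymm2
  have h3 := h.esymm3
  have h4 := h.esymm4
  rw [firstEntryC, firstEntryB, bigR, ← xPlus_mul_xMinus, P.lam_eq, bigX]
  apply mul_right_cancel₀ hz
  rw [sub_mul, mul_assoc (Complex.I / 4), div_mul_cancel₀ _ hz]
  linear_combination Complex.I * (h4 + z₁ * h3 + z₁ ^ 2 * h2 + z₁ ^ 3 * h1)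
    - (4 * x₃ * xMinus x₁ x₂ * z₁ ^ 3 + 4 * x₃ * xPlus x₁ x₂ * z₁) * Complex.I_sq

/-- The Abel images, with `αᵢ` moved by `-Nτ`, form the points of a mini-twistor line. -/
theorem Params.linePoints {k x₁ x₂ x₃ : ℝ} (P : Params k) {ζ α : Fin 4 → ℂ} {N : ℤ}
    (hζ : (atiyahWard k x₁ x₂ x₃).roots = Multiset.map ζ Finset.univ.val)
    (hα : ∀ r, IsAbelImage k (ζ r) ((twistor x₁ x₂ x₃).eval (ζ r)) (α r))
    (hN : ∑ r, α r = (N : ℂ) * tau k) {i j m l : Fin 4}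
    (hinj : Function.Injective ![i, j, m, l]) :
    LinePoints k (xPlus x₁ x₂) (xMinus x₁ x₂) x₃ (α i + (-N : ℤ) * tau k) (α j) (α m) (α l) := by
  have hr : ∀ r, theta1 (tau k) (α r) * theta3 (tau k) (α r) ≠ 0 ∧ ζ r = abelZ k (α r) ∧
      quad (xPlus x₁ x₂) (xMinus x₁ x₂) x₃ (ζ r) = abelH k (α r) := fun r => by
    rw [← twistor_eval]; exact P.abelImage (hα r)
  have hη : ∀ r, abelH k (α r) = quad (xPlus x₁ x₂) (xMinus x₁ x₂) x₃ (abelZ k (α r)) :=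
    fun r => by rw [← (hr r).2.1]; exact (hr r).2.2.symm
  have hq := isQuadruple_of_roots hζ hinj
  have hz := root_ne_zero hq
  rw [(hr i).2.1] at hz
  rw [(hr i).2.1, (hr j).2.1, (hr m).2.1, (hr l).2.1] at hq
  obtain ⟨s1, s2, s3, -⟩ := P.add_int_mul_tau (-N) (hr i).1
  rw [sum_univ_of_injective hinj] at hN
  refine ⟨?_, s1, (hr j).1, (hr m).1, (hr l).1, ?_, hη j, hη m, hη l, ?_, ?_⟩
  · push_cast
    linear_combination hN
  · rw [s2, s3]; exact hη i
  · rwa [s2]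
  · rwa [s2]

/-- The summand iπN of μ is exactly the jump of β₁ under the shift by -Nτ. What remains is p =
-2ix₋ζ - 2x₃, the constant in the differential equations of y₁ and y₃. -/
lemma Params.two_mul_mu {k x₁ x₂ x₃ : ℝ} (P : Params k) {N : ℤ} {α : ℂ}
    (h : theta1 (tau k) α * theta3 (tau k) α ≠ 0) :
    2 * mu k x₁ x₂ x₃ N (abelZ k α) α = 2 * beta1 k (α + (-N : ℤ) * tau k)
      + (-2 * Complex.I * xMinus x₁ x₂ * abelZ k (α + (-N : ℤ) * tau k) - 2 * x₃) := by
  obtain ⟨-, s2, -, s4⟩ := P.add_int_mul_tau (-N) h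
  rw [s4, s2, mu, xMinus]
  push_cast
  linear_combination 2 * x₃ * Complex.I_sq

end Monopole

end

/-! ### Assembly of the expansion. -/

theorem theorem7p2 (k : ℝ) (hk0 : 0 < k) (hk1 : k < 1) (x₁ x₂ x₃ : ℝ)
    (ζ α : Fin 4 → ℂ) (N : ℤ)
    (hζ : (Monopole.atiyahWard k x₁ x₂ x₃).roots = Multiset.map ζ Finset.univ.val)
    (hα : ∀ r, Monopole.IsAbelImage k (ζ r)
      ((Monopole.twistor x₁ x₂ x₃).eval (ζ r)) (α r))
    (hN : ∑ r, α r = (N : ℂ) * Monopole.tau k)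
    (i j m l : Fin 4) (hijml : Function.Injective ![i, j, m, l]) :
    Monopole.normN k x₁ x₂ x₃ N ζ α i ≠ 0 ∧
    ∃ v₃ : Fin 4 → ℂ,
      ((fun ξ : ℝ => Monopole.vBar k x₁ x₂ x₃ N ζ α i j m l (1 - ξ)
          - Monopole.normN k x₁ x₂ x₃ N ζ α i •
            ((ξ ^ (-(3 / 2) : ℝ)) • Monopole.poleVec0
              + (ξ ^ (-(1 / 2) : ℝ)) • Monopole.poleVec1 x₁ x₂ x₃
              + (ξ ^ (1 / 2 : ℝ)) • ((Monopole.normN k x₁ x₂ x₃ N ζ α i)⁻¹ • v₃)))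
        =O[𝓝[>] (0 : ℝ)] (fun ξ : ℝ => ξ ^ (3 / 2 : ℝ))) ∧
      (∀ j' : Fin 4, j' ≠ i →
        (Monopole.normN k x₁ x₂ x₃ N ζ α i)⁻¹ • v₃ =
          Monopole.finiteVec k x₁ x₂ x₃ (ζ i)
            (Monopole.firstEntryA k x₁ x₂ x₃ (ζ i) (ζ j'))) ∧
      (Monopole.normN k x₁ x₂ x₃ N ζ α i)⁻¹ • v₃ =
        Monopole.finiteVec k x₁ x₂ x₃ (ζ i) (Monopole.firstEntryB k x₁ x₂ x₃ (ζ i)) ∧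
      (Monopole.normN k x₁ x₂ x₃ N ζ α i)⁻¹ • v₃ =
        Monopole.finiteVec k x₁ x₂ x₃ (ζ i) (Monopole.firstEntryC k x₁ x₂ x₃ (ζ i)) := by
  obtain ⟨P⟩ := Monopole.nonempty_params hk0 hk1
  have h := P.linePoints hζ hα hN hijml
  have hq := Monopole.isQuadruple_of_roots hζ hijml
  obtain ⟨hne, hζi, -⟩ := P.abelImage (hα i)
  have hζj := (P.abelImage (hα j)).2.1
  -- The shift by -Nτ changes the Abel image but not the point of the curve.
  have hZ : Monopole.abelZ k (α i + (-N : ℤ) * Monopole.tau k) = ζ i :=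
    (P.add_int_mul_tau (-N) hne).2.1.trans hζi.symm
  have hμ := P.two_mul_mu (x₁ := x₁) (x₂ := x₂) (x₃ := x₃) (N := N) hne
  rw [← hζi] at hμ
  have hN0 : Monopole.normN k x₁ x₂ x₃ N ζ α i ≠ 0 := by
    rw [Monopole.normN_eq P hijml]
    refine mul_ne_zero (mul_ne_zero two_ne_zero ?_) (mul_ne_zero (div_ne_zero (h.tripleQ_ne P)
      (mul_ne_zero (mul_ne_zero P.ellK_ne h.tripleD_ne) P.deriv_theta1_ne))
      (Complex.exp_ne_zero _))
    exact_mod_cast (Real.sqrt_pos.mpr P.ellK_pos).ne'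
  -- The witness carries the second form of the first entry, which involves ζᵢ alone and no
  -- division; the other two forms are compared with it.
  refine ⟨hN0, Monopole.normN k x₁ x₂ x₃ N ζ α i • Monopole.finiteVec k x₁ x₂ x₃ (ζ i)
    (Monopole.firstEntryB k x₁ x₂ x₃ (ζ i)), ?_⟩
  rw [inv_smul_smul₀ hN0]
  refine ⟨?_, ?_, rfl, ?_⟩
  · rw [Asymptotics.isBigO_pi]
    intro n
    have e := (P.expands_entryGerm h.ne_a h.eta_a hμ n).isBigO_rpow.const_mul_left
      (Monopole.normN k x₁ x₂ x₃ N ζ α i)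
    refine e.congr' ?_ EventuallyEq.rfl
    filter_upwards [Ioo_mem_nhdsGT (zero_lt_one' ℝ)] with ξ hξ
    have hv := P.vBar_eq hijml h hζj hξ.1 hξ.2.le n (N := N)
    simp only [Pi.sub_apply, Pi.smul_apply, Pi.add_apply, smul_eq_mul, Complex.real_smul]
    rw [hv, hZ]
    ring
  · intro j' hj'
    have hj : j' = j ∨ j' = m ∨ j' = l := by
      have := (Monopole.erase_eq_of_injective hijml).1
      have hmem : j' ∈ (Finset.univ : Finset (Fin 4)).erase i := by simpa using hj'
      rw [this] at hmem
      simpa using hmem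
    rcases hj with rfl | rfl | rfl
    · rw [Monopole.firstEntryA_eq P hq.quarticDD12]
    · rw [Monopole.firstEntryA_eq P hq.quarticDD13]
    · rw [Monopole.firstEntryA_eq P hq.quarticDD14]
  · rw [Monopole.firstEntryC_eq P (Monopole.root_ne_zero hq) hq]
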